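/- **Setting.** Let $r\ge 0$, let $\mathcal X\subseteq[0,r]^d$ be compact and non-empty, and let $\eta\ge 1/2$ be a noise level. Let $\kappa$ be a continuous positive semidefinite kernel on $\mathbb R^d$. For $A\subseteq\mathcal X$ (or $A=[0,r]^d$) let $$I_n(A)=\sup_{x_1,\dots,x_n\in A} I(F+\varepsilon;F),\qquad F\sim N\big(0,(\kappa(x_i,x_j))_{ij}\big),\quad \varepsilon\sim N(0,\eta^2 I)\text{ independent of }F,$$ where $I(X;Y)=H(X)-H(X\mid Y)$ is mutual information (points may be repeated). Assume that $\kappa$ is the linear kernel, a squared exponential kernel, a Matérn kernel with smoothness $\nu>d/2$, or any other such kernel with $I_n([0,r]^d)=o(\sqrt n)$. Let $f,f_c:\mathcal X\to\mathbb R$. A direct query at $x$ costs $\lambda_l$ and returns $f(x)+\varepsilon$, where $|\varepsilon|\le\eta$ and $\varepsilon$ has mean $0$ conditionally on the past. A comparison at $x$ costs $\lambda_c$, with $0<\lambda_c<\lambda_l$: an opponent $x'$ is drawn from a fixed probability distribution on $\mathcal X$ (for instance the uniform one), independently of the past, and $z\in\{0,1\}$ is returned, with $z=1$ with probability $\Pr[x\succ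 x']$. Let $f_r(x)=\Pr[x\succ X]$ be the Borda function, where $X$ has that distribution. Write $g^*=\sup_{\mathcal X}g$. Assume that * $f$ and $f_r$ belong to the reproducing kernel Hilbert space of $\kappa$ on $\mathcal X$, with norms at most $B$; * $\frac1{L_1}(f_c^*-f_c(x))\le f_r^*-f_r(x)\le L_2(f_c^*-f_c(x))$ for all $x\in\mathcal X$, where $L_1,L_2>0$; * $|(f_c^*-f_c(x))-(f^*-f(x))|\le\zeta$ for all $x\in\mathcal X$. Let $\gamma>0$, $0<\delta<1$ and $\mathcal H^\gamma=\{x\in\mathcal X: f_r(x)\ge f_r^*-L_2\zeta-4\gamma\}$. For $t\ge1$ put $$\beta^{(r)}_t=2B+\sqrt{2\big(I_{t-1}(\mathcal X)+1+\log(1/\delta)\big)},\qquad \beta_t=2B+\sqrt{2\big(I_{t-1}(\mathcal H^\gamma)+1+\log(1/\delta)\big)}.$$ **Algorithm (COMP-GP-UCB with known $\zeta$).** Let $\mu^{(r)}_t,\sigma^{(r)}_t$ (resp. $\mu^{(l)}_t,\sigma^{(l)}_t$) be the Gaussian process posterior mean and standard deviation, with prior covariance $\kappa$ and noise variance $\eta^2$,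 computed from the comparison results $z$ (resp. the direct-query results) of the first $t$ steps. Phase 1: for $t=1,2,\dots$ make a comparison at $x_t\in\arg\max_{x\in\mathcal X}\big(\mu^{(r)}_{t-1}(x)+\beta^{(r)}_t\sigma^{(r)}_{t-1}(x)\big)$, up to and including the first step $T$ with $\beta^{(r)}_T\sigma^{(r)}_{T-1}(x_T)\le\gamma$; then set $\hat f_r=\mu^{(r)}_{T-1}(x_T)-\beta^{(r)}_T\sigma^{(r)}_{T-1}(x_T)$. Phase 2: for $t>T$, let $x_t$ maximize $\mu^{(l)}_{t-1}(x)+\beta_t\sigma^{(l)}_{t-1}(x)$ over the $x\in\mathcal X$ with $\mu^{(r)}_{t-1}(x)+\beta^{(r)}_t\sigma^{(r)}_{t-1}(x)-\hat f_r+L_2\zeta\ge0$ (if there is no such $x$, then $x_t\in\mathcal X$ is arbitrary); make a comparison at $x_t$ if $\beta^{(r)}_t\sigma^{(r)}_{t-1}(x_t)\ge\gamma$, and a direct query otherwise. Under the budget $\Lambda$ the run stops when the next query no longer fits into the budget. The simple regret $S(\Lambda)$ is the minimum over the steps made of $f^*-f(x_t)$ (direct query) or $\min\{f^*-f(x_t),f^*-f(x'_t)\}$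 (comparison with the opponent $x'_t$). **Theorem.** Let $\overline n_\Lambda=\lceil\Lambda/\lambda_c\rceil$ and $\underline n_\Lambda=\lfloor\Lambda/\lambda_l\rfloor$. There are a constant $C>0$ that depends only on $\zeta,\gamma,B,d,\kappa,r,\eta$ and a $\Lambda_0$ that depends only on these and on $\delta,\lambda_c,\lambda_l$ such that, with probability at least $1-\delta$, for all $\Lambda\ge\Lambda_0$ we have $S(\Lambda)\le\min\{S_1,S_2\}$, where $$S_1=2L_1\gamma+\zeta+C\Big(B+\sqrt{I_{\overline n_\Lambda}(\mathcal X)+\log(1/\delta)}\Big)\sqrt{\frac{I_{\overline n_\Lambda}(\mathcal X)}{\overline n_\Lambda}},$$ $$S_2=C\Big(B+\sqrt{I_{\underline n_\Lambda}(\mathcal H^\gamma)+\log(1/\delta)}\Big)\sqrt{\frac{I_{\underline n_\Lambda}(\mathcal H^\gamma)}{\underline n_\Lambda}}.$$ -/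

import Mathlib

open MeasureTheory ProbabilityTheory Filter Asymptotics
open scoped Matrix

namespace DuelingChoice

noncomputable section

/-- The ambient Euclidean space of the feature space. -/
abbrev Pt (d : ℕ) : Type := EuclideanSpace ℝ (Fin d)

/-- The cube `[0, r]^d`. -/
def box (d : ℕ) (r : ℝ) : Set (Pt d) := {x | ∀ i, 0 ≤ x i ∧ x i ≤ r}

/-- The supremum of `g` over `X`, written `g^*`. -/
def supOn {α : Type*} (X : Set α) (g : α → ℝ) : ℝ := sSup (g '' X)

/-! ### Kernels -/

/-- The linear kernel `⟨x, y⟩`. -/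
def linearKernel (d : ℕ) (x y : Pt d) : ℝ := inner ℝ x y

/-- The squared exponential kernel with length scale `ℓ`. -/
def seKernel (d : ℕ) (ℓ : ℝ) (x y : Pt d) : ℝ := Real.exp (-‖x - y‖ ^ 2 / (2 * ℓ ^ 2))

/-- The modified Bessel function of the second kind `K_ν(z)`, for `z > 0`, through the integral
`K_ν(z) = (1/2) (z/2)^ν ∫_0^∞ exp(-t - z^2/(4t)) t^(-ν-1) dt`. -/
def besselSecond (ν z : ℝ) : ℝ :=
  1 / 2 * (z / 2) ^ ν * ∫ t in Set.Ioi (0 : ℝ), Real.exp (-t - z ^ 2 / (4 * t)) * t ^ (-ν - 1)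

open Classical in
/-- The Matérn kernel with smoothness `ν` and length scale `ρ` (continuously extended by `1` to
the diagonal). -/
def maternKernel (d : ℕ) (ν ρ : ℝ) (x y : Pt d) : ℝ :=
  if x = y then 1
  else (2 : ℝ) ^ (1 - ν) / Real.Gamma ν * (√(2 * ν) * ‖x - y‖ / ρ) ^ ν *
    besselSecond ν (√(2 * ν) * ‖x - y‖ / ρ)

/-- The matrix `(κ (x i) (x j))` of the points `x i`. -/
def gram {d : ℕ} (κ : Pt d → Pt d → ℝ) {ι : Type*} (x : ι → Pt d) : Matrix ι ι ℝ :=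
  Matrix.of fun i j => κ (x i) (x j)

/-- The restriction of `g` to `X` belongs to the reproducing kernel Hilbert space of functions on
`X` with kernel `κ`, with norm at most `B`. -/
def InRKHSBall {d : ℕ} (κ : Pt d → Pt d → ℝ) (X : Set (Pt d)) (B : ℝ) (g : Pt d → ℝ) : Prop :=
  ∃ (H : Type) (_ : NormedAddCommGroup H) (_ : InnerProductSpace ℝ H) (_ : CompleteSpace H)
    (_ : RKHS ℝ H X ℝ) (h : H),
    (∀ x y : X, RKHS.kernel H x y (1 : ℝ) = κ x y) ∧ (∀ x : X, h x = g x) ∧ ‖h‖ ≤ B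

/-! ### Information gain -/

/-- Differential entropy `-∫ p log p` of a law with Lebesgue density `p`. -/
def diffEntropy {n : ℕ} (m : Measure (EuclideanSpace ℝ (Fin n))) : ℝ :=
  -∫ z, Real.log (m.rnDeriv volume z).toReal ∂m

/-- The law of the noise vector shifted by `v`, that is `N(v, η^2 I)`. -/
def noiseLaw (η : ℝ) {n : ℕ} (v : EuclideanSpace ℝ (Fin n)) :
    Measure (EuclideanSpace ℝ (Fin n)) :=
  multivariateGaussian v (η ^ 2 • (1 : Matrix (Fin n) (Fin n) ℝ))

/-- The law of the vector of prior function values `(g (x i))_i` for `g` drawn from the centred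
Gaussian process with covariance `κ`. -/
def priorLaw {d : ℕ} (κ : Pt d → Pt d → ℝ) {n : ℕ} (x : Fin n → Pt d) :
    Measure (EuclideanSpace ℝ (Fin n)) :=
  multivariateGaussian 0 (gram κ x)

/-- The mutual information `I(F + ε; F) = H(F + ε) - H(F + ε | F)` of the prior function values
`F` at the points `x` and their observations `F + ε` with independent noise `ε ~ N(0, η^2 I)`:
given `F = v`, the law of `F + ε` is `N(v, η^2 I)`. -/
def mutualInformation {d : ℕ} (κ : Pt d → Pt d → ℝ) (η : ℝ) {n : ℕ} (x : Fin n → Pt d) : ℝ :=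
  diffEntropy ((priorLaw κ x).conv (noiseLaw η 0)) -
    ∫ v, diffEntropy (noiseLaw η v) ∂(priorLaw κ x)

/-- Maximum information gain of `n` evaluations in `A` (points may be evaluated repeatedly). -/
def infoGain {d : ℕ} (κ : Pt d → Pt d → ℝ) (η : ℝ) (n : ℕ) (A : Set (Pt d)) : ℝ :=
  sSup {v | ∃ x : Fin n → Pt d, (∀ i, x i ∈ A) ∧ v = mutualInformation κ η x}

/-- The kernels considered: linear, squared exponential, Matérn of smoothness `ν > d/2`, or any
other kernel whose information gain on the cube is of smaller order than `√n`. -/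
def AdmissibleKernel (d : ℕ) (r η : ℝ) (κ : Pt d → Pt d → ℝ) : Prop :=
  κ = linearKernel d ∨
  (∃ ℓ : ℝ, 0 < ℓ ∧ κ = seKernel d ℓ) ∨
  (∃ ν ρ : ℝ, (d : ℝ) / 2 < ν ∧ 0 < ρ ∧ κ = maternKernel d ν ρ) ∨
  (fun n : ℕ => infoGain κ η n (box d r)) =o[atTop] (fun n : ℕ => √(n : ℝ))

/-! ### Gaussian process posterior -/

/-- Posterior mean at `p` from the observations `y s` at the points `x s`, `s ∈ S`. -/
def postMean {d : ℕ} (κ : Pt d → Pt d → ℝ) (η : ℝ) (S : Finset ℕ) (x : ℕ → Pt d) (y : ℕ → ℝ)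
    (p : Pt d) : ℝ :=
  (fun i : S => κ p (x i)) ⬝ᵥ
    ((gram κ (fun i : S => x i) + η ^ 2 • (1 : Matrix S S ℝ))⁻¹ *ᵥ fun i : S => y i)

/-- Posterior standard deviation at `p` from observations at the points `x s`, `s ∈ S`. -/
def postStd {d : ℕ} (κ : Pt d → Pt d → ℝ) (η : ℝ) (S : Finset ℕ) (x : ℕ → Pt d)
    (p : Pt d) : ℝ :=
  √(κ p p - (fun i : S => κ p (x i)) ⬝ᵥ
    ((gram κ (fun i : S => x i) + η ^ 2 • (1 : Matrix S S ℝ))⁻¹ *ᵥ fun i : S => κ p (x i)))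

/-! ### The algorithm

Steps are numbered `0, 1, 2, …`; step `t` uses the feedback of the steps before `t`. -/

/-- The two types of queries. -/
inductive Query : Type
  | comp
  | label

open Classical in
/-- The steps before `t` at which a query of type `a` was made. -/
def stepsOf (q : ℕ → Query) (a : Query) (t : ℕ) : Finset ℕ :=
  (Finset.range t).filter fun s => q s = a

/-- The confidence multiplier at step `t` (the `(t+1)`-st step), with the information gain of `t`
evaluations in `A`. -/
def beta {d : ℕ} (κ : Pt d → Pt d → ℝ) (η B δ : ℝ) (A : Set (Pt d)) (t : ℕ) : ℝ :=
  2 * B + √(2 * (infoGain κ η t A + 1 + Real.log (1 / δ)))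

/-- Half width of the confidence interval at `p` in step `t`, from the queries of type `a`. -/
def width {d : ℕ} (κ : Pt d → Pt d → ℝ) (η : ℝ) (β : ℕ → ℝ) (a : Query)
    (x : ℕ → Pt d) (q : ℕ → Query) (t : ℕ) (p : Pt d) : ℝ :=
  β t * postStd κ η (stepsOf q a t) x p

/-- Upper confidence bound at `p` in step `t`, from the queries of type `a`. -/
def ucb {d : ℕ} (κ : Pt d → Pt d → ℝ) (η : ℝ) (β : ℕ → ℝ) (a : Query)
    (x : ℕ → Pt d) (q : ℕ → Query) (y : ℕ → ℝ) (t : ℕ) (p : Pt d) : ℝ :=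
  postMean κ η (stepsOf q a t) x y p + width κ η β a x q t p

/-- Lower confidence bound at `p` in step `t`, from the queries of type `a`. -/
def lcb {d : ℕ} (κ : Pt d → Pt d → ℝ) (η : ℝ) (β : ℕ → ℝ) (a : Query)
    (x : ℕ → Pt d) (q : ℕ → Query) (y : ℕ → ℝ) (t : ℕ) (p : Pt d) : ℝ :=
  postMean κ η (stepsOf q a t) x y p - width κ η β a x q t p

/-- `T` is the last step of the first phase: the first step whose queried point has confidence
width at most `γ`. -/
def IsExit {d : ℕ} (κ : Pt d → Pt d → ℝ) (η : ℝ) (βr : ℕ → ℝ) (γ : ℝ)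
    (x : ℕ → Pt d) (q : ℕ → Query) (T : ℕ) : Prop :=
  width κ η βr .comp x q T (x T) ≤ γ ∧ ∀ s < T, γ < width κ η βr .comp x q s (x s)

/-- The points `p` of `X` with `φ_t(p) ≥ 0`, where `φ_t` is the upper confidence bound of the Borda
function minus the lower bound obtained at the exit step `T`, plus `L₂ ζ`. -/
def feasible {d : ℕ} (κ : Pt d → Pt d → ℝ) (η : ℝ) (X : Set (Pt d)) (βr : ℕ → ℝ) (L₂ ζ : ℝ)
    (x : ℕ → Pt d) (q : ℕ → Query) (y : ℕ → ℝ) (T t : ℕ) : Set (Pt d) :=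
  {p | p ∈ X ∧ 0 ≤ ucb κ η βr .comp x q y t p - lcb κ η βr .comp x q y T (x T) + L₂ * ζ}

/-- The points `x t`, query types `q t` and feedbacks `y t` form a trajectory of COMP-GP-UCB, run
without end (the budget only decides at which step it is stopped). Ties in the maximizations are
broken arbitrarily, and so is the choice of the point if no point is feasible. -/
structure IsTrajectory {d : ℕ} (κ : Pt d → Pt d → ℝ) (η : ℝ) (X : Set (Pt d)) (βr βl : ℕ → ℝ)
    (L₂ ζ γ : ℝ) (x : ℕ → Pt d) (q : ℕ → Query) (y : ℕ → ℝ) : Prop where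
  mem : ∀ t, x t ∈ X
  phase_one_point : ∀ t, (∀ s < t, γ < width κ η βr .comp x q s (x s)) →
    IsMaxOn (ucb κ η βr .comp x q y t) X (x t)
  phase_one_query : ∀ t, (∀ s < t, γ < width κ η βr .comp x q s (x s)) → q t = .comp
  phase_two_point : ∀ T t, IsExit κ η βr γ x q T → T < t →
    (feasible κ η X βr L₂ ζ x q y T t).Nonempty →
    x t ∈ feasible κ η X βr L₂ ζ x q y T t ∧
      IsMaxOn (ucb κ η βl .label x q y t) (feasible κ η X βr L₂ ζ x q y T t) (x t)
  phase_two_query : ∀ T t, IsExit κ η βr γ x q T → T < t →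
    (q t = .comp ↔ γ ≤ width κ η βr .comp x q t (x t))

/-! ### The feedback -/

/-- The Borda function: `pref x u` is the probability that `x` beats `u`, and the opponent `u` is
drawn from `ν`. -/
def borda {d : ℕ} (pref : Pt d → Pt d → ℝ) (ν : Measure (Pt d)) (x : Pt d) : ℝ :=
  ∫ u, pref x u ∂ν

/-- The stochastic feedback. `ℱ t` is the information available before step `t`. At a comparison,
an opponent `x' t` is drawn from `ν` and `y t` is `1` with probability `pref (x t) (x' t)` and `0`
otherwise. At a direct query, `y t - f (x t)` is a centred noise in `[-η, η]`. -/
structure IsFeedback {d : ℕ} {Ω : Type*} {mΩ : MeasurableSpace Ω} (P : Measure Ω)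
    (ℱ : Filtration ℕ mΩ) (η : ℝ) (f : Pt d → ℝ) (pref : Pt d → Pt d → ℝ) (ν : Measure (Pt d))
    (x x' : ℕ → Ω → Pt d) (q : ℕ → Ω → Query) (y : ℕ → Ω → ℝ) : Prop where
  point_meas : ∀ t, Measurable[ℱ t] (x t)
  query_meas : ∀ t, MeasurableSet[ℱ t] {ω | q t ω = .comp}
  opponent_meas : ∀ t, Measurable[ℱ (t + 1)] (x' t)
  feedback_meas : ∀ t, Measurable[ℱ (t + 1)] (y t)
  comp_win : ∀ t (A : Set (Pt d)), MeasurableSet A → ∀ᵐ ω ∂P, q t ω = .comp →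
    (P[Set.indicator {ω' | x' t ω' ∈ A ∧ y t ω' = 1} (fun _ => (1 : ℝ)) | ℱ t]) ω =
      ∫ u in A, pref (x t ω) u ∂ν
  comp_lose : ∀ t (A : Set (Pt d)), MeasurableSet A → ∀ᵐ ω ∂P, q t ω = .comp →
    (P[Set.indicator {ω' | x' t ω' ∈ A ∧ y t ω' = 0} (fun _ => (1 : ℝ)) | ℱ t]) ω =
      ∫ u in A, (1 - pref (x t ω) u) ∂ν
  label_bound : ∀ t, ∀ᵐ ω ∂P, q t ω = .label → |y t ω - f (x t ω)| ≤ η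
  label_mean : ∀ t, ∀ᵐ ω ∂P, q t ω = .label →
    (P[Set.indicator {ω' | q t ω' = .label} (fun ω' => y t ω' - f (x t ω')) | ℱ t]) ω = 0

/-! ### Budget, regret, rates -/

/-- Cost of a query. -/
def cost (lc ll : ℝ) : Query → ℝ
  | .comp => lc
  | .label => ll

/-- Regret of one step. -/
def stepRegret {d : ℕ} (X : Set (Pt d)) (f : Pt d → ℝ) (a : Query) (p p' : Pt d) : ℝ :=
  match a with
  | .label => supOn X f - f p
  | .comp => min (supOn X f - f p) (supOn X f - f p')

/-- Simple regret: the least regret of a step that is completed within the budget `Λ`. -/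
def simpleRegret {d : ℕ} (X : Set (Pt d)) (f : Pt d → ℝ) (lc ll : ℝ) (x x' : ℕ → Pt d)
    (q : ℕ → Query) (Λ : ℝ) : ℝ :=
  sInf {v | ∃ t : ℕ, (∑ s ∈ Finset.range (t + 1), cost lc ll (q s)) ≤ Λ ∧
    v = stepRegret X f (q t) (x t) (x' t)}

/-- The reduced set of the points at which `fr` is within `L₂ ζ + 4 γ` of its supremum. -/
def reducedSet {d : ℕ} (X : Set (Pt d)) (fr : Pt d → ℝ) (L₂ ζ γ : ℝ) : Set (Pt d) :=
  {p | p ∈ X ∧ supOn X fr - L₂ * ζ - 4 * γ ≤ fr p}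

/-- The rate of `n` queries exploring `A`. -/
def rate {d : ℕ} (κ : Pt d → Pt d → ℝ) (η B δ : ℝ) (n : ℕ) (A : Set (Pt d)) : ℝ :=
  (B + √(infoGain κ η n A + Real.log (1 / δ))) * √(infoGain κ η n A / n)

end

end DuelingChoice

/-! The theorem rests on two confidence bands that hold at all times, one for the Borda function and
one for `f`, and on a count of the steps at which a band can be wide.

Bands. Take the noise vector `e` of the queries of one type. The ratio of its density under
"Gaussian process plus `N(0, η²)` noise" to its density under pure `N(0, η²)` noise is `likelihood`;
its logarithm is half of `|e|²/η² - eᵀ(K + η²I)⁻¹e`, minus the gain. A new observation multiplies it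
by a one-dimensional ratio of Gaussian densities, which is a mixture of the functions `exp(g e/η² -
g²/(2η²))`. For centred noise in a known interval of length at most `2η`, Hoeffding's lemma shows
that this factor has conditional mean at most one (`ratio_le_one_add`). So the likelihood is a
supermartingale that starts at one, and Ville's inequality (`measure_likelihoodProcess_ge`) keeps it
below `exp 1 / δ` forever, off an event of probability at most `δ / exp 1`; the two types of queries
together cost less than `δ`. A bounded likelihood bounds the noise part of the posterior mean by
`√(2(gain + 1 + log(1/δ)))` standard deviations (`sq_condMean_le`). The RKHS norm adds at most `B`
standard deviations (`InRKHSBall.abs_sub_postMean_le`).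

Counting. The posterior variances at the queried points sum to at most a multiple of the gain
(`sum_sq_postStd_le`). Hence the width is at least `γ` in at most `O(β_t² I_t)` comparisons among
the first `t` steps. With `B` and `δ` fixed, `β_t² = O(1 + I_t)`, so `I_t = o(√t)` makes this count
`o(t)`. There is thus a step `t₀`, known in advance, before which the first phase ends and from
which on at least half of the queries made so far are direct. The growth of `I_t`
(`AdmissibleKernel.isLittleO`) comes from approximating the kernel by finitely many features:
coordinates for the linear kernel, local Taylor polynomials of the Fourier characters for the other
two.

Regret. Optimism places the exit point of the first phase within `2γ` of the best Borda value, hence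
within `2 L₁ γ + ζ` of the best value of `f`; this proves the first bound even without its rate
term. In the second phase a maximizer of `f` always remains feasible and direct queries fall into
the reduced set (`label_step`). So the regret of a direct query is at most twice its width, and
averaging the squared widths over at least half of the steps gives the second bound. -/

namespace DuelingChoice

set_option linter.unusedSectionVars false

/-! ### Gaussian conditioning: one-point updates of quadratic form, determinant and gain. -/

section LinearAlgebra

variable {d : ℕ} {κ : Pt d → Pt d → ℝ} {η : ℝ} {ι ι' : Type*} [Fintype ι] [DecidableEq ι]
  [Fintype ι'] [DecidableEq ι']

/-- The regularized kernel matrix `K + η² I`. -/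
noncomputable def regGram (κ : Pt d → Pt d → ℝ) (η : ℝ) (x : ι → Pt d) : Matrix ι ι ℝ :=
  gram κ x + η ^ 2 • (1 : Matrix ι ι ℝ)

/-- Posterior mean at `p` from the values `e i` at the points `x i`. -/
noncomputable def condMean (κ : Pt d → Pt d → ℝ) (η : ℝ) (x : ι → Pt d) (e : ι → ℝ) (p : Pt d) :
    ℝ :=
  (fun i => κ p (x i)) ⬝ᵥ ((regGram κ η x)⁻¹ *ᵥ e)

/-- Posterior variance at `p` from observations at the points `x i`. -/
noncomputable def condVar (κ : Pt d → Pt d → ℝ) (η : ℝ) (x : ι → Pt d) (p : Pt d) : ℝ :=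
  κ p p - (fun i => κ p (x i)) ⬝ᵥ ((regGram κ η x)⁻¹ *ᵥ fun i => κ p (x i))

/-- The quadratic form of the inverse of `K + η² I`. -/
noncomputable def quad (κ : Pt d → Pt d → ℝ) (η : ℝ) (x : ι → Pt d) (e : ι → ℝ) : ℝ :=
  e ⬝ᵥ ((regGram κ η x)⁻¹ *ᵥ e)

/-- The information gain `½ log det (I + η⁻² K)` of observations at the points `x i`. -/
noncomputable def gain (κ : Pt d → Pt d → ℝ) (η : ℝ) (x : ι → Pt d) : ℝ :=
  1 / 2 * (Real.log (regGram κ η x).det - Fintype.card ι * Real.log (η ^ 2))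

lemma dotProduct_self_nonneg' (v : ι → ℝ) : 0 ≤ v ⬝ᵥ v :=
  Finset.sum_nonneg fun i _ => mul_self_nonneg (v i)

lemma kernel_symm (hκ : (Matrix.of κ).PosSemidef) (p p' : Pt d) : κ p p' = κ p' p := by
  simpa using hκ.isHermitian.apply p' p

lemma gram_posSemidef (hκ : (Matrix.of κ).PosSemidef) (x : ι → Pt d) :
    (gram κ x).PosSemidef := hκ.submatrix x

lemma regGram_posDef (hκ : (Matrix.of κ).PosSemidef) (hη : 0 < η) (x : ι → Pt d) :
    (regGram κ η x).PosDef :=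
  Matrix.PosDef.posSemidef_add (gram_posSemidef hκ x) (Matrix.PosDef.one.smul (by positivity))

lemma regGram_det_pos (hκ : (Matrix.of κ).PosSemidef) (hη : 0 < η) (x : ι → Pt d) :
    0 < (regGram κ η x).det := (regGram_posDef hκ hη x).det_pos

lemma regGram_mulVec_inv (hκ : (Matrix.of κ).PosSemidef) (hη : 0 < η) (x : ι → Pt d)
    (e : ι → ℝ) : regGram κ η x *ᵥ ((regGram κ η x)⁻¹ *ᵥ e) = e := by
  rw [Matrix.mulVec_mulVec, Matrix.mul_nonsing_inv _ (regGram_det_pos hκ hη x).ne'.isUnit,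
    Matrix.one_mulVec]

lemma regGram_inv_mulVec_of_eq (hκ : (Matrix.of κ).PosSemidef) (hη : 0 < η) (x : ι → Pt d)
    {e w : ι → ℝ} (h : regGram κ η x *ᵥ w = e) : (regGram κ η x)⁻¹ *ᵥ e = w := by
  rw [← h, Matrix.mulVec_mulVec, Matrix.nonsing_inv_mul _ (regGram_det_pos hκ hη x).ne'.isUnit,
    Matrix.one_mulVec]

lemma regGram_mulVec (x : ι → Pt d) (w : ι → ℝ) :
    regGram κ η x *ᵥ w = gram κ x *ᵥ w + η ^ 2 • w := by
  rw [regGram, Matrix.add_mulVec, Matrix.smul_mulVec, Matrix.one_mulVec]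

lemma regGram_inv_symm (hκ : (Matrix.of κ).PosSemidef) (hη : 0 < η) (x : ι → Pt d)
    (v w : ι → ℝ) :
    v ⬝ᵥ ((regGram κ η x)⁻¹ *ᵥ w) = w ⬝ᵥ ((regGram κ η x)⁻¹ *ᵥ v) := by
  have h : ((regGram κ η x)⁻¹)ᵀ = (regGram κ η x)⁻¹ := by
    simpa using (regGram_posDef hκ hη x).inv.isHermitian.eq
  rw [Matrix.dotProduct_mulVec, ← Matrix.mulVec_transpose, h, dotProduct_comm]

/-- The quadratic form of the kernel of the points `p` and `x i` with weights `1` and `-c i`. -/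
lemma residual_nonneg (hκ : (Matrix.of κ).PosSemidef) (x : ι → Pt d) (p : Pt d) (c : ι → ℝ) :
    0 ≤ κ p p - 2 * ((fun i => κ p (x i)) ⬝ᵥ c) + c ⬝ᵥ (gram κ x *ᵥ c) := by
  have h := (hκ.submatrix (fun o : Option ι => o.elim p x)).dotProduct_mulVec_nonneg
    (fun o : Option ι => o.elim 1 (fun i => -c i))
  simp only [dotProduct, Matrix.mulVec, Fintype.sum_option, Matrix.submatrix_apply, Matrix.of_apply,
    Option.elim, star_trivial] at h
  simp only [dotProduct, Matrix.mulVec, gram, Matrix.of_apply]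
  have e1 : ∀ i, κ (x i) p = κ p (x i) := fun i => kernel_symm hκ _ _
  simp only [e1] at h
  simp only [mul_neg, mul_one, neg_mul, one_mul, Finset.sum_neg_distrib, mul_add,
    Finset.sum_add_distrib, neg_neg] at h
  have e2 : ∑ i, c i * κ p (x i) = ∑ i, κ p (x i) * c i := Finset.sum_congr rfl fun i _ => mul_comm _ _
  linarith

lemma dotProduct_inv_self (hκ : (Matrix.of κ).PosSemidef) (hη : 0 < η) (x : ι → Pt d)
    (e : ι → ℝ) :
    ((regGram κ η x)⁻¹ *ᵥ e) ⬝ᵥ (gram κ x *ᵥ ((regGram κ η x)⁻¹ *ᵥ e)) =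
      quad κ η x e - η ^ 2 * (((regGram κ η x)⁻¹ *ᵥ e) ⬝ᵥ ((regGram κ η x)⁻¹ *ᵥ e)) := by
  have h := regGram_mulVec_inv hκ hη x e
  rw [regGram_mulVec] at h
  set w := (regGram κ η x)⁻¹ *ᵥ e with hw
  have h2 : gram κ x *ᵥ w = e - η ^ 2 • w := by rw [← h]; abel
  rw [h2, dotProduct_sub, dotProduct_smul, quad, ← hw, dotProduct_comm w e, smul_eq_mul]

/-- The weights `w = (K + η²I)⁻¹ k_p` leave a kernel residual equal to the posterior variance minus
`η²|w|²`. This turns an RKHS norm bound into a bound by the posterior standard deviation. -/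
lemma residual_le_condVar (hκ : (Matrix.of κ).PosSemidef) (hη : 0 < η) (x : ι → Pt d)
    (p : Pt d) :
    κ p p - 2 * ((fun i => κ p (x i)) ⬝ᵥ ((regGram κ η x)⁻¹ *ᵥ fun i => κ p (x i))) +
      ((regGram κ η x)⁻¹ *ᵥ fun i => κ p (x i)) ⬝ᵥ
        (gram κ x *ᵥ ((regGram κ η x)⁻¹ *ᵥ fun i => κ p (x i))) ≤ condVar κ η x p := by
  rw [dotProduct_inv_self hκ hη, condVar, quad]
  have := dotProduct_self_nonneg' ((regGram κ η x)⁻¹ *ᵥ fun i => κ p (x i))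
  nlinarith [mul_nonneg (sq_nonneg η) this]

lemma condVar_nonneg (hκ : (Matrix.of κ).PosSemidef) (hη : 0 < η) (x : ι → Pt d) (p : Pt d) :
    0 ≤ condVar κ η x p :=
  (residual_nonneg hκ x p _).trans (residual_le_condVar hκ hη x p)

lemma quad_nonneg (hκ : (Matrix.of κ).PosSemidef) (hη : 0 < η) (x : ι → Pt d) (e : ι → ℝ) :
    0 ≤ quad κ η x e := by
  rw [quad]
  simpa using (regGram_posDef hκ hη x).inv.posSemidef.dotProduct_mulVec_nonneg e

lemma condVar_le (hκ : (Matrix.of κ).PosSemidef) (hη : 0 < η) (x : ι → Pt d) (p : Pt d) :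
    condVar κ η x p ≤ κ p p :=
  sub_le_self _ (quad_nonneg hκ hη x _)

/-- The eigenvalues of `(K + η²I)⁻¹` are at most `η⁻²`. Without diagonalizing: for `w = (K + η²I)⁻¹
e`, add `|e - η²w|² ≥ 0` and `η² wᵀKw ≥ 0`. -/
lemma quad_le (hκ : (Matrix.of κ).PosSemidef) (hη : 0 < η) (x : ι → Pt d) (e : ι → ℝ) :
    quad κ η x e ≤ (e ⬝ᵥ e) / η ^ 2 := by
  have h := regGram_mulVec_inv hκ hη x e
  rw [regGram_mulVec] at h
  have h1 := dotProduct_inv_self hκ hη x e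
  set w := (regGram κ η x)⁻¹ *ᵥ e with hw
  have h3 : 0 ≤ w ⬝ᵥ (gram κ x *ᵥ w) := by
    simpa using (gram_posSemidef hκ x).dotProduct_mulVec_nonneg w
  have hq : quad κ η x e = e ⬝ᵥ w := rfl
  have h4 : 0 ≤ (e - η ^ 2 • w) ⬝ᵥ (e - η ^ 2 • w) := dotProduct_self_nonneg' _
  simp only [sub_dotProduct, dotProduct_sub, dotProduct_smul, smul_dotProduct, smul_eq_mul,
    dotProduct_comm w e] at h4
  rw [le_div_iff₀ (by positivity)]
  rw [h1, hq] at h3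
  rw [hq]
  nlinarith [mul_nonneg (sq_nonneg η) h3]

lemma regGram_option_mulVec (hκ : (Matrix.of κ).PosSemidef) (x : ι → Pt d) (p : Pt d)
    (w : ι → ℝ) (a : ℝ) :
    regGram κ η (fun o : Option ι => o.elim p x) *ᵥ (fun o => o.elim a w) =
      fun o => o.elim ((κ p p + η ^ 2) * a + (fun i => κ p (x i)) ⬝ᵥ w)
        ((regGram κ η x *ᵥ w) + a • fun i => κ p (x i)) := by
  ext o
  rw [regGram_mulVec, regGram_mulVec]
  cases o with
  | none =>
    simp [Matrix.mulVec, dotProduct, gram]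
    ring
  | some i =>
    simp [Matrix.mulVec, dotProduct, gram, kernel_symm hκ (x i) p]
    ring

/-- One further observation `e0` at `p` changes the quadratic form by its squared normalized
residual. -/
lemma quad_option (hκ : (Matrix.of κ).PosSemidef) (hη : 0 < η) (x : ι → Pt d) (p : Pt d)
    (e : ι → ℝ) (e0 : ℝ) :
    quad κ η (fun o : Option ι => o.elim p x) (fun o => o.elim e0 e) =
      quad κ η x e + (e0 - condMean κ η x e p) ^ 2 / (condVar κ η x p + η ^ 2) := by
  have hv : 0 < condVar κ η x p + η ^ 2 := by
    have := condVar_nonneg hκ hη x p; positivity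
  set α := (e0 - condMean κ η x e p) / (condVar κ η x p + η ^ 2) with hα
  have hα' : α * (condVar κ η x p + η ^ 2) = e0 - condMean κ η x e p := by
    rw [hα]; field_simp
  -- Block elimination: the new coordinate of the solution is the residual divided by the Schur
  -- complement, and the old coordinates are corrected accordingly.
  have key : regGram κ η (fun o : Option ι => o.elim p x) *ᵥ
      (fun o => o.elim α ((regGram κ η x)⁻¹ *ᵥ e -
        α • ((regGram κ η x)⁻¹ *ᵥ fun i => κ p (x i)))) = fun o => o.elim e0 e := by
    rw [regGram_option_mulVec hκ, Matrix.mulVec_sub, Matrix.mulVec_smul,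
      regGram_mulVec_inv hκ hη, regGram_mulVec_inv hκ hη]
    ext o
    cases o with
    | none =>
      simp only [Option.elim, dotProduct_sub, dotProduct_smul, smul_eq_mul]
      simp only [condMean, condVar] at hα' ⊢
      linarith
    | some i => simp
  rw [quad, regGram_inv_mulVec_of_eq hκ hη _ key]
  have h1 : ∀ (a b : ℝ) (u w : ι → ℝ), (fun o : Option ι => o.elim a u) ⬝ᵥ (fun o => o.elim b w) =
      a * b + u ⬝ᵥ w := by
    intro a b u w; simp [dotProduct]
  rw [h1, dotProduct_sub, dotProduct_smul, smul_eq_mul, regGram_inv_symm hκ hη x e fun i => κ p (x i)]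
  have : (e0 - condMean κ η x e p) ^ 2 / (condVar κ η x p + η ^ 2) =
      (e0 - condMean κ η x e p) * α := by rw [hα]; ring
  rw [this, quad]
  simp only [condMean]
  ring

/-- `condVar + η²` is the Schur complement of the old block. -/
lemma det_option (hκ : (Matrix.of κ).PosSemidef) (hη : 0 < η) (x : ι → Pt d) (p : Pt d) :
    (regGram κ η (fun o : Option ι => o.elim p x)).det =
      (regGram κ η x).det * (condVar κ η x p + η ^ 2) := by
  have : (regGram κ η (fun o : Option ι => o.elim p x)).submatrix
      (Equiv.optionEquivSumPUnit ι).symm (Equiv.optionEquivSumPUnit ι).symm =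
      Matrix.fromBlocks (regGram κ η x) (Matrix.of fun i (_ : Unit) => κ p (x i))
        (Matrix.of fun (_ : Unit) i => κ p (x i)) (Matrix.of fun _ _ => κ p p + η ^ 2) := by
    ext i j
    rcases i with i | i <;> rcases j with j | j <;>
      simp [regGram, gram, kernel_symm hκ p, Matrix.one_apply]
  rw [← Matrix.det_submatrix_equiv_self (Equiv.optionEquivSumPUnit ι).symm, this]
  have : Invertible (regGram κ η x) :=
    Matrix.invertibleOfIsUnitDet _ (regGram_det_pos hκ hη x).ne'.isUnit
  rw [Matrix.det_fromBlocks₁₁, Matrix.invOf_eq_nonsing_inv]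
  congr 1
  rw [Matrix.det_unique]
  simp only [condVar, Matrix.sub_apply, Matrix.of_apply, Matrix.mul_assoc]
  rw [Matrix.mul_apply]
  simp only [dotProduct, Matrix.mulVec, Matrix.mul_apply, Matrix.of_apply]
  ring

/-- Chain rule for the information: a new observation adds the capacity of a Gaussian channel whose
signal variance is the current posterior variance. -/
lemma gain_option (hκ : (Matrix.of κ).PosSemidef) (hη : 0 < η) (x : ι → Pt d) (p : Pt d) :
    gain κ η (fun o : Option ι => o.elim p x) =
      gain κ η x + 1 / 2 * Real.log (1 + condVar κ η x p / η ^ 2) := by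
  have hv := condVar_nonneg hκ hη x p
  have h1 : 1 + condVar κ η x p / η ^ 2 = (condVar κ η x p + η ^ 2) / η ^ 2 := by
    field_simp; ring
  rw [gain, gain, det_option hκ hη, h1, Real.log_mul (regGram_det_pos hκ hη x).ne' (by positivity),
    Real.log_div (by positivity) (by positivity), Fintype.card_option]
  push_cast
  ring

lemma gain_option_le (hκ : (Matrix.of κ).PosSemidef) (hη : 0 < η) (x : ι → Pt d) (p : Pt d) :
    gain κ η x ≤ gain κ η (fun o : Option ι => o.elim p x) := by
  have hv := condVar_nonneg hκ hη x p
  rw [gain_option hκ hη]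
  have : 0 ≤ Real.log (1 + condVar κ η x p / η ^ 2) :=
    Real.log_nonneg (le_add_of_nonneg_right (by positivity))
  linarith

lemma regGram_comp (x : ι → Pt d) (f : ι' ≃ ι) :
    regGram κ η (x ∘ f) = (regGram κ η x).submatrix f f := by
  ext i j; simp [regGram, gram, Matrix.one_apply]

lemma gain_comp (x : ι → Pt d) (f : ι' ≃ ι) : gain κ η (x ∘ f) = gain κ η x := by
  rw [gain, gain, regGram_comp, Matrix.det_submatrix_equiv_self, Fintype.card_congr f]

lemma quad_comp (x : ι → Pt d) (e : ι → ℝ) (f : ι' ≃ ι) :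
    quad κ η (x ∘ f) (e ∘ f) = quad κ η x e := by
  rw [quad, quad, regGram_comp, Matrix.inv_submatrix_equiv, Matrix.submatrix_mulVec_equiv]
  simp [Function.comp_assoc, dotProduct]
  exact f.sum_comp fun i => e i * ((regGram κ η x)⁻¹ *ᵥ e) i

/-- The squared posterior mean is controlled by the loss of the quadratic form. -/
lemma sq_condMean_le (hκ : (Matrix.of κ).PosSemidef) (hη : 0 < η) (x : ι → Pt d) (e : ι → ℝ)
    (p : Pt d) :
    condMean κ η x e p ^ 2 ≤ ((e ⬝ᵥ e) / η ^ 2 - quad κ η x e) * condVar κ η x p := by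
  -- Apply `quad_le` after adding a fictitious observation `e0` at `p`. The claim is what remains
  -- after optimizing over `e0`.
  have key : ∀ e0 : ℝ, 0 ≤ ((e ⬝ᵥ e) / η ^ 2 - quad κ η x e) + e0 ^ 2 / η ^ 2 -
      (e0 - condMean κ η x e p) ^ 2 / (condVar κ η x p + η ^ 2) := by
    intro e0
    have h := quad_le hκ hη (fun o : Option ι => o.elim p x) (fun o => o.elim e0 e)
    rw [quad_option hκ hη] at h
    have h1 : (fun o : Option ι => o.elim e0 e) ⬝ᵥ (fun o : Option ι => o.elim e0 e) =
      e0 ^ 2 + e ⬝ᵥ e := by simp [dotProduct]; ring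
    rw [h1, add_div] at h
    linarith
  have hv := condVar_nonneg hκ hη x p
  have hQ : 0 ≤ (e ⬝ᵥ e) / η ^ 2 - quad κ η x e := sub_nonneg.2 (quad_le hκ hη x e)
  set Q := (e ⬝ᵥ e) / η ^ 2 - quad κ η x e
  set m := condMean κ η x e p
  set v := condVar κ η x p
  rcases hv.eq_or_lt with hv0 | hv0
  · rw [← hv0] at key ⊢
    rw [mul_zero]
    by_contra hm
    push Not at hm
    have hm0 : m ≠ 0 := by rintro h; simp [h] at hm
    -- With zero variance the expression is affine in `e0` with nonzero slope, so some `e0` makes it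
    -- negative.
    have := key (-(Q + 1) * η ^ 2 / (2 * m))
    have h2 : Q + (-(Q + 1) * η ^ 2 / (2 * m)) ^ 2 / η ^ 2 -
      (-(Q + 1) * η ^ 2 / (2 * m) - m) ^ 2 / (0 + η ^ 2) = -1 - m ^ 2 / η ^ 2 := by
      field_simp; ring
    rw [h2] at this
    have : 0 ≤ m ^ 2 / η ^ 2 := by positivity
    linarith
  -- This `e0` minimizes the quadratic polynomial.
  · have := key (-m * η ^ 2 / v)
    have h2 : Q + (-m * η ^ 2 / v) ^ 2 / η ^ 2 - (-m * η ^ 2 / v - m) ^ 2 / (v + η ^ 2) =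
      Q - m ^ 2 / v := by
      field_simp; ring
    rw [h2, sub_nonneg, div_le_iff₀ hv0] at this
    exact this

end LinearAlgebra

/-! ### Mutual information of Gaussian observations as a log-determinant. -/

section Entropy

open scoped MatrixOrder

variable {n : ℕ}

/-- The standard Gaussian law has density `(2π)^(-n/2) exp(-‖x‖²/2)`. -/
lemma stdGaussian_eq_withDensity :
    stdGaussian (EuclideanSpace ℝ (Fin n)) =
      (volume : Measure (EuclideanSpace ℝ (Fin n))).withDensity (fun x => ENNReal.ofReal
        (((2 * Real.pi) ^ ((n : ℝ) / 2))⁻¹ * Real.exp (-(1 / 2) * ‖x‖ ^ 2))) := by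
  have hc : 0 < ((2 * Real.pi) ^ ((n : ℝ) / 2))⁻¹ := by positivity
  set c := ((2 * Real.pi) ^ ((n : ℝ) / 2))⁻¹ with hcdef
  have hint : Integrable (fun x : EuclideanSpace ℝ (Fin n) =>
      c * Real.exp (-(1 / 2) * ‖x‖ ^ 2)) := by
    refine Integrable.const_mul ?_ c
    have h := GaussianFourier.integral_rexp_neg_mul_sq_norm (V := EuclideanSpace ℝ (Fin n))
      (b := 1 / 2) (by norm_num)
    -- A non-integrable function has integral 0 by convention, but the Gaussian integral is
    -- positive.
    by_contra hcon
    rw [integral_undef hcon] at h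
    have : (0 : ℝ) < (Real.pi / (1 / 2)) ^
      ((Module.finrank ℝ (EuclideanSpace ℝ (Fin n)) : ℝ) / 2) := by positivity
    linarith
  have hfin : IsFiniteMeasure ((volume : Measure (EuclideanSpace ℝ (Fin n))).withDensity
      (fun x => ENNReal.ofReal (c * Real.exp (-(1 / 2) * ‖x‖ ^ 2)))) :=
    isFiniteMeasure_withDensity_ofReal hint.2
  apply Measure.ext_of_charFun
  ext t
  rw [charFun_stdGaussian, charFun_apply, integral_withDensity_eq_integral_toReal_smul
    (by fun_prop) (by simp)]
  have h := GaussianFourier.integral_cexp_neg_mul_sq_norm_add (V := EuclideanSpace ℝ (Fin n))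
    (b := 1 / 2) (by norm_num) Complex.I t
  have h2 : ∀ x : EuclideanSpace ℝ (Fin n),
      (ENNReal.ofReal (c * Real.exp (-(1 / 2) * ‖x‖ ^ 2))).toReal •
        Complex.exp (inner ℝ x t * Complex.I) =
      c * Complex.exp (-(1 / 2) * ‖x‖ ^ 2 + Complex.I * inner ℝ t x) := by
    intro x
    rw [ENNReal.toReal_ofReal (by positivity), Complex.exp_add, real_inner_comm x t]
    simp only [Complex.real_smul]
    push_cast
    ring_nf
  simp_rw [h2]
  rw [integral_const_mul, h, ← mul_assoc]
  have h3 : (c : ℂ) * ((Real.pi : ℂ) / (1 / 2)) ^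
      ((Module.finrank ℝ (EuclideanSpace ℝ (Fin n)) : ℂ) / 2) = 1 := by
    have e1 : ((Real.pi : ℂ) / (1 / 2)) = ((2 * Real.pi : ℝ) : ℂ) := by push_cast; ring
    have e2 : ((Module.finrank ℝ (EuclideanSpace ℝ (Fin n)) : ℂ) / 2) = (((n : ℝ) / 2 : ℝ) : ℂ) := by
      simp
    rw [e1, e2, ← Complex.ofReal_cpow (by positivity), ← Complex.ofReal_mul, hcdef,
      inv_mul_cancel₀ (by positivity), Complex.ofReal_one]
  rw [h3, one_mul]
  congr 1
  rw [Complex.I_sq]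
  ring

lemma integrable_sq_norm_stdGaussian :
    Integrable (fun x => ‖x‖ ^ 2) (stdGaussian (EuclideanSpace ℝ (Fin n))) :=
  (IsGaussian.memLp_two_id (μ := stdGaussian (EuclideanSpace ℝ (Fin n)))).integrable_norm_pow
    (by norm_num)

/-- Entropy of the image of the standard Gaussian law under an invertible affine map. -/
lemma diffEntropy_multivariateGaussian (v : EuclideanSpace ℝ (Fin n))
    {S : Matrix (Fin n) (Fin n) ℝ} (hS : S.PosDef) :
    diffEntropy (multivariateGaussian v S) =
      -(Real.log ((2 * Real.pi) ^ ((n : ℝ) / 2))⁻¹ -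
        1 / 2 * ∫ x, ‖x‖ ^ 2 ∂(stdGaussian (EuclideanSpace ℝ (Fin n)))) +
      1 / 2 * Real.log S.det := by
  set L := Matrix.toEuclideanCLM (n := Fin n) (𝕜 := ℝ) (CFC.sqrt S) with hL
  have hdetS : 0 < S.det := hS.det_pos
  have hdet : LinearMap.det (L : EuclideanSpace ℝ (Fin n) →ₗ[ℝ] EuclideanSpace ℝ (Fin n)) =
      √S.det := by
    rw [hL, Matrix.coe_toEuclideanCLM_eq_toEuclideanLin, LinearMap.det_toLpLin]
    rw [hS.posSemidef.det_sqrt]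
    simp [RCLike.sqrt_of_nonneg, hdetS.le]
  have hdetpos : 0 < √S.det := Real.sqrt_pos.2 hdetS
  have hvol : (volume : Measure (EuclideanSpace ℝ (Fin n))).map (fun x => v + L x) =
      ENNReal.ofReal (√S.det)⁻¹ • volume := by
    have h1 := Measure.map_linearMap_addHaar_eq_smul_addHaar
      (volume : Measure (EuclideanSpace ℝ (Fin n)))
      (f := (L : EuclideanSpace ℝ (Fin n) →ₗ[ℝ] EuclideanSpace ℝ (Fin n)))
      (by rw [hdet]; exact hdetpos.ne')
    rw [hdet, abs_of_pos (inv_pos.2 hdetpos)] at h1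
    have h2 : (fun x => v + L x) = (fun x => v + x) ∘ L := rfl
    rw [h2, ← Measure.map_map (by fun_prop) (by fun_prop)]
    have h1' : (volume : Measure (EuclideanSpace ℝ (Fin n))).map L =
      ENNReal.ofReal (√S.det)⁻¹ • volume := h1
    rw [h1', Measure.map_smul, map_add_left_eq_self]
  have hinj : Function.Injective L := by
    have : IsUnit (LinearMap.det (L : EuclideanSpace ℝ (Fin n) →ₗ[ℝ] EuclideanSpace ℝ (Fin n))) :=
      by rw [hdet]; exact hdetpos.ne'.isUnit
    have h3 := (LinearMap.isUnit_iff_isUnit_det _).2 this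
    exact ((Module.End.isUnit_iff _).1 h3).1
  have hemb : MeasurableEmbedding (fun x => v + L x) := by
    refine Continuous.measurableEmbedding (by fun_prop) ?_
    intro a b hab
    exact hinj (add_left_cancel hab)
  have hmap : multivariateGaussian v S =
      (stdGaussian (EuclideanSpace ℝ (Fin n))).map (fun x => v + L x) := rfl
  have hac : stdGaussian (EuclideanSpace ℝ (Fin n)) ≪ volume := by
    rw [stdGaussian_eq_withDensity]; exact withDensity_absolutelyContinuous _ _
  -- Lebesgue measure is a multiple of its own affine image. The density of the image law against
  -- the image measure is the standard Gaussian density at the preimage, so only the determinant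
  -- factor remains.
  have hsmul : (volume : Measure (EuclideanSpace ℝ (Fin n))) =
      ENNReal.ofReal (√S.det) • (volume : Measure (EuclideanSpace ℝ (Fin n))).map
        (fun x => v + L x) := by
    rw [hvol, smul_smul, ← ENNReal.ofReal_mul hdetpos.le, mul_inv_cancel₀ hdetpos.ne',
      ENNReal.ofReal_one, one_smul]
  have hsf : SigmaFinite ((volume : Measure (EuclideanSpace ℝ (Fin n))).map
      (fun x => v + L x)) := by
    rw [hvol]
    change SigmaFinite ((√S.det)⁻¹.toNNReal • (volume : Measure (EuclideanSpace ℝ (Fin n))))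
    infer_instance
  have hrn : ∀ᵐ x ∂(stdGaussian (EuclideanSpace ℝ (Fin n))),
      Real.log ((multivariateGaussian v S).rnDeriv volume (v + L x)).toReal =
        Real.log ((2 * Real.pi) ^ ((n : ℝ) / 2))⁻¹ - 1 / 2 * ‖x‖ ^ 2 -
          1 / 2 * Real.log S.det := by
    have h1 : (multivariateGaussian v S).rnDeriv volume
        =ᵐ[(volume : Measure (EuclideanSpace ℝ (Fin n))).map (fun x => v + L x)]
        (ENNReal.ofReal (√S.det))⁻¹ • (multivariateGaussian v S).rnDeriv
          ((volume : Measure (EuclideanSpace ℝ (Fin n))).map (fun x => v + L x)) := by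
      conv_lhs => rw [hsmul]
      exact Measure.rnDeriv_smul_right_of_ne_top' _ _ (by simpa using hdetS) (by simp)
    have h2 := hac.ae_le (ae_of_ae_map hemb.measurable.aemeasurable h1)
    have h3 := hac.ae_le (hemb.rnDeriv_map (stdGaussian (EuclideanSpace ℝ (Fin n))) volume)
    have h4 := Measure.rnDeriv_withDensity (volume : Measure (EuclideanSpace ℝ (Fin n)))
      (f := fun x => ENNReal.ofReal
        (((2 * Real.pi) ^ ((n : ℝ) / 2))⁻¹ * Real.exp (-(1 / 2) * ‖x‖ ^ 2))) (by fun_prop)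
    rw [← stdGaussian_eq_withDensity] at h4
    filter_upwards [h2, h3, hac.ae_le h4] with x hx2 hx3 hx4
    rw [hx2, Pi.smul_apply, hmap, hx3, hx4, smul_eq_mul, ENNReal.toReal_mul, ENNReal.toReal_inv,
      ENNReal.toReal_ofReal hdetpos.le, ENNReal.toReal_ofReal (by positivity),
      Real.log_mul (by positivity) (by positivity), Real.log_mul (by positivity) (by positivity),
      Real.log_exp, Real.log_inv (√S.det), Real.log_sqrt hdetS.le]
    ring
  rw [diffEntropy]
  conv_lhs => rw [hmap]
  rw [hemb.integral_map, ← hmap, integral_congr_ae hrn]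
  rw [integral_sub, integral_sub, integral_const_mul]
  · simp
    ring
  · exact integrable_const _
  · exact integrable_sq_norm_stdGaussian.const_mul _
  · exact (integrable_const _).sub (integrable_sq_norm_stdGaussian.const_mul _)
  · exact integrable_const _

lemma conv_multivariateGaussian {S R : Matrix (Fin n) (Fin n) ℝ} (hS : S.PosSemidef)
    (hR : R.PosSemidef) :
    (multivariateGaussian 0 S).conv (multivariateGaussian 0 R) =
      multivariateGaussian 0 (S + R) := by
  apply Measure.ext_of_charFun
  ext t
  rw [charFun_conv, charFun_multivariateGaussian hS, charFun_multivariateGaussian hR,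
    charFun_multivariateGaussian (hS.add hR), ← Complex.exp_add]
  congr 1
  simp [Matrix.add_mulVec, dotProduct_add]
  ring

/-- The mutual information of Gaussian observations is `½ log det (I + η⁻² K)`. -/
lemma mutualInformation_eq_gain {d : ℕ} {κ : Pt d → Pt d → ℝ} (hκ : (Matrix.of κ).PosSemidef)
    {η : ℝ} (hη : 0 < η) (x : Fin n → Pt d) : mutualInformation κ η x = gain κ η x := by
  have h1 : (η ^ 2 • (1 : Matrix (Fin n) (Fin n) ℝ)).PosDef :=
    Matrix.PosDef.one.smul (by positivity)
  rw [mutualInformation]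
  simp only [priorLaw, noiseLaw]
  rw [conv_multivariateGaussian (gram_posSemidef hκ x) h1.posSemidef]
  -- The entropy of the noise does not depend on its mean, and the second moment of the standard
  -- Gaussian cancels in the difference, so it never has to be computed.
  simp_rw [diffEntropy_multivariateGaussian _ h1]
  have h2 := diffEntropy_multivariateGaussian 0 (regGram_posDef hκ hη x)
  rw [regGram] at h2
  rw [h2, integral_const, gain, regGram]
  simp
  ring

end Entropy

/-! ### Maximum information gain: bounds and monotonicity. -/

section InfoGain

variable {d : ℕ} {κ : Pt d → Pt d → ℝ} {η k : ℝ} {A A' : Set (Pt d)}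

lemma isCompact_box (d : ℕ) (r : ℝ) : IsCompact (box d r) := by
  have h : box d r = EuclideanSpace.equiv (Fin d) ℝ ⁻¹' (Set.Icc 0 (fun _ => r)) := by
    ext x
    simp only [box, Set.mem_ofPred_eq, Set.mem_preimage, Set.mem_Icc, Pi.le_def]
    exact forall_and
  rw [h]
  exact (EuclideanSpace.equiv (Fin d) ℝ).toHomeomorph.isCompact_preimage.2 isCompact_Icc

lemma exists_kernel_bound (r : ℝ) (hκc : Continuous (Function.uncurry κ)) :
    ∃ k : ℝ, 1 ≤ k ∧ ∀ p ∈ box d r, κ p p ≤ k := by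
  have hc : Continuous fun p : Pt d => κ p p := hκc.comp (continuous_id.prodMk continuous_id)
  obtain ⟨k, hk⟩ := (isCompact_box d r).bddAbove_image hc.continuousOn
  exact ⟨max 1 k, le_max_left _ _, fun p hp => (hk ⟨p, hp, rfl⟩).trans (le_max_right _ _)⟩

lemma gain_isEmpty {ι : Type*} [Fintype ι] [DecidableEq ι] [IsEmpty ι] (x : ι → Pt d) :
    gain κ η x = 0 := by
  simp [gain]

lemma gain_succ (hκ : (Matrix.of κ).PosSemidef) (hη : 0 < η) {n : ℕ} (x : Fin (n + 1) → Pt d) :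
    gain κ η x = gain κ η (fun i : Fin n => x i.succ) +
      1 / 2 * Real.log (1 + condVar κ η (fun i : Fin n => x i.succ) (x 0) / η ^ 2) := by
  rw [← gain_option hκ hη, ← gain_comp _ (finSuccEquiv n)]
  congr 1
  ext1 i
  refine Fin.cases ?_ (fun j => ?_) i <;> simp

lemma gain_fin_nonneg (hκ : (Matrix.of κ).PosSemidef) (hη : 0 < η) {n : ℕ} (x : Fin n → Pt d) :
    0 ≤ gain κ η x := by
  induction n with
  | zero => rw [gain_isEmpty]
  | succ n ih =>
    rw [gain_succ hκ hη]
    have hv := condVar_nonneg hκ hη (fun i : Fin n => x i.succ) (x 0)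
    have : 0 ≤ Real.log (1 + condVar κ η (fun i : Fin n => x i.succ) (x 0) / η ^ 2) :=
      Real.log_nonneg (le_add_of_nonneg_right (by positivity))
    linarith [ih fun i : Fin n => x i.succ]

lemma gain_fin_le (hκ : (Matrix.of κ).PosSemidef) (hη : 0 < η) {n : ℕ} (x : Fin n → Pt d)
    (hk : ∀ i, κ (x i) (x i) ≤ k) : gain κ η x ≤ n * (1 / 2 * (k / η ^ 2)) := by
  induction n with
  | zero => simp [gain_isEmpty]
  | succ n ih =>
    rw [gain_succ hκ hη]
    have hv := condVar_nonneg hκ hη (fun i : Fin n => x i.succ) (x 0)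
    have h1 : Real.log (1 + condVar κ η (fun i : Fin n => x i.succ) (x 0) / η ^ 2) ≤
        k / η ^ 2 := by
      have h2 := Real.log_le_sub_one_of_pos
        (show 0 < 1 + condVar κ η (fun i : Fin n => x i.succ) (x 0) / η ^ 2 by positivity)
      have h3 : condVar κ η (fun i : Fin n => x i.succ) (x 0) / η ^ 2 ≤ k / η ^ 2 := by
        gcongr
        exact (condVar_le hκ hη _ _).trans (hk 0)
      linarith
    have := ih (fun i : Fin n => x i.succ) fun i => hk i.succ
    push_cast
    linarith

lemma infoGain_eq (hκ : (Matrix.of κ).PosSemidef) (hη : 0 < η) (n : ℕ) (A : Set (Pt d)) :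
    infoGain κ η n A = sSup {v | ∃ x : Fin n → Pt d, (∀ i, x i ∈ A) ∧ v = gain κ η x} := by
  simp only [infoGain, mutualInformation_eq_gain hκ hη]

/-- Needed because a real supremum over an unbounded set would be the default value 0. -/
lemma gain_bddAbove (hκ : (Matrix.of κ).PosSemidef) (hη : 0 < η) (hk : ∀ p ∈ A, κ p p ≤ k)
    (n : ℕ) : BddAbove {v | ∃ x : Fin n → Pt d, (∀ i, x i ∈ A) ∧ v = gain κ η x} := by
  refine ⟨n * (1 / 2 * (k / η ^ 2)), ?_⟩
  rintro v ⟨x, hx, rfl⟩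
  exact gain_fin_le hκ hη x fun i => hk _ (hx i)

lemma infoGain_nonneg (hκ : (Matrix.of κ).PosSemidef) (hη : 0 < η) (n : ℕ) (A : Set (Pt d)) :
    0 ≤ infoGain κ η n A := by
  rw [infoGain_eq hκ hη]
  refine Real.sSup_nonneg ?_
  rintro v ⟨x, -, rfl⟩
  exact gain_fin_nonneg hκ hη x

lemma gain_le_infoGain (hκ : (Matrix.of κ).PosSemidef) (hη : 0 < η) (hk : ∀ p ∈ A, κ p p ≤ k)
    {ι : Type*} [Fintype ι] [DecidableEq ι] (x : ι → Pt d) (hx : ∀ i, x i ∈ A) :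
    gain κ η x ≤ infoGain κ η (Fintype.card ι) A := by
  rw [infoGain_eq hκ hη, ← gain_comp x (Fintype.equivFin ι).symm]
  exact le_csSup (gain_bddAbove hκ hη hk _) ⟨_, fun i => hx _, rfl⟩

lemma infoGain_le (hκ : (Matrix.of κ).PosSemidef) (hη : 0 < η) (hA : A.Nonempty) {n : ℕ} {c : ℝ}
    (h : ∀ x : Fin n → Pt d, (∀ i, x i ∈ A) → gain κ η x ≤ c) : infoGain κ η n A ≤ c := by
  obtain ⟨a, ha⟩ := hA
  rw [infoGain_eq hκ hη]
  refine csSup_le ⟨_, fun _ => a, fun _ => ha, rfl⟩ ?_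
  rintro v ⟨x, hx, rfl⟩
  exact h x hx

lemma infoGain_mono (hκ : (Matrix.of κ).PosSemidef) (hη : 0 < η) (hk : ∀ p ∈ A, κ p p ≤ k)
    (hA : A.Nonempty) : Monotone fun n => infoGain κ η n A := by
  refine monotone_nat_of_le_succ fun n => infoGain_le hκ hη hA fun x hx => ?_
  obtain ⟨a, ha⟩ := hA
  have h := gain_le_infoGain hκ hη hk (fun o : Option (Fin n) => o.elim a x)
    (fun o => by cases o <;> simp [ha, hx])
  rw [Fintype.card_option, Fintype.card_fin] at h
  exact (gain_option_le hκ hη x a).trans h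

lemma infoGain_mono_set (hκ : (Matrix.of κ).PosSemidef) (hη : 0 < η) (hk : ∀ p ∈ A', κ p p ≤ k)
    (hA : A.Nonempty) (h : A ⊆ A') (n : ℕ) : infoGain κ η n A ≤ infoGain κ η n A' := by
  refine infoGain_le hκ hη hA fun x hx => ?_
  simpa using gain_le_infoGain hκ hη hk x fun i => h (hx i)

/-! ### Gain along a finite set of steps -/

lemma gain_insert (hκ : (Matrix.of κ).PosSemidef) (hη : 0 < η) (x : ℕ → Pt d) {S : Finset ℕ}
    {t : ℕ} (ht : t ∉ S) :
    gain κ η (fun i : ↥(insert t S) => x i) = gain κ η (fun i : S => x i) +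
      1 / 2 * Real.log (1 + condVar κ η (fun i : S => x i) (x t) / η ^ 2) := by
  rw [← gain_option hκ hη, ← gain_comp _ (Finset.subtypeInsertEquivOption ht).symm]
  congr 1
  ext1 o
  cases o <;> rfl

lemma quad_insert (hκ : (Matrix.of κ).PosSemidef) (hη : 0 < η) (x : ℕ → Pt d) (e : ℕ → ℝ)
    {S : Finset ℕ} {t : ℕ} (ht : t ∉ S) :
    quad κ η (fun i : ↥(insert t S) => x i) (fun i => e i) =
      quad κ η (fun i : S => x i) (fun i => e i) +
        (e t - condMean κ η (fun i : S => x i) (fun i => e i) (x t)) ^ 2 /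
          (condVar κ η (fun i : S => x i) (x t) + η ^ 2) := by
  rw [← quad_option hκ hη, ← quad_comp _ _ (Finset.subtypeInsertEquivOption ht).symm]
  congr 1 <;>
  · ext1 o
    cases o <;> rfl

lemma postMean_eq (S : Finset ℕ) (x : ℕ → Pt d) (y : ℕ → ℝ) (p : Pt d) :
    postMean κ η S x y p = condMean κ η (fun i : S => x i) (fun i => y i) p := rfl

lemma postStd_eq (S : Finset ℕ) (x : ℕ → Pt d) (p : Pt d) :
    postStd κ η S x p = √(condVar κ η (fun i : S => x i) p) := rfl

lemma sq_postStd (hκ : (Matrix.of κ).PosSemidef) (hη : 0 < η) (S : Finset ℕ) (x : ℕ → Pt d)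
    (p : Pt d) : postStd κ η S x p ^ 2 = condVar κ η (fun i : S => x i) p := by
  rw [postStd_eq, Real.sq_sqrt (condVar_nonneg hκ hη _ _)]

/-- A variance up to `k` is at most a constant times its information. -/
lemma le_mul_log (hη : 0 < η) {v : ℝ} (hv : 0 ≤ v) (hvk : v ≤ k) :
    v ≤ (k + η ^ 2) * Real.log (1 + v / η ^ 2) := by
  have h1 := Real.one_sub_inv_le_log_of_pos (show 0 < 1 + v / η ^ 2 by positivity)
  have h2 : 1 - (1 + v / η ^ 2)⁻¹ = v / (v + η ^ 2) := by
    have : v + η ^ 2 ≠ 0 := by positivity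
    field_simp
    ring
  rw [h2] at h1
  have h3 : v = (v + η ^ 2) * (v / (v + η ^ 2)) := by
    have : v + η ^ 2 ≠ 0 := by positivity
    field_simp
  have hk : 0 ≤ k + η ^ 2 := add_nonneg (hv.trans hvk) (sq_nonneg η)
  calc v = (v + η ^ 2) * (v / (v + η ^ 2)) := h3
    _ ≤ (k + η ^ 2) * Real.log (1 + v / η ^ 2) := by gcongr

end InfoGain

/-! ### Steps of one query type and the sum of their variances. -/

section Steps

variable {d : ℕ} {κ : Pt d → Pt d → ℝ} {η k : ℝ} {q : ℕ → Query} {a : Query}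

lemma stepsOf_zero : stepsOf q a 0 = ∅ := by simp [stepsOf]

lemma stepsOf_succ_of_eq {t : ℕ} (h : q t = a) :
    stepsOf q a (t + 1) = insert t (stepsOf q a t) := by
  simp [stepsOf, Finset.range_add_one, Finset.filter_insert, h]

lemma stepsOf_succ_of_ne {t : ℕ} (h : q t ≠ a) : stepsOf q a (t + 1) = stepsOf q a t := by
  simp [stepsOf, Finset.range_add_one, Finset.filter_insert, h]

lemma notMem_stepsOf {t : ℕ} : t ∉ stepsOf q a t := by simp [stepsOf]

lemma mem_stepsOf {s t : ℕ} : s ∈ stepsOf q a t ↔ s < t ∧ q s = a := by simp [stepsOf]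

lemma card_stepsOf_le (q : ℕ → Query) (a : Query) (t : ℕ) : (stepsOf q a t).card ≤ t := by
  have h : stepsOf q a t ⊆ Finset.range t := fun s hs => by simpa using (mem_stepsOf.1 hs).1
  simpa using Finset.card_le_card h

/-- The posterior variances at the queried points sum to at most a multiple of the gain. -/
lemma sum_sq_postStd_le (hκ : (Matrix.of κ).PosSemidef) (hη : 0 < η) (x : ℕ → Pt d)
    (hk : ∀ t, κ (x t) (x t) ≤ k) (q : ℕ → Query) (a : Query) (t : ℕ) :
    ∑ s ∈ stepsOf q a t, postStd κ η (stepsOf q a s) x (x s) ^ 2 ≤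
      2 * (k + η ^ 2) * gain κ η (fun i : stepsOf q a t => x i) := by
  induction t with
  | zero =>
    have : IsEmpty (stepsOf q a 0) := by rw [stepsOf_zero]; infer_instance
    rw [gain_isEmpty]
    simp [stepsOf_zero]
  | succ t ih =>
    by_cases h : q t = a
    · rw [stepsOf_succ_of_eq h, Finset.sum_insert notMem_stepsOf, gain_insert hκ hη x notMem_stepsOf,
        sq_postStd hκ hη]
      have := le_mul_log hη (condVar_nonneg hκ hη (fun i : stepsOf q a t => x i) (x t))
        ((condVar_le hκ hη _ _).trans (hk t))
      linarith
    · rw [stepsOf_succ_of_ne h]; exact ih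

end Steps

/-! ### One-step likelihood ratio against bounded centred noise. -/

section LikelihoodRatio

open Real

/-- **Hoeffding's lemma** for the centred law on two points. -/
lemma two_point_hoeffding {lo w : ℝ} (hw : 0 < w) (hlo : lo ≤ 0) (hhi : 0 ≤ lo + w) (l : ℝ) :
    (lo + w) * exp (l * lo) - lo * exp (l * (lo + w)) ≤ w * exp (w ^ 2 / 8 * l ^ 2) := by
  -- The centred probability law on the two end points; the claim is `w` times the bound on its
  -- moment generating function.
  set μ : Measure ℝ := ENNReal.ofReal ((lo + w) / w) • Measure.dirac lo +
    ENNReal.ofReal (-lo / w) • Measure.dirac (lo + w) with hμ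
  have h1 : 0 ≤ (lo + w) / w := by positivity
  have h2 : 0 ≤ -lo / w := div_nonneg (neg_nonneg.2 hlo) hw.le
  have hP : IsProbabilityMeasure μ := by
    constructor
    rw [hμ]
    simp only [Measure.add_apply, Measure.smul_apply, measure_univ, smul_eq_mul, mul_one]
    rw [← ENNReal.ofReal_add h1 h2, ← ENNReal.ofReal_one]
    congr 1
    field_simp
    ring
  have hint : ∀ g : ℝ → ℝ, Measurable g → ∫ z, g z ∂μ =
      (lo + w) / w * g lo + -lo / w * g (lo + w) := by
    intro g hg
    rw [hμ, integral_add_measure, integral_smul_measure, integral_smul_measure, integral_dirac,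
      integral_dirac, ENNReal.toReal_ofReal h1, ENNReal.toReal_ofReal h2, smul_eq_mul, smul_eq_mul]
    · exact (integrable_dirac (by simp)).smul_measure ENNReal.ofReal_ne_top
    · exact (integrable_dirac (by simp)).smul_measure ENNReal.ofReal_ne_top
  have hb : ∀ᵐ z ∂μ, id z ∈ Set.Icc lo (lo + w) := by
    rw [hμ, ae_add_measure_iff]
    refine ⟨Measure.ae_smul_measure ?_ _, Measure.ae_smul_measure ?_ _⟩ <;>
    · rw [ae_dirac_iff (measurableSet_Icc.preimage measurable_id)]
      exact ⟨by simp; try linarith, by simp; try linarith⟩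
  have hc : μ[id] = 0 := by
    have := hint id measurable_id
    rw [this]; simp only [id]; field_simp; ring
  have h := (hasSubgaussianMGF_of_mem_Icc_of_integral_eq_zero (X := id) measurable_id.aemeasurable
    hb hc).mgf_le l
  rw [mgf, hint (fun z => exp (l * id z)) (by fun_prop)] at h
  have h3 : ((((‖lo + w - lo‖₊ / 2) ^ 2 : NNReal)) : ℝ) * l ^ 2 / 2 = w ^ 2 / 8 * l ^ 2 := by
    simp [abs_of_pos hw]; ring
  rw [h3] at h
  simp only [id] at h
  calc (lo + w) * exp (l * lo) - lo * exp (l * (lo + w))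
      = w * ((lo + w) / w * exp (l * lo) + -lo / w * exp (l * (lo + w))) := by field_simp; ring
    _ ≤ _ := by gcongr

/-- Ratio at `e` of the Gaussian densities of variances `v + η²` and `η²` and means `m` and `0`. -/
noncomputable def ratio (η m v e : ℝ) : ℝ :=
  √(η ^ 2 / (v + η ^ 2)) * exp (e ^ 2 / (2 * η ^ 2) - (e - m) ^ 2 / (2 * (v + η ^ 2)))

/-- The exponents differ by the square `(e - g)²/(2η²)`. The bound is uniform in `g`, so the mixture
over `g` is integrable under any probability law. -/
lemma tilt_le {η : ℝ} (hη : 0 < η) (e g : ℝ) :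
    exp (g * e / η ^ 2 - g ^ 2 / (2 * η ^ 2)) ≤ exp (e ^ 2 / (2 * η ^ 2)) := by
  rw [exp_le_exp, ← sub_nonneg]
  have : e ^ 2 / (2 * η ^ 2) - (g * e / η ^ 2 - g ^ 2 / (2 * η ^ 2)) =
    (e - g) ^ 2 / (2 * η ^ 2) := by field_simp; ring
  rw [this]; positivity

lemma integrable_tilt {η : ℝ} (hη : 0 < η) (e : ℝ) (μ : Measure ℝ) [IsProbabilityMeasure μ] :
    Integrable (fun g => exp (g * e / η ^ 2 - g ^ 2 / (2 * η ^ 2))) μ := by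
  refine Integrable.of_bound (by fun_prop) (exp (e ^ 2 / (2 * η ^ 2))) (ae_of_all _ fun g => ?_)
  rw [norm_eq_abs, abs_of_pos (exp_pos _)]
  exact tilt_le hη e g

/-- The density ratio is a Gaussian mixture of exponentials. -/
lemma ratio_eq_integral {η v : ℝ} (hη : 0 < η) (hv : 0 ≤ v) (m e : ℝ) :
    ratio η m v e = ∫ g, exp (g * e / η ^ 2 - g ^ 2 / (2 * η ^ 2)) ∂(gaussianReal m v.toNNReal) := by
  rcases hv.eq_or_lt with rfl | hv
  · rw [toNNReal_zero, gaussianReal_zero_var, integral_dirac, ratio, zero_add,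
      div_self (by positivity), sqrt_one, one_mul]
    congr 1
    field_simp
    ring
  · rw [integral_gaussianReal_eq_integral_smul (by simpa using hv)]
    have hv' : 0 < v * η ^ 2 / (v + η ^ 2) := by positivity
    -- Bayes' rule for a Gaussian prior on `g` and observation `e`: joint density equals evidence
    -- times posterior density, and the latter integrates to one.
    have key : ∀ g, gaussianPDFReal m v.toNNReal g • exp (g * e / η ^ 2 - g ^ 2 / (2 * η ^ 2)) =
        ratio η m v e * gaussianPDFReal ((m * η ^ 2 + v * e) / (v + η ^ 2))
          (v * η ^ 2 / (v + η ^ 2)).toNNReal g := by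
      intro g
      simp only [gaussianPDFReal, ratio, smul_eq_mul, coe_toNNReal _ hv.le, coe_toNNReal _ hv'.le]
      rw [mul_assoc, ← exp_add, mul_mul_mul_comm, ← exp_add]
      congr 1
      · rw [← sqrt_inv, ← sqrt_inv, ← sqrt_mul (by positivity)]
        congr 1
        field_simp
      · congr 1
        field_simp
        ring
    simp_rw [key]
    rw [integral_const_mul, integral_gaussianPDFReal_eq_one _ (by simpa using hv'), mul_one]

lemma ratio_nonneg (η m v e : ℝ) : 0 ≤ ratio η m v e := by rw [ratio]; positivity

lemma ratio_le {η v : ℝ} (hη : 0 < η) (hv : 0 ≤ v) (m e : ℝ) :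
    ratio η m v e ≤ exp (e ^ 2 / (2 * η ^ 2)) := by
  rw [ratio_eq_integral hη hv]
  calc _ ≤ ∫ _, exp (e ^ 2 / (2 * η ^ 2)) ∂(gaussianReal m v.toNNReal) :=
        integral_mono (integrable_tilt hη e _) (integrable_const _) (tilt_le hη e)
    _ = _ := by simp

/-- The slope of the chord of `ratio η m v` over `[lo, lo + w]`. -/
noncomputable def slope' (η m v lo w : ℝ) : ℝ :=
  (ratio η m v (lo + w) - ratio η m v lo) / w

/-- Each function in the mixture is convex in `e`, so it lies below its chord over the noise
interval. The value of that chord at `0` is the mean under the centred two-point law, at most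
`exp(w²g²/(8η⁴) - g²/(2η²)) ≤ 1` by Hoeffding and `w ≤ 2η`. Integrating over `g` gives an affine
bound in `e` whose slope is determined by the past, so only the conditional mean of the noise is
needed later. -/
lemma ratio_le_one_add {η v m lo w e : ℝ} (hη : 0 < η) (hv : 0 ≤ v) (hw : 0 < w) (hwη : w ≤ 2 * η)
    (hlo : lo ≤ 0) (hhi : 0 ≤ lo + w) (he : lo ≤ e) (he' : e ≤ lo + w) :
    ratio η m v e ≤ 1 + slope' η m v lo w * e := by
  set F : ℝ → ℝ → ℝ := fun e g => exp (g * e / η ^ 2 - g ^ 2 / (2 * η ^ 2)) with hF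
  have hFi : ∀ e, Integrable (F e) (gaussianReal m v.toNNReal) := fun e => integrable_tilt hη e _
  have hpt : ∀ g, w * F e g ≤ (w * 1 + e * F (lo + w) g) - e * F lo g := by
    intro g
    have hsplit : ∀ e, F e g = exp (g / η ^ 2 * e) * exp (-(g ^ 2 / (2 * η ^ 2))) := by
      intro e; rw [hF, ← exp_add]; ring_nf
    have hconv := convexOn_exp.2 (Set.mem_univ (g / η ^ 2 * lo))
      (Set.mem_univ (g / η ^ 2 * (lo + w)))
      (div_nonneg (sub_nonneg.2 he') hw.le : 0 ≤ (lo + w - e) / w)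
      (div_nonneg (sub_nonneg.2 he) hw.le : 0 ≤ (e - lo) / w)
      (by rw [← add_div, div_eq_one_iff_eq hw.ne']; ring)
    have harg : ((lo + w - e) / w) • (g / η ^ 2 * lo) + ((e - lo) / w) • (g / η ^ 2 * (lo + w)) =
        g / η ^ 2 * e := by simp only [smul_eq_mul]; field_simp; ring
    rw [harg] at hconv
    simp only [smul_eq_mul] at hconv
    have hc2 : w * exp (g / η ^ 2 * e) ≤ (lo + w - e) * exp (g / η ^ 2 * lo) +
        (e - lo) * exp (g / η ^ 2 * (lo + w)) := by
      calc _ ≤ w * ((lo + w - e) / w * exp (g / η ^ 2 * lo) +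
          (e - lo) / w * exp (g / η ^ 2 * (lo + w))) := by gcongr
        _ = _ := by field_simp
    have hh := two_point_hoeffding hw hlo hhi (g / η ^ 2)
    have hh2 : exp (w ^ 2 / 8 * (g / η ^ 2) ^ 2) * exp (-(g ^ 2 / (2 * η ^ 2))) ≤ 1 := by
      rw [← exp_add, exp_le_one_iff]
      have : w ^ 2 / 8 * (g / η ^ 2) ^ 2 ≤ (2 * η) ^ 2 / 8 * (g / η ^ 2) ^ 2 := by gcongr
      have h2 : (2 * η) ^ 2 / 8 * (g / η ^ 2) ^ 2 = g ^ 2 / (2 * η ^ 2) := by field_simp; ring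
      linarith
    rw [hsplit, hsplit, hsplit]
    have hE := exp_pos (-(g ^ 2 / (2 * η ^ 2)))
    have h3 := mul_le_mul_of_nonneg_right hc2 hE.le
    have h4 := mul_le_mul_of_nonneg_right hh hE.le
    have h5 := mul_le_mul_of_nonneg_left hh2 hw.le
    linarith
  have h1 : w * ratio η m v e ≤ (w * 1 + e * ratio η m v (lo + w)) - e * ratio η m v lo := by
    simp only [ratio_eq_integral hη hv]
    change w * ∫ g, F e g ∂_ ≤ (w * 1 + e * ∫ g, F (lo + w) g ∂_) - e * ∫ g, F lo g ∂_
    have i1 : Integrable (fun g => w * 1 + e * F (lo + w) g) (gaussianReal m v.toNNReal) :=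
      (integrable_const _).add ((hFi _).const_mul _)
    have h := integral_mono ((hFi _).const_mul _) (i1.sub ((hFi lo).const_mul e)) hpt
    rw [integral_const_mul, integral_sub' i1 ((hFi _).const_mul _),
      integral_add (integrable_const _) ((hFi _).const_mul _), integral_const_mul,
      integral_const_mul, integral_const_mul] at h
    simpa using h
  have h2 : 1 + slope' η m v lo w * e =
      ((w * 1 + e * ratio η m v (lo + w)) - e * ratio η m v lo) / w := by
    rw [slope']; field_simp; ring
  rw [h2, le_div_iff₀ hw]
  linarith

/-- A crude deterministic bound, used to take the slope out of a conditional expectation. -/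
lemma abs_slope_le {η v m lo w : ℝ} (hη : 0 < η) (hv : 0 ≤ v) (hw : 0 < w)
    (hlo : lo ≤ 0) (hhi : 0 ≤ lo + w) :
    |slope' η m v lo w| ≤ exp (w ^ 2 / (2 * η ^ 2)) / w := by
  have h1 : ∀ e, |e| ≤ w → ratio η m v e ≤ exp (w ^ 2 / (2 * η ^ 2)) := by
    intro e he
    refine (ratio_le hη hv m e).trans ?_
    rw [exp_le_exp]
    gcongr ?_ / _
    exact sq_le_sq' (by linarith [abs_le.1 he]) (abs_le.1 he).2
  rw [slope', abs_div, abs_of_pos hw]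
  gcongr
  have := h1 lo (abs_le.2 ⟨by linarith, by linarith⟩)
  have := h1 (lo + w) (abs_le.2 ⟨by linarith, by linarith⟩)
  rw [abs_le]
  constructor <;> linarith [ratio_nonneg η m v lo, ratio_nonneg η m v (lo + w)]

end LikelihoodRatio

/-! ### Measurability of posterior quantities at random points and steps. -/

section Measurability

variable {d : ℕ} {κ : Pt d → Pt d → ℝ} {η : ℝ} {ι : Type*} [Fintype ι] [DecidableEq ι]

lemma continuous_regGram (hκc : Continuous (Function.uncurry κ)) :
    Continuous fun x : ι → Pt d => regGram κ η x := by
  refine continuous_matrix fun i j => ?_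
  simp only [regGram, gram, Matrix.add_apply, Matrix.of_apply]
  have h : Continuous fun x : ι → Pt d => κ (x i) (x j) :=
    hκc.comp (f := fun x : ι → Pt d => (x i, x j))
      ((continuous_apply i).prodMk (continuous_apply j))
  exact h.add continuous_const

/-- Cramer's rule, with a determinant that never vanishes. -/
lemma continuous_regGram_inv (hκ : (Matrix.of κ).PosSemidef) (hη : 0 < η)
    (hκc : Continuous (Function.uncurry κ)) :
    Continuous fun x : ι → Pt d => (regGram κ η x)⁻¹ := by
  simp only [Matrix.inv_def, Ring.inverse_eq_inv']
  exact ((continuous_regGram hκc).matrix_det.inv₀ fun x => (regGram_det_pos hκ hη x).ne').smul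
    (continuous_regGram hκc).matrix_adjugate

lemma continuous_kernel_vec (hκc : Continuous (Function.uncurry κ)) :
    Continuous fun z : (ι → Pt d) × Pt d => fun i => κ z.2 (z.1 i) :=
  continuous_pi fun i =>
    hκc.comp (continuous_snd.prodMk ((continuous_apply i).comp continuous_fst))

lemma continuous_condMean (hκ : (Matrix.of κ).PosSemidef) (hη : 0 < η)
    (hκc : Continuous (Function.uncurry κ)) :
    Continuous fun z : (ι → Pt d) × (ι → ℝ) × Pt d => condMean κ η z.1 z.2.1 z.2.2 := by
  have h1 := (continuous_kernel_vec (ι := ι) hκc).comp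
    (continuous_fst.prodMk (continuous_snd.comp continuous_snd) :
      Continuous fun z : (ι → Pt d) × (ι → ℝ) × Pt d => (z.1, z.2.2))
  exact h1.dotProduct (((continuous_regGram_inv hκ hη hκc).comp continuous_fst).matrix_mulVec
    (continuous_fst.comp continuous_snd))

lemma continuous_condVar (hκ : (Matrix.of κ).PosSemidef) (hη : 0 < η)
    (hκc : Continuous (Function.uncurry κ)) :
    Continuous fun z : (ι → Pt d) × Pt d => condVar κ η z.1 z.2 := by
  have h1 := continuous_kernel_vec (ι := ι) hκc
  exact (hκc.comp (continuous_snd.prodMk continuous_snd)).sub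
    (h1.dotProduct (((continuous_regGram_inv hκ hη hκc).comp continuous_fst).matrix_mulVec h1))

lemma continuous_quad (hκ : (Matrix.of κ).PosSemidef) (hη : 0 < η)
    (hκc : Continuous (Function.uncurry κ)) :
    Continuous fun z : (ι → Pt d) × (ι → ℝ) => quad κ η z.1 z.2 :=
  continuous_snd.dotProduct (((continuous_regGram_inv hκ hη hκc).comp
    continuous_fst).matrix_mulVec continuous_snd)

lemma continuous_gain (hκ : (Matrix.of κ).PosSemidef) (hη : 0 < η)
    (hκc : Continuous (Function.uncurry κ)) :
    Continuous fun x : ι → Pt d => gain κ η x :=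
  (((continuous_regGram hκc).matrix_det.log fun x => (regGram_det_pos hκ hη x).ne').sub
    continuous_const).const_mul _

/-- A function of the steps and of `ω` is measurable in `ω` if it is so for constant steps. -/
lemma measurable_comp_stepsOf {Ω : Type*} {m : MeasurableSpace Ω} {q : ℕ → Ω → Query}
    {a : Query} {t : ℕ} (hq : ∀ s < t, MeasurableSet[m] {ω | q s ω = a})
    (F : Finset ℕ → Ω → ℝ) (hF : ∀ S, S ⊆ Finset.range t → Measurable[m] (F S)) :
    Measurable[m] fun ω => F (stepsOf (fun s => q s ω) a t) ω := by
  have hset : ∀ S : Finset ℕ, MeasurableSet[m] {ω | stepsOf (fun s => q s ω) a t = S} := by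
    intro S
    have : {ω | stepsOf (fun s => q s ω) a t = S} =
        ⋂ s : ℕ, {ω | (s < t ∧ q s ω = a) ↔ s ∈ S} := by
      ext ω
      simp [Finset.ext_iff, mem_stepsOf]
    rw [this]
    refine MeasurableSet.iInter fun s => ?_
    by_cases hs : s < t
    · by_cases hS : s ∈ S
      · simpa [hs, hS] using hq s hs
      · have h : {ω | (s < t ∧ q s ω = a) ↔ s ∈ S} = {ω | q s ω = a}ᶜ := by
          ext ω; simp [hs, hS]
        rw [h]
        exact (hq s hs).compl
    · by_cases hS : s ∈ S <;> simp [hs, hS]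
  intro B hB
  -- The random set of steps takes only finitely many values.
  have : (fun ω => F (stepsOf (fun s => q s ω) a t) ω) ⁻¹' B =
      ⋃ S ∈ (Finset.range t).powerset, {ω | stepsOf (fun s => q s ω) a t = S} ∩ F S ⁻¹' B := by
    ext ω
    simp only [Set.mem_preimage, Set.mem_iUnion, Finset.mem_powerset, Set.mem_inter_iff,
      Set.mem_ofPred_eq]
    constructor
    · intro h
      exact ⟨_, fun s hs => by simpa using (mem_stepsOf.1 hs).1, rfl, h⟩
    · rintro ⟨S, -, hS, h⟩
      rwa [hS]
  rw [this]
  exact Finset.measurableSet_biUnion _ fun S hS =>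
    (hset S).inter (hF S (Finset.mem_powerset.1 hS) hB)

end Measurability

/-! ### The likelihood supermartingale and its maximal inequality. -/

section Supermartingale

open Real

variable {d : ℕ}

/-- The ratio at the noise `e` of the density of the Gaussian process observations at the steps
`S` to the density of pure noise. -/
noncomputable def likelihood (κ : Pt d → Pt d → ℝ) (η : ℝ) (S : Finset ℕ) (x : ℕ → Pt d)
    (e : ℕ → ℝ) : ℝ :=
  exp (1 / 2 * ((∑ s ∈ S, e s ^ 2) / η ^ 2 - quad κ η (fun i : S => x i) fun i => e i) -
    gain κ η fun i : S => x i)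

variable {κ : Pt d → Pt d → ℝ} {η : ℝ}

/-- Densities multiply along observations: the new factor compares the predictive law, of variance
`v + η²`, with the pure noise law. -/
lemma likelihood_insert (hκ : (Matrix.of κ).PosSemidef) (hη : 0 < η) (x : ℕ → Pt d) (e : ℕ → ℝ)
    {S : Finset ℕ} {t : ℕ} (ht : t ∉ S) :
    likelihood κ η (insert t S) x e = likelihood κ η S x e *
      ratio η (condMean κ η (fun i : S => x i) (fun i => e i) (x t))
        (condVar κ η (fun i : S => x i) (x t)) (e t) := by
  have hv := condVar_nonneg hκ hη (fun i : S => x i) (x t)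
  set v := condVar κ η (fun i : S => x i) (x t)
  have h1 : √(η ^ 2 / (v + η ^ 2)) = exp (-(1 / 2 * log (1 + v / η ^ 2))) := by
    have h2 : 1 + v / η ^ 2 = (η ^ 2 / (v + η ^ 2))⁻¹ := by field_simp; ring
    have h3 : 0 < η ^ 2 / (v + η ^ 2) := by positivity
    rw [h2, log_inv, mul_neg, neg_neg, one_div_mul_eq_div, ← log_sqrt h3.le,
      exp_log (sqrt_pos.2 h3)]
  rw [likelihood, likelihood, ratio, h1, ← exp_add, ← exp_add, Finset.sum_insert ht,
    quad_insert hκ hη x e ht, gain_insert hκ hη x ht]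
  congr 1
  have hvη : v + η ^ 2 ≠ 0 := by positivity
  change 1 / 2 * ((e t ^ 2 + ∑ s ∈ S, e s ^ 2) / η ^ 2 - (_ + _ / (v + η ^ 2))) -
    (_ + 1 / 2 * log (1 + v / η ^ 2)) = _
  field_simp
  ring

lemma likelihood_pos (S : Finset ℕ) (x : ℕ → Pt d) (e : ℕ → ℝ) : 0 < likelihood κ η S x e :=
  exp_pos _

lemma gain_nonneg (hκ : (Matrix.of κ).PosSemidef) (hη : 0 < η) {ι : Type*} [Fintype ι]
    [DecidableEq ι] (x : ι → Pt d) : 0 ≤ gain κ η x := by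
  rw [← gain_comp x (Fintype.equivFin ι).symm]
  exact gain_fin_nonneg hκ hη _

lemma likelihood_le (hκ : (Matrix.of κ).PosSemidef) (hη : 0 < η) (S : Finset ℕ) (x : ℕ → Pt d)
    (e : ℕ → ℝ) : likelihood κ η S x e ≤ exp (1 / 2 * ((∑ s ∈ S, e s ^ 2) / η ^ 2)) := by
  rw [likelihood, exp_le_exp]
  linarith [gain_nonneg hκ hη fun i : S => x i, quad_nonneg hκ hη (fun i : S => x i) fun i => e i]

/-- Noise of the queries of type `a` whose conditional law is centred and supported in an interval
of length `w` that is known beforehand. -/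
structure IsNoise {Ω : Type*} {mΩ : MeasurableSpace Ω} (P : Measure Ω) (ℱ : Filtration ℕ mΩ)
    (a : Query) (w : ℝ) (x : ℕ → Ω → Pt d) (q : ℕ → Ω → Query) (e lo : ℕ → Ω → ℝ) : Prop where
  point_meas : ∀ t, Measurable[ℱ t] (x t)
  query_meas : ∀ t, MeasurableSet[ℱ t] {ω | q t ω = a}
  noise_meas : ∀ t, Measurable[ℱ (t + 1)] (e t)
  lo_meas : ∀ t, Measurable[ℱ t] (lo t)
  lo_nonpos : ∀ t ω, lo t ω ≤ 0
  hi_nonneg : ∀ t ω, 0 ≤ lo t ω + w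
  bound : ∀ t, ∀ᵐ ω ∂P, q t ω = a → lo t ω ≤ e t ω ∧ e t ω ≤ lo t ω + w
  mean : ∀ t, P[Set.indicator {ω | q t ω = a} (e t) | ℱ t] =ᵐ[P] 0

variable {Ω : Type*} {mΩ : MeasurableSpace Ω} {P : Measure Ω} [IsProbabilityMeasure P]
  {ℱ : Filtration ℕ mΩ} {a : Query} {w : ℝ} {x : ℕ → Ω → Pt d} {q : ℕ → Ω → Query}
  {e lo : ℕ → Ω → ℝ}

/-- The likelihood of the noise of the queries of type `a` before step `t`. -/
noncomputable def likelihoodProcess (κ : Pt d → Pt d → ℝ) (η : ℝ) (a : Query) (x : ℕ → Ω → Pt d)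
    (q : ℕ → Ω → Query) (e : ℕ → Ω → ℝ) (t : ℕ) (ω : Ω) : ℝ :=
  likelihood κ η (stepsOf (fun s => q s ω) a t) (fun s => x s ω) (fun s => e s ω)

lemma measurable_likelihoodProcess (hκ : (Matrix.of κ).PosSemidef) (hη : 0 < η)
    (hκc : Continuous (Function.uncurry κ)) (h : IsNoise P ℱ a w x q e lo) (t : ℕ) :
    Measurable[ℱ t] (likelihoodProcess κ η a x q e t) := by
  refine measurable_comp_stepsOf (m := ℱ t) (fun s hs => ℱ.mono hs.le _ (h.query_meas s))
    (fun S ω => likelihood κ η S (fun s => x s ω) (fun s => e s ω)) fun S hS => ?_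
  have hlt : ∀ s ∈ S, s < t := fun s hs => by simpa using hS hs
  have hx : Measurable[ℱ t] fun ω => fun i : S => x i ω :=
    @measurable_pi_lambda _ _ _ (ℱ t) _ _ fun i =>
      (h.point_meas i).mono (ℱ.mono (hlt i i.2).le) le_rfl
  have he' : ∀ s ∈ S, Measurable[ℱ t] (e s) := fun s hs =>
    (h.noise_meas s).mono (ℱ.mono (hlt s hs)) le_rfl
  have he : Measurable[ℱ t] fun ω => fun i : S => e i ω :=
    @measurable_pi_lambda _ _ _ (ℱ t) _ _ fun i => he' i i.2
  have h1 : Measurable[ℱ t] fun ω => quad κ η (fun i : S => x i ω) (fun i => e i ω) :=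
    (continuous_quad hκ hη hκc).measurable.comp
      (f := fun ω => (fun i : S => x i ω, fun i : S => e i ω)) (hx.prodMk he)
  have h2 : Measurable[ℱ t] fun ω => gain κ η (fun i : S => x i ω) :=
    (continuous_gain hκ hη hκc).measurable.comp hx
  have h3 : Measurable[ℱ t] fun ω => ∑ s ∈ S, e s ω ^ 2 :=
    @Finset.measurable_fun_sum _ _ _ _ _ _ (ℱ t) _ S fun s hs => (he' s hs).pow_const 2
  unfold likelihood
  exact measurable_exp.comp ((((h3.div_const _).sub h1).const_mul _).sub h2)

/-- The slope of the chord of the next likelihood ratio. -/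
noncomputable def slopeProcess (κ : Pt d → Pt d → ℝ) (η w : ℝ) (a : Query) (x : ℕ → Ω → Pt d)
    (q : ℕ → Ω → Query) (e lo : ℕ → Ω → ℝ) (t : ℕ) (ω : Ω) : ℝ :=
  slope' η (condMean κ η (fun i : stepsOf (fun s => q s ω) a t => x i ω) (fun i => e i ω) (x t ω))
    (condVar κ η (fun i : stepsOf (fun s => q s ω) a t => x i ω) (x t ω)) (lo t ω) w

lemma measurable_slope' (η w : ℝ) :
    Measurable fun z : ℝ × ℝ × ℝ => slope' η z.1 z.2.1 z.2.2 w := by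
  unfold slope' ratio
  fun_prop

lemma measurable_slopeProcess (hκ : (Matrix.of κ).PosSemidef) (hη : 0 < η)
    (hκc : Continuous (Function.uncurry κ)) (h : IsNoise P ℱ a w x q e lo) (t : ℕ) :
    Measurable[ℱ t] (slopeProcess κ η w a x q e lo t) := by
  refine measurable_comp_stepsOf (m := ℱ t) (fun s hs => ℱ.mono hs.le _ (h.query_meas s))
    (fun S ω => slope' η (condMean κ η (fun i : S => x i ω) (fun i => e i ω) (x t ω))
    (condVar κ η (fun i : S => x i ω) (x t ω)) (lo t ω) w) fun S hS => ?_
  have hlt : ∀ s ∈ S, s < t := fun s hs => by simpa using hS hs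
  have hx : Measurable[ℱ t] fun ω => fun i : S => x i ω :=
    @measurable_pi_lambda _ _ _ (ℱ t) _ _ fun i =>
      (h.point_meas i).mono (ℱ.mono (hlt i i.2).le) le_rfl
  have he : Measurable[ℱ t] fun ω => fun i : S => e i ω :=
    @measurable_pi_lambda _ _ _ (ℱ t) _ _ fun i => (h.noise_meas i).mono (ℱ.mono (hlt i i.2)) le_rfl
  have h1 : Measurable[ℱ t] fun ω => condMean κ η (fun i : S => x i ω) (fun i => e i ω) (x t ω) :=
    (continuous_condMean hκ hη hκc).measurable.comp
      (f := fun ω => (fun i : S => x i ω, fun i : S => e i ω, x t ω)) (hx.prodMk (he.prodMk (h.point_meas t)))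
  have h2 : Measurable[ℱ t] fun ω => condVar κ η (fun i : S => x i ω) (x t ω) :=
    (continuous_condVar hκ hη hκc).measurable.comp
      (f := fun ω => (fun i : S => x i ω, x t ω)) (hx.prodMk (h.point_meas t))
  exact (measurable_slope' η w).comp
    (f := fun ω => (condMean κ η (fun i : S => x i ω) (fun i => e i ω) (x t ω),
      condVar κ η (fun i : S => x i ω) (x t ω), lo t ω)) (h1.prodMk (h2.prodMk (h.lo_meas t)))

/-- The noise interval contains `0`, so each noise value is at most `w` in modulus. A deterministic
bound at each time suffices for all integrability questions. -/
lemma likelihoodProcess_bound (hκ : (Matrix.of κ).PosSemidef) (hη : 0 < η)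
    (h : IsNoise P ℱ a w x q e lo) (t : ℕ) :
    ∀ᵐ ω ∂P, likelihoodProcess κ η a x q e t ω ≤ exp (1 / 2 * ((t * w ^ 2) / η ^ 2)) := by
  filter_upwards [ae_all_iff.2 h.bound] with ω hω
  refine (likelihood_le hκ hη _ _ _).trans ?_
  rw [exp_le_exp]
  gcongr
  calc ∑ s ∈ stepsOf (fun s => q s ω) a t, e s ω ^ 2
      ≤ ∑ s ∈ stepsOf (fun s => q s ω) a t, w ^ 2 := by
        refine Finset.sum_le_sum fun s hs => ?_
        have h1 := hω s (mem_stepsOf.1 hs).2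
        have h2 := h.lo_nonpos s ω
        have h3 := h.hi_nonneg s ω
        exact sq_le_sq' (by linarith) (by linarith)
    _ = (stepsOf (fun s => q s ω) a t).card * w ^ 2 := by simp
    _ ≤ t * w ^ 2 := by gcongr; exact card_stepsOf_le _ _ _

lemma integrable_likelihoodProcess (hκ : (Matrix.of κ).PosSemidef) (hη : 0 < η)
    (hκc : Continuous (Function.uncurry κ)) (h : IsNoise P ℱ a w x q e lo) (t : ℕ) :
    Integrable (likelihoodProcess κ η a x q e t) P := by
  refine Integrable.of_bound (((measurable_likelihoodProcess hκ hη hκc h t).mono (ℱ.le t)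
    le_rfl).aestronglyMeasurable) (exp (1 / 2 * ((t * w ^ 2) / η ^ 2))) ?_
  filter_upwards [likelihoodProcess_bound hκ hη h t] with ω hω
  rwa [norm_eq_abs, abs_of_pos (show 0 < likelihoodProcess κ η a x q e t ω from
    likelihood_pos _ _ _)]

/-- The likelihood is a supermartingale. -/
lemma setIntegral_likelihoodProcess_succ_le (hκ : (Matrix.of κ).PosSemidef) (hη : 0 < η)
    (hκc : Continuous (Function.uncurry κ)) (h : IsNoise P ℱ a w x q e lo) (hw : 0 < w)
    (hwη : w ≤ 2 * η) (t : ℕ) {E : Set Ω} (hE : MeasurableSet[ℱ t] E) :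
    ∫ ω in E, likelihoodProcess κ η a x q e (t + 1) ω ∂P ≤
      ∫ ω in E, likelihoodProcess κ η a x q e t ω ∂P := by
  set M := likelihoodProcess κ η a x q e with hM
  set b := slopeProcess κ η w a x q e lo t with hb
  set W : Ω → ℝ := Set.indicator {ω | q t ω = a} (e t) with hW
  -- The coefficient of the noise in the affine bound for the next likelihood, known before step
  -- `t`.
  set Z : Ω → ℝ := E.indicator (fun ω => M t ω * b ω) with hZ
  have hEm : MeasurableSet E := ℱ.le t _ hE
  have hZm : Measurable[ℱ t] Z :=
    ((measurable_likelihoodProcess hκ hη hκc h t).mul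
      (measurable_slopeProcess hκ hη hκc h t)).indicator hE
  have hbb : ∀ ω, |b ω| ≤ exp (w ^ 2 / (2 * η ^ 2)) / w := fun ω =>
    abs_slope_le hη (condVar_nonneg hκ hη _ _) hw (h.lo_nonpos t ω) (h.hi_nonneg t ω)
  have hZb : ∀ᵐ ω ∂P, ‖Z ω‖ ≤
      exp (1 / 2 * ((t * w ^ 2) / η ^ 2)) * (exp (w ^ 2 / (2 * η ^ 2)) / w) := by
    filter_upwards [likelihoodProcess_bound hκ hη h t] with ω hω
    refine (norm_indicator_le_norm_self _ _).trans ?_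
    rw [norm_mul]
    refine mul_le_mul ?_ (hbb ω) (norm_nonneg _) (exp_pos _).le
    rwa [norm_eq_abs, abs_of_pos (show 0 < M t ω from likelihood_pos _ _ _)]
  have hWm : Measurable W :=
    ((h.noise_meas t).mono (ℱ.le _) le_rfl).indicator (ℱ.le _ _ (h.query_meas t))
  have hWb : ∀ᵐ ω ∂P, ‖W ω‖ ≤ w := by
    filter_upwards [h.bound t] with ω hω
    by_cases hq : q t ω = a
    · rw [hW, Set.indicator_of_mem (show ω ∈ {ω | q t ω = a} from hq), norm_eq_abs, abs_le]
      have h1 := hω hq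
      have h2 := h.lo_nonpos t ω
      have h3 := h.hi_nonneg t ω
      constructor <;> linarith
    · rw [hW, Set.indicator_of_notMem (show ω ∉ {ω | q t ω = a} from hq), norm_zero]
      exact hw.le
  have hWi : Integrable W P := Integrable.of_bound hWm.aestronglyMeasurable w hWb
  -- `Z` is bounded and known, so it comes out of the conditional expectation, and `W` has
  -- conditional mean zero.
  have hzero : ∫ ω, (Z * W) ω ∂P = 0 := by
    rw [← integral_condExp (ℱ.le t)]
    have h1 := condExp_stronglyMeasurable_mul_of_bound (ℱ.le t) (hZm.stronglyMeasurable)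
      hWi _ hZb
    rw [integral_congr_ae (h1.trans ((EventuallyEq.refl _ Z).mul (h.mean t)))]
    simp
  have hZWi : Integrable (Z * W) P := hWi.bdd_mul ((hZm.mono (ℱ.le t) le_rfl).aestronglyMeasurable) hZb
  have hMi := fun t => integrable_likelihoodProcess hκ hη hκc h t
  have hle : ∀ᵐ ω ∂P, E.indicator (M (t + 1)) ω ≤ E.indicator (M t) ω + (Z * W) ω := by
    filter_upwards [h.bound t] with ω hω
    by_cases hωE : ω ∈ E
    · simp only [hZ, Pi.mul_apply, Set.indicator_of_mem hωE]
      by_cases hq : q t ω = a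
      · rw [hW, Set.indicator_of_mem (show ω ∈ {ω | q t ω = a} from hq)]
        have h1 := hω hq
        have h2 : M (t + 1) ω = M t ω * ratio η
            (condMean κ η (fun i : stepsOf (fun s => q s ω) a t => x i ω) (fun i => e i ω) (x t ω))
            (condVar κ η (fun i : stepsOf (fun s => q s ω) a t => x i ω) (x t ω)) (e t ω) := by
          rw [hM, likelihoodProcess, stepsOf_succ_of_eq hq,
            likelihood_insert hκ hη _ _ notMem_stepsOf]
          rfl
        have h3 := ratio_le_one_add
          (m := condMean κ η (fun i : stepsOf (fun s => q s ω) a t => x i ω) (fun i => e i ω)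
            (x t ω)) hη (condVar_nonneg hκ hη
          (fun i : stepsOf (fun s => q s ω) a t => x i ω) (x t ω)) hw hwη (h.lo_nonpos t ω)
          (h.hi_nonneg t ω) h1.1 h1.2
        rw [h2]
        calc _ ≤ M t ω * (1 + b ω * e t ω) :=
              mul_le_mul_of_nonneg_left h3 (likelihood_pos _ _ _).le
          _ = _ := by ring
      · rw [hW, Set.indicator_of_notMem (show ω ∉ {ω | q t ω = a} from hq), mul_zero, add_zero]
        rw [hM, likelihoodProcess, stepsOf_succ_of_ne hq]
        rfl
    · simp [hZ, Set.indicator_of_notMem hωE]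
  rw [← integral_indicator hEm, ← integral_indicator hEm]
  calc ∫ ω, E.indicator (M (t + 1)) ω ∂P ≤ ∫ ω, (E.indicator (M t) ω + (Z * W) ω) ∂P :=
        integral_mono_ae ((hMi _).indicator hEm) (((hMi _).indicator hEm).add hZWi) hle
    _ = ∫ ω, E.indicator (M t) ω ∂P := by
      rw [integral_add ((hMi _).indicator hEm) hZWi, hzero, add_zero]

/-- **Ville's inequality** for the likelihood. -/
lemma measure_likelihoodProcess_ge (hκ : (Matrix.of κ).PosSemidef) (hη : 0 < η)
    (hκc : Continuous (Function.uncurry κ)) (h : IsNoise P ℱ a w x q e lo) (hw : 0 < w)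
    (hwη : w ≤ 2 * η) {c : ℝ} (hc : 1 < c) :
    P {ω | ∃ t, c ≤ likelihoodProcess κ η a x q e t ω} ≤ ENNReal.ofReal (1 / c) := by
  set M := likelihoodProcess κ η a x q e with hM
  have hMm := fun t => measurable_likelihoodProcess hκ hη hκc h t
  have hMi := fun t => integrable_likelihoodProcess hκ hη hκc h t
  -- The event that level `c` has not been reached up to time `t`.
  set E : ℕ → Set Ω := fun t => {ω | ∀ s ≤ t, M s ω < c} with hE
  have hEm : ∀ t, MeasurableSet[ℱ t] (E t) := by
    intro t
    have : E t = ⋂ s ∈ Finset.range (t + 1), {ω | M s ω < c} := by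
      ext ω; simp [hE]
    rw [this]
    refine @Finset.measurableSet_biInter _ _ (ℱ t) _ _ fun s hs => ?_
    have hst : s ≤ t := by simpa [Nat.lt_succ_iff] using hs
    exact ((hMm s).mono (ℱ.mono hst) le_rfl) measurableSet_Iio
  have hEm' : ∀ t, MeasurableSet (E t) := fun t => ℱ.le t _ (hEm t)
  have hanti : Antitone E := fun s t hst ω hω u hu => hω u (hu.trans hst)
  -- Ville's inequality without stopping times: level times the probability of having crossed, plus
  -- the mass on the paths that have not, never exceeds its initial value. Paths that cross at `t +
  -- 1` carry mass at least `c` times their probability.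
  have key : ∀ t, c * P.real (E t)ᶜ + ∫ ω in E t, M t ω ∂P ≤ 1 := by
    intro t
    induction t with
    | zero =>
      have h0 : ∀ ω, M 0 ω = 1 := by
        intro ω
        have : IsEmpty (stepsOf (fun s => q s ω) a 0) := by rw [stepsOf_zero]; infer_instance
        rw [hM, likelihoodProcess, likelihood, gain_isEmpty, quad]
        simp [stepsOf_zero, dotProduct]
      have hE0 : E 0 = Set.univ := by
        ext ω; simp [hE, h0, hc]
      rw [hE0]
      simp [h0]
    | succ t ih =>
      have h1 := setIntegral_likelihoodProcess_succ_le hκ hη hκc h hw hwη t (hEm t)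
      have hsub : E (t + 1) ⊆ E t := hanti (Nat.le_succ t)
      have hsplit : E t = E (t + 1) ∪ (E t \ E (t + 1)) := (Set.union_sdiff_cancel hsub).symm
      have h2 : ∫ ω in E t, M (t + 1) ω ∂P =
          ∫ ω in E (t + 1), M (t + 1) ω ∂P + ∫ ω in E t \ E (t + 1), M (t + 1) ω ∂P := by
        conv_lhs => rw [hsplit]
        exact setIntegral_union Set.disjoint_sdiff_right ((hEm' t).diff (hEm' _))
          (hMi _).integrableOn (hMi _).integrableOn
      have h3 : c * P.real (E t \ E (t + 1)) ≤ ∫ ω in E t \ E (t + 1), M (t + 1) ω ∂P := by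
        have : ∫ ω in E t \ E (t + 1), c ∂P = c * P.real (E t \ E (t + 1)) := by
          rw [setIntegral_const, smul_eq_mul, mul_comm]
        rw [← this]
        refine setIntegral_mono_on (integrable_const _).integrableOn (hMi _).integrableOn
          ((hEm' t).diff (hEm' _)) fun ω hω => ?_
        by_contra hlt
        push Not at hlt
        refine hω.2 fun s hs => ?_
        rcases Nat.le_succ_iff.1 hs with hs | rfl
        · exact hω.1 s hs
        · exact hlt
      have h4 : P.real (E (t + 1))ᶜ = P.real (E t)ᶜ + P.real (E t \ E (t + 1)) := by
        rw [← measureReal_union _ ((hEm' t).diff (hEm' _))]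
        · congr 1
          ext ω
          simp only [Set.mem_compl_iff, Set.mem_union, Set.mem_sdiff]
          constructor
          · intro hω
            by_cases hωt : ω ∈ E t
            · exact Or.inr ⟨hωt, hω⟩
            · exact Or.inl hωt
          · rintro (hω | hω)
            · exact fun h' => hω (hsub h')
            · exact hω.2
        · exact Set.disjoint_left.2 fun ω hω hω' => hω hω'.1
      rw [h4, mul_add]
      linarith
  have hreal : ∀ t, P (E t)ᶜ ≤ ENNReal.ofReal (1 / c) := by
    intro t
    have h1 : 0 ≤ ∫ ω in E t, M t ω ∂P := integral_nonneg fun ω => (likelihood_pos _ _ _).le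
    rw [← ofReal_measureReal]
    refine ENNReal.ofReal_le_ofReal ?_
    rw [le_div_iff₀ (by linarith), mul_comm]
    linarith [key t]
  have hunion : {ω | ∃ t, c ≤ M t ω} ⊆ ⋃ t, (E t)ᶜ := by
    rintro ω ⟨t, ht⟩
    refine Set.mem_iUnion.2 ⟨t, fun hω => ?_⟩
    exact absurd (hω t le_rfl) (not_lt.2 ht)
  refine (measure_mono hunion).trans ?_
  have hmono : Monotone fun t => (E t)ᶜ := fun s t hst => Set.compl_subset_compl.2 (hanti hst)
  rw [hmono.measure_iUnion]
  exact iSup_le hreal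

/-- Off an event of probability `δ`, the posterior mean of the noise is at most a multiple of the
posterior standard deviation. -/
lemma sq_condMean_noise_le (hκ : (Matrix.of κ).PosSemidef) (hη : 0 < η) (S : Finset ℕ)
    (x : ℕ → Pt d) (e : ℕ → ℝ) {c : ℝ} (hc : likelihood κ η S x e ≤ exp c) (p : Pt d) :
    |postMean κ η S x e p| ≤ √(2 * (gain κ η (fun i : S => x i) + c)) * postStd κ η S x p := by
  have h1 := sq_condMean_le hκ hη (fun i : S => x i) (fun i => e i) p
  have h2 : (fun i : S => e i) ⬝ᵥ (fun i : S => e i) = ∑ s ∈ S, e s ^ 2 := by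
    rw [dotProduct, ← Finset.sum_coe_sort S]
    exact Finset.sum_congr rfl fun i _ => (sq _).symm
  rw [likelihood, exp_le_exp] at hc
  rw [h2] at h1
  have hv := condVar_nonneg hκ hη (fun i : S => x i) p
  rw [postStd_eq, ← sqrt_mul' _ hv, postMean_eq]
  refine abs_le_sqrt (h1.trans ?_)
  gcongr
  linarith

end Supermartingale

/-! ### Functions in the RKHS ball: continuity and confidence bands. -/

section RKHS

variable {d : ℕ} {κ : Pt d → Pt d → ℝ} {η B : ℝ} {X : Set (Pt d)} {g : Pt d → ℝ}

/-- A linear combination of values of a function in the ball of the reproducing kernel Hilbert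
space is bounded by the kernel norm of the functional. -/
lemma InRKHSBall.abs_residual_le (h : InRKHSBall κ X B g) (hκ : (Matrix.of κ).PosSemidef)
    {ι : Type*} [Fintype ι] [DecidableEq ι] {x : ι → Pt d} (hx : ∀ i, x i ∈ X) {p : Pt d}
    (hp : p ∈ X) (c : ι → ℝ) :
    |g p - ∑ i, c i * g (x i)| ≤
      B * √(κ p p - 2 * ((fun i => κ p (x i)) ⬝ᵥ c) + c ⬝ᵥ (gram κ x *ᵥ c)) := by
  obtain ⟨H, _, _, _, _, u, hker, hu, hB⟩ := h
  have hin : ∀ a b : X, inner ℝ (RKHS.kerFun H a (1 : ℝ)) (RKHS.kerFun H b (1 : ℝ)) = κ a b := by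
    intro a b
    rw [RKHS.kerFun_inner, RKHS.kerFun_apply, hker]
    simp
  set v : H := RKHS.kerFun H (⟨p, hp⟩ : X) (1 : ℝ) -
    ∑ i, c i • RKHS.kerFun H (⟨x i, hx i⟩ : X) (1 : ℝ) with hv
  have h1 : inner ℝ v u = g p - ∑ i, c i * g (x i) := by
    rw [hv, inner_sub_left, sum_inner, RKHS.kerFun_inner]
    simp only [inner_smul_left, RKHS.kerFun_inner, hu]
    simp
  have h2 : ‖v‖ ^ 2 = κ p p - 2 * ((fun i => κ p (x i)) ⬝ᵥ c) + c ⬝ᵥ (gram κ x *ᵥ c) := by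
    rw [← real_inner_self_eq_norm_sq, hv, inner_sub_left, inner_sub_right, inner_sub_right]
    simp only [inner_sum, sum_inner, inner_smul_left, inner_smul_right, hin, conj_trivial]
    simp only [dotProduct, Matrix.mulVec, gram, Matrix.of_apply, kernel_symm hκ _ p,
      Finset.mul_sum]
    have : ∑ i, c i * κ p (x i) = ∑ i, κ p (x i) * c i :=
      Finset.sum_congr rfl fun i _ => mul_comm _ _
    rw [this, ← Finset.mul_sum]
    have h3 : ∀ i j, c i * (c j * κ (x j) (x i)) = c j * (κ (x j) (x i) * c i) :=
      fun i j => by ring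
    simp only [h3]
    ring_nf
    rw [Finset.sum_comm]
  rw [← h2, Real.sqrt_sq (norm_nonneg _), ← h1]
  calc |inner ℝ v u| ≤ ‖v‖ * ‖u‖ := abs_real_inner_le_norm _ _
    _ ≤ B * ‖v‖ := by rw [mul_comm]; gcongr

lemma InRKHSBall.abs_sub_le (h : InRKHSBall κ X B g) (hκ : (Matrix.of κ).PosSemidef)
    {p p' : Pt d} (hp : p ∈ X) (hp' : p' ∈ X) :
    |g p - g p'| ≤ B * √(κ p p - 2 * κ p p' + κ p' p') := by
  have := h.abs_residual_le hκ (ι := Unit) (x := fun _ => p') (fun _ => hp') hp (fun _ => 1)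
  simpa [dotProduct, Matrix.mulVec, gram] using this

lemma InRKHSBall.abs_le (h : InRKHSBall κ X B g) (hκ : (Matrix.of κ).PosSemidef)
    {p : Pt d} (hp : p ∈ X) : |g p| ≤ B * √(κ p p) := by
  have := h.abs_residual_le hκ (ι := Empty) (x := fun i => i.elim) (fun i => i.elim) hp
    (fun i => i.elim)
  simpa [dotProduct] using this

/-- Increments are controlled by the kernel distance, which is continuous. This supplies both the
measurability of the noise and the existence of maximizers on `X`. -/
lemma InRKHSBall.continuousOn (h : InRKHSBall κ X B g) (hκ : (Matrix.of κ).PosSemidef)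
    (hκc : Continuous (Function.uncurry κ)) : ContinuousOn g X := by
  intro p hp
  rw [ContinuousWithinAt, tendsto_iff_norm_sub_tendsto_zero]
  have hc : Continuous fun p' : Pt d => B * √(κ p' p' - 2 * κ p' p + κ p p) := by
    have h1 : Continuous fun p' : Pt d => κ p' p' := hκc.comp (continuous_id.prodMk continuous_id)
    have h2 : Continuous fun p' : Pt d => κ p' p := hκc.comp (continuous_id.prodMk continuous_const)
    fun_prop
  have h0 : Tendsto (fun p' : Pt d => B * √(κ p' p' - 2 * κ p' p + κ p p))
      (nhdsWithin p X) (nhds 0) := by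
    have := (hc.tendsto p).mono_left (nhdsWithin_le_nhds (s := X))
    have h3 : κ p p - 2 * κ p p + κ p p = 0 := by ring
    rwa [h3, Real.sqrt_zero, mul_zero] at this
  refine squeeze_zero' (Eventually.of_forall fun _ => norm_nonneg _) ?_ h0
  filter_upwards [self_mem_nhdsWithin] with p' hp'
  exact h.abs_sub_le hκ hp' hp

/-- Confidence bound: if the likelihood of the noise is at most `exp c`, the posterior mean of the
observations is close to the function. -/
lemma InRKHSBall.abs_sub_postMean_le (h : InRKHSBall κ X B g) (hκ : (Matrix.of κ).PosSemidef)
    (hη : 0 < η) {S : Finset ℕ} {x : ℕ → Pt d} (hx : ∀ t, x t ∈ X) {y : ℕ → ℝ} {c : ℝ}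
    (hc : likelihood κ η S x (fun s => y s - g (x s)) ≤ Real.exp c) (hB : 0 ≤ B) {p : Pt d}
    (hp : p ∈ X) :
    |g p - postMean κ η S x y p| ≤
      (B + √(2 * (gain κ η (fun i : S => x i) + c))) * postStd κ η S x p := by
  have h1 := sq_condMean_noise_le hκ hη S x _ hc p
  have h2 := h.abs_residual_le hκ (x := fun i : S => x i) (fun i => hx i) hp
    ((regGram κ η fun i : S => x i)⁻¹ *ᵥ fun i => κ p (x i))
  have h3 := residual_le_condVar hκ hη (fun i : S => x i) p
  -- The posterior mean is linear in the data, so it splits into its action on the function values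
  -- and on the noise.
  have h4 : postMean κ η S x y p =
      ∑ i : S, ((regGram κ η fun i : S => x i)⁻¹ *ᵥ fun i => κ p (x i)) i * g (x i) +
      postMean κ η S x (fun s => y s - g (x s)) p := by
    have e1 : ∑ i : S, ((regGram κ η fun i : S => x i)⁻¹ *ᵥ fun i => κ p (x i)) i * g (x i) =
        condMean κ η (fun i : S => x i) (fun i => g (x i)) p := by
      rw [condMean, regGram_inv_symm hκ hη, dotProduct_comm]
      rfl
    rw [e1, postMean_eq, postMean_eq, condMean, condMean, condMean, ← dotProduct_add,
      ← Matrix.mulVec_add]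
    congr 2
    ext i
    simp
  have h5 : B * √(κ p p - 2 * ((fun i : S => κ p (x i)) ⬝ᵥ ((regGram κ η fun i : S => x i)⁻¹ *ᵥ
      fun i => κ p (x i))) + ((regGram κ η fun i : S => x i)⁻¹ *ᵥ fun i => κ p (x i)) ⬝ᵥ
        (gram κ (fun i : S => x i) *ᵥ ((regGram κ η fun i : S => x i)⁻¹ *ᵥ
          fun i => κ p (x i)))) ≤ B * postStd κ η S x p := by
    rw [postStd_eq]
    gcongr
  rw [h4, ← sub_sub, add_mul]
  exact (abs_sub _ _).trans (add_le_add (h2.trans h5) h1)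

end RKHS

/-! ### Both kinds of feedback as centred noise in a known interval. -/

section Noise

variable {d : ℕ} {κ : Pt d → Pt d → ℝ} {η B : ℝ} {X : Set (Pt d)}

/-- Nothing is known about the function outside `X`, so the composition is factored through the
subtype. -/
lemma measurable_comp_of_continuousOn {Ω : Type*} {m : MeasurableSpace Ω} {g : Pt d → ℝ}
    (hg : ContinuousOn g X) {x : Ω → Pt d} (hx : Measurable[m] x) (hxX : ∀ ω, x ω ∈ X) :
    Measurable[m] fun ω => g (x ω) :=
  (continuousOn_iff_continuous_domRestrict.1 hg).measurable.comp (hx.subtype_mk (h := hxX))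

variable {Ω : Type*} {mΩ : MeasurableSpace Ω} {P : Measure Ω} [IsProbabilityMeasure P]
  {ℱ : Filtration ℕ mΩ} {f : Pt d → ℝ} {pref : Pt d → Pt d → ℝ} {ν : Measure (Pt d)}
  {x x' : ℕ → Ω → Pt d} {q : ℕ → Ω → Query} {y : ℕ → Ω → ℝ}

lemma setOf_query_label (t : ℕ) : {ω | q t ω = .label} = {ω | q t ω = .comp}ᶜ := by
  ext ω
  simp only [Set.mem_ofPred_eq, Set.mem_compl_iff]
  cases q t ω <;> simp

lemma IsFeedback.isNoise_label (h : IsFeedback P ℱ η f pref ν x x' q y) (hη : 0 < η)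
    (hf : ContinuousOn f X) (hx : ∀ t ω, x t ω ∈ X) :
    IsNoise P ℱ .label (2 * η) x q (fun t ω => y t ω - f (x t ω)) (fun _ _ => -η) where
  point_meas := h.point_meas
  query_meas t := by rw [setOf_query_label]; exact (h.query_meas t).compl
  noise_meas t := (h.feedback_meas t).sub
    ((measurable_comp_of_continuousOn hf (h.point_meas t) (hx t)).mono
      (ℱ.mono (Nat.le_succ t)) le_rfl)
  lo_meas t := measurable_const
  lo_nonpos t ω := by linarith
  hi_nonneg t ω := by linarith
  bound t := by
    filter_upwards [h.label_bound t] with ω hω hq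
    have := abs_le.1 (hω hq)
    constructor <;> linarith
  mean t := by
    have hQ : MeasurableSet[ℱ t] {ω | q t ω = .label} := by
      rw [setOf_query_label]; exact (h.query_meas t).compl
    have hm : Measurable fun ω => y t ω - f (x t ω) :=
      ((h.feedback_meas t).mono (ℱ.le _) le_rfl).sub
        ((measurable_comp_of_continuousOn hf (h.point_meas t) (hx t)).mono (ℱ.le _) le_rfl)
    have hi : Integrable (Set.indicator {ω | q t ω = .label} fun ω => y t ω - f (x t ω)) P := by
      refine Integrable.of_bound (hm.indicator (ℱ.le _ _ hQ)).aestronglyMeasurable η ?_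
      filter_upwards [h.label_bound t] with ω hω
      by_cases hq : q t ω = .label
      · rw [Set.indicator_of_mem (show ω ∈ {ω | q t ω = .label} from hq)]
        exact hω hq
      · rw [Set.indicator_of_notMem (show ω ∉ {ω | q t ω = .label} from hq), norm_zero]
        exact hη.le
    -- The mean-zero hypothesis speaks only of the event that the query is direct; off this event
    -- the conditional expectation of the indicator vanishes.
    have h1 := condExp_indicator (m := ℱ t) hi hQ
    rw [Set.indicator_indicator, Set.inter_self] at h1
    filter_upwards [h1, h.label_mean t] with ω h1 h2
    rw [h1]
    by_cases hq : q t ω = .label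
    · rw [Set.indicator_of_mem (show ω ∈ {ω | q t ω = .label} from hq)]
      exact h2 hq
    · rw [Set.indicator_of_notMem (show ω ∉ {ω | q t ω = .label} from hq)]
      rfl

lemma integrable_pref [IsProbabilityMeasure ν] (hν : ν Xᶜ = 0)
    (hpm : Measurable (Function.uncurry pref))
    (hp : ∀ x ∈ X, ∀ u ∈ X, 0 ≤ pref x u ∧ pref x u ≤ 1) {p : Pt d} (hpX : p ∈ X) :
    Integrable (pref p) ν := by
  refine Integrable.of_bound (hpm.comp measurable_prodMk_left).aestronglyMeasurable 1 ?_
  have : ∀ᵐ u ∂ν, u ∈ X := hν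
  filter_upwards [this] with u hu
  rw [Real.norm_eq_abs, abs_of_nonneg (hp p hpX u hu).1]
  exact (hp p hpX u hu).2

lemma borda_mem_Icc [IsProbabilityMeasure ν] (hν : ν Xᶜ = 0)
    (hpm : Measurable (Function.uncurry pref))
    (hp : ∀ x ∈ X, ∀ u ∈ X, 0 ≤ pref x u ∧ pref x u ≤ 1) {p : Pt d} (hpX : p ∈ X) :
    0 ≤ borda pref ν p ∧ borda pref ν p ≤ 1 := by
  have hX : ∀ᵐ u ∂ν, u ∈ X := hν
  constructor
  · refine integral_nonneg_of_ae ?_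
    filter_upwards [hX] with u hu using (hp p hpX u hu).1
  · calc borda pref ν p ≤ ∫ _, (1 : ℝ) ∂ν := by
          refine integral_mono_ae (integrable_pref hν hpm hp hpX) (integrable_const _) ?_
          filter_upwards [hX] with u hu using (hp p hpX u hu).2
      _ = 1 := by simp

/-- With the opponent averaged out, the result is a Bernoulli variable whose parameter is the Borda
value. The noise lies in `[-b, 1 - b]`, an interval of length 1 that is known once the point is,
whereas the symmetric interval `[-1, 1]` would need twice the length. -/
lemma IsFeedback.isNoise_comp [IsProbabilityMeasure ν] (h : IsFeedback P ℱ η f pref ν x x' q y)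
    (hν : ν Xᶜ = 0) (hpm : Measurable (Function.uncurry pref))
    (hp : ∀ x ∈ X, ∀ u ∈ X, 0 ≤ pref x u ∧ pref x u ≤ 1)
    (hg : ContinuousOn (borda pref ν) X) (hx : ∀ t ω, x t ω ∈ X) :
    IsNoise P ℱ .comp 1 x q (fun t ω => y t ω - borda pref ν (x t ω))
      (fun t ω => -borda pref ν (x t ω)) := by
  have hbm : ∀ t, Measurable[ℱ t] fun ω => borda pref ν (x t ω) := fun t =>
    measurable_comp_of_continuousOn hg (h.point_meas t) (hx t)
  have hb01 := fun t ω => borda_mem_Icc hν hpm hp (hx t ω)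
  set I : ℝ → ℕ → Ω → ℝ := fun v t => Set.indicator {ω | x' t ω ∈ Set.univ ∧ y t ω = v}
    (fun _ => (1 : ℝ)) with hI
  have hIm : ∀ v t, Measurable (I v t) := fun v t => by
    refine measurable_const.indicator ?_
    have : {ω | x' t ω ∈ Set.univ ∧ y t ω = v} = y t ⁻¹' {v} := by ext; simp
    rw [this]
    exact ((h.feedback_meas t).mono (ℱ.le _) le_rfl) (measurableSet_singleton v)
  have hIi : ∀ v t, Integrable (I v t) P := fun v t =>
    Integrable.of_bound (hIm v t).aestronglyMeasurable 1
      (ae_of_all _ fun ω => by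
        refine (norm_indicator_le_norm_self _ _).trans ?_
        simp)
  -- Taking every opponent as admissible integrates the preference to the Borda value.
  have hwin : ∀ t, ∀ᵐ ω ∂P, q t ω = .comp → (P[I 1 t | ℱ t]) ω = borda pref ν (x t ω) := by
    intro t
    filter_upwards [h.comp_win t Set.univ MeasurableSet.univ] with ω hω hq
    rw [hω hq, Measure.restrict_univ, borda]
  have hlose : ∀ t, ∀ᵐ ω ∂P, q t ω = .comp →
      (P[I 0 t | ℱ t]) ω = 1 - borda pref ν (x t ω) := by
    intro t
    filter_upwards [h.comp_lose t Set.univ MeasurableSet.univ] with ω hω hq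
    rw [hω hq, Measure.restrict_univ, integral_sub (integrable_const _)
      (integrable_pref hν hpm hp (hx t ω)), borda]
    simp
  have hsum : ∀ t ω, I 1 t ω + I 0 t ω ≤ 1 := by
    intro t ω
    simp only [hI, Set.indicator, Set.mem_ofPred_eq, Set.mem_univ, true_and]
    by_cases h1 : y t ω = 1 <;> by_cases h0 : y t ω = 0 <;> simp [h1, h0]
  -- That a comparison returns only 0 or 1 follows from the conditional probabilities: those of 1
  -- and 0 sum to one, so the nonnegative defect has integral zero.
  have hval : ∀ t, ∀ᵐ ω ∂P, q t ω = .comp → I 1 t ω + I 0 t ω = 1 := by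
    intro t
    have hQ := h.query_meas t
    have hi0 : Integrable (fun ω => 1 - (I 1 t ω + I 0 t ω)) P :=
      (integrable_const _).sub ((hIi 1 t).add (hIi 0 t))
    have hce : P[fun ω => 1 - (I 1 t ω + I 0 t ω) | ℱ t] =ᵐ[P]
        fun ω => 1 - ((P[I 1 t | ℱ t]) ω + (P[I 0 t | ℱ t]) ω) := by
      have h1 := condExp_sub (integrable_const (1 : ℝ)) ((hIi 1 t).add (hIi 0 t)) (ℱ t)
      have h2 := condExp_add (hIi 1 t) (hIi 0 t) (ℱ t)
      rw [condExp_const (ℱ.le t)] at h1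
      filter_upwards [h1, h2] with ω h1 h2
      rw [Pi.sub_apply, h2] at h1
      exact h1
    have hint : ∫ ω, Set.indicator {ω | q t ω = .comp} (fun ω => 1 - (I 1 t ω + I 0 t ω)) ω ∂P
        = 0 := by
      rw [← integral_condExp (ℱ.le t)]
      refine integral_eq_zero_of_ae ?_
      filter_upwards [condExp_indicator hi0 hQ, hce, hwin t, hlose t] with ω h1 h2 h3 h4
      rw [h1]
      by_cases hq : q t ω = .comp
      · rw [Set.indicator_of_mem (show ω ∈ {ω | q t ω = .comp} from hq), h2, h3 hq, h4 hq]
        simp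
      · rw [Set.indicator_of_notMem (show ω ∉ {ω | q t ω = .comp} from hq)]
        rfl
    have h0 := (integral_eq_zero_iff_of_nonneg (fun ω => Set.indicator_nonneg
      (fun ω _ => sub_nonneg.2 (hsum t ω)) ω) (hi0.indicator (ℱ.le _ _ hQ))).1 hint
    filter_upwards [h0] with ω hω hq
    rw [Set.indicator_of_mem (show ω ∈ {ω | q t ω = .comp} from hq)] at hω
    have : (0 : Ω → ℝ) ω = 0 := rfl
    linarith
  have hy : ∀ t, ∀ᵐ ω ∂P, q t ω = .comp → (y t ω = 1 ∨ y t ω = 0) ∧ y t ω = I 1 t ω := by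
    intro t
    filter_upwards [hval t] with ω hω hq
    have := hω hq
    simp only [hI, Set.indicator, Set.mem_ofPred_eq, Set.mem_univ, true_and] at this ⊢
    by_cases h1 : y t ω = 1
    · simp [h1]
    · by_cases h0 : y t ω = 0
      · simp [h0]
      · simp [h1, h0] at this
  refine ⟨h.point_meas, h.query_meas, fun t => (h.feedback_meas t).sub ((hbm t).mono
    (ℱ.mono (Nat.le_succ t)) le_rfl), fun t => (hbm t).neg, fun t ω => by linarith [hb01 t ω],
    fun t ω => by linarith [hb01 t ω], fun t => ?_, fun t => ?_⟩
  · filter_upwards [hy t] with ω hω hq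
    rcases (hω hq).1 with h1 | h1 <;> rw [h1] <;> constructor <;> linarith [hb01 t ω]
  · have hbi : Integrable (fun ω => borda pref ν (x t ω)) P :=
      Integrable.of_bound ((hbm t).mono (ℱ.le _) le_rfl).aestronglyMeasurable 1
        (ae_of_all _ fun ω => by
          rw [Real.norm_eq_abs, abs_of_nonneg (hb01 t ω).1]; exact (hb01 t ω).2)
    have h1 : Set.indicator {ω | q t ω = .comp} (fun ω => y t ω - borda pref ν (x t ω)) =ᵐ[P]
        Set.indicator {ω | q t ω = .comp} (I 1 t - fun ω => borda pref ν (x t ω)) := by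
      filter_upwards [hy t] with ω hω
      by_cases hq : q t ω = .comp
      · rw [Set.indicator_of_mem (show ω ∈ {ω | q t ω = .comp} from hq),
          Set.indicator_of_mem (show ω ∈ {ω | q t ω = .comp} from hq), Pi.sub_apply, ← (hω hq).2]
      · rw [Set.indicator_of_notMem (show ω ∉ {ω | q t ω = .comp} from hq),
          Set.indicator_of_notMem (show ω ∉ {ω | q t ω = .comp} from hq)]
    have h2 := condExp_indicator (m := ℱ t) ((hIi 1 t).sub hbi) (h.query_meas t)
    have h3 := condExp_sub (hIi 1 t) hbi (ℱ t)
    have h4 : P[fun ω => borda pref ν (x t ω) | ℱ t] = fun ω => borda pref ν (x t ω) :=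
      condExp_of_stronglyMeasurable (ℱ.le t) (hbm t).stronglyMeasurable hbi
    rw [h4] at h3
    filter_upwards [condExp_congr_ae (m := ℱ t) h1, h2, h3, hwin t] with ω h1 h2 h3 h5
    rw [h1, h2]
    by_cases hq : q t ω = .comp
    · rw [Set.indicator_of_mem (show ω ∈ {ω | q t ω = .comp} from hq), h3, Pi.sub_apply, h5 hq]
      simp
    · rw [Set.indicator_of_notMem (show ω ∉ {ω | q t ω = .comp} from hq)]
      rfl

end Noise

/-! ### Log-determinants of matrices that are nearly of low rank. -/

section LogDet

open scoped MatrixOrder Matrix.Norms.L2Operator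

variable {ι : Type*} [Fintype ι] [DecidableEq ι]

lemma det_one_add_eq_prod {C : Matrix ι ι ℝ} (hC : C.IsHermitian) :
    (1 + C).det = ∏ i, (1 + hC.eigenvalues i) := by
  have h1 : C.charpoly.eval (-1) = ∏ i, (-1 - hC.eigenvalues i) := by
    rw [hC.charpoly_eq, Polynomial.eval_prod]
    simp
  rw [Matrix.eval_charpoly] at h1
  have h2 : Matrix.scalar ι (-1 : ℝ) - C = -(1 + C) := by
    rw [map_neg, map_one]; abel
  have h3 : ∏ i, (-1 - hC.eigenvalues i) =
      (-1) ^ Fintype.card ι * ∏ i, (1 + hC.eigenvalues i) := by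
    rw [← Finset.card_univ, ← Finset.prod_const, ← Finset.prod_mul_distrib]
    exact Finset.prod_congr rfl fun i _ => by ring
  rw [h2, Matrix.det_neg, h3] at h1
  exact mul_left_cancel₀ (pow_ne_zero _ (by norm_num)) h1

lemma one_le_det_one_add {C : Matrix ι ι ℝ} (hC : C.PosSemidef) : 1 ≤ (1 + C).det := by
  rw [det_one_add_eq_prod hC.isHermitian]
  refine Finset.one_le_prod fun i _ => ?_
  linarith [hC.eigenvalues_nonneg i]

lemma log_det_one_add_le_trace {C : Matrix ι ι ℝ} (hC : C.PosSemidef) :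
    Real.log (1 + C).det ≤ C.trace := by
  have h0 := fun i => hC.eigenvalues_nonneg i
  rw [det_one_add_eq_prod hC.isHermitian, Real.log_prod fun i _ => by linarith [h0 i],
    hC.isHermitian.trace_eq_sum_eigenvalues]
  refine Finset.sum_le_sum fun i _ => ?_
  have := Real.log_le_sub_one_of_pos (show 0 < 1 + hC.isHermitian.eigenvalues i by linarith [h0 i])
  simpa using this

/-- Only nonzero eigenvalues contribute, and none exceeds the trace. -/
lemma log_det_one_add_le_rank {C : Matrix ι ι ℝ} (hC : C.PosSemidef) :
    Real.log (1 + C).det ≤ C.rank * Real.log (1 + C.trace) := by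
  have h0 := fun i => hC.eigenvalues_nonneg i
  have htr : C.trace = ∑ i, hC.isHermitian.eigenvalues i := by
    simpa using hC.isHermitian.trace_eq_sum_eigenvalues
  have hle : ∀ i, hC.isHermitian.eigenvalues i ≤ C.trace := fun i => by
    rw [htr]
    exact Finset.single_le_sum (f := fun i => hC.isHermitian.eigenvalues i)
      (fun j _ => h0 j) (Finset.mem_univ i)
  rw [det_one_add_eq_prod hC.isHermitian, Real.log_prod fun i _ => by linarith [h0 i],
    hC.isHermitian.rank_eq_card_non_zero_eigs, Fintype.card_subtype]
  calc ∑ i, Real.log (1 + hC.isHermitian.eigenvalues i)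
      = ∑ i with hC.isHermitian.eigenvalues i ≠ 0,
          Real.log (1 + hC.isHermitian.eigenvalues i) := by
        rw [Finset.sum_filter]
        refine Finset.sum_congr rfl fun i _ => ?_
        split_ifs with h
        · rfl
        · push Not at h
          rw [h, add_zero, Real.log_one]
    _ ≤ ∑ i with hC.isHermitian.eigenvalues i ≠ 0, Real.log (1 + C.trace) := by
        refine Finset.sum_le_sum fun i _ => Real.log_le_log (by linarith [h0 i]) ?_
        linarith [hle i]
    _ = _ := by rw [Finset.sum_const, nsmul_eq_mul]

lemma trace_nonneg_of_posSemidef {C : Matrix ι ι ℝ} (hC : C.PosSemidef) : 0 ≤ C.trace :=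
  Finset.sum_nonneg fun _ _ => hC.diag_nonneg

/-- `det (A + Dᵀ D) = det A · det (I + D A⁻¹ Dᵀ)`. -/
lemma det_add_transpose_mul {A : Matrix ι ι ℝ} (hA : A.PosDef) (D : Matrix ι ι ℝ) :
    (A + Dᵀ * D).det = A.det * (1 + D * A⁻¹ * Dᵀ).det := by
  have h1 : A + Dᵀ * D = A * (1 + (A⁻¹ * Dᵀ) * D) := by
    rw [mul_add, mul_one, ← mul_assoc, ← mul_assoc,
      Matrix.mul_nonsing_inv _ hA.det_pos.ne'.isUnit, one_mul]
  rw [h1, Matrix.det_mul, Matrix.det_one_add_mul_comm, mul_assoc D]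

lemma exists_transpose_mul_self {B : Matrix ι ι ℝ} (hB : B.PosSemidef) :
    ∃ D : Matrix ι ι ℝ, B = Dᵀ * D := by
  obtain ⟨D, hD⟩ := CStarAlgebra.nonneg_iff_eq_star_mul_self.1 hB.nonneg
  exact ⟨D, by rw [hD, Matrix.star_eq_conjTranspose, Matrix.conjTranspose_eq_transpose_of_trivial]⟩

lemma posSemidef_conj_inv {A : Matrix ι ι ℝ} (hA : A.PosDef) (D : Matrix ι ι ℝ) :
    (D * A⁻¹ * Dᵀ).PosSemidef := by
  simpa using hA.inv.posSemidef.mul_mul_conjTranspose_same D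

lemma det_le_det_add {A B : Matrix ι ι ℝ} (hA : A.PosDef) (hB : B.PosSemidef) :
    A.det ≤ (A + B).det := by
  obtain ⟨D, rfl⟩ := exists_transpose_mul_self hB
  rw [det_add_transpose_mul hA]
  exact le_mul_of_one_le_right hA.det_pos.le (one_le_det_one_add (posSemidef_conj_inv hA D))

/-- The difference is `(1 + K)⁻¹ (K + K²) (1 + K)⁻¹`. -/
lemma posSemidef_one_sub_inv {K : Matrix ι ι ℝ} (hK : K.PosSemidef) :
    (1 - (1 + K)⁻¹).PosSemidef := by
  have hA : (1 + K).PosDef := Matrix.PosDef.one.add_posSemidef hK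
  have hu := hA.det_pos.ne'.isUnit
  have h1 : 1 - (1 + K)⁻¹ = (1 + K)⁻¹ * (K + Kᵀ * K) * ((1 + K)⁻¹)ᵀ := by
    have hs : ((1 + K)⁻¹)ᵀ = (1 + K)⁻¹ := by simpa using hA.inv.isHermitian.eq
    have hKs : Kᵀ = K := by simpa using hK.isHermitian.eq
    rw [hs, hKs]
    have h2 : K + K * K = K * (1 + K) := by rw [mul_add, mul_one]
    rw [h2, ← mul_assoc, mul_assoc, Matrix.mul_nonsing_inv _ hu, mul_one]
    have h3 : (1 + K)⁻¹ * (1 + K) = 1 := Matrix.nonsing_inv_mul _ hu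
    rw [mul_add, mul_one] at h3
    exact sub_eq_iff_eq_add'.2 h3.symm
  rw [h1]
  have h4 : (K + Kᵀ * K).PosSemidef := by
    refine hK.add ?_
    simpa using Matrix.posSemidef_conjTranspose_mul_self K
  simpa using h4.mul_mul_conjTranspose_same (1 + K)⁻¹

/-- With `L = DᵀD`, the extra factor is `det(1 + D(1 + K)⁻¹Dᵀ)`. Its logarithm is at most the trace
of `D(1 + K)⁻¹Dᵀ`, which is at most that of `DDᵀ` as `(1 + K)⁻¹ ≤ 1`. -/
lemma log_det_one_add_add_le {K L : Matrix ι ι ℝ} (hK : K.PosSemidef) (hL : L.PosSemidef) :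
    Real.log (1 + K + L).det ≤ Real.log (1 + K).det + L.trace := by
  have hA : (1 + K).PosDef := Matrix.PosDef.one.add_posSemidef hK
  obtain ⟨D, rfl⟩ := exists_transpose_mul_self hL
  have hC := posSemidef_conj_inv hA D
  rw [det_add_transpose_mul hA, Real.log_mul hA.det_pos.ne'
    (by linarith [one_le_det_one_add hC] : (0 : ℝ) < _).ne']
  have h1 : 0 ≤ (D * (1 - (1 + K)⁻¹) * Dᵀ).trace := trace_nonneg_of_posSemidef
    (by simpa using (posSemidef_one_sub_inv hK).mul_mul_conjTranspose_same D)
  rw [mul_sub, mul_one, sub_mul, Matrix.trace_sub, Matrix.trace_mul_comm D Dᵀ] at h1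
  linarith [log_det_one_add_le_trace hC]

variable {V : Type*} [NormedAddCommGroup V] [InnerProductSpace ℝ V]

/-- The Gram matrix factors through the coefficient matrix `M`. -/
lemma rank_gram_le {J : Type*} [Fintype J] (p : ι → V) (g : J → V) (M : Matrix ι J ℝ)
    (h : ∀ i, p i = ∑ a, M i a • g a) : (Matrix.gram ℝ p).rank ≤ Fintype.card J := by
  have h1 : Matrix.gram ℝ p = M * (Matrix.gram ℝ g * Mᵀ) := by
    ext i j
    rw [Matrix.gram_apply, h i, h j, sum_inner, Matrix.mul_apply]
    refine Finset.sum_congr rfl fun a _ => ?_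
    rw [inner_smul_left, inner_sum, Matrix.mul_apply]
    simp [inner_smul_right, mul_comm]
  rw [h1]
  exact (Matrix.rank_mul_le_left _ _).trans (Matrix.rank_le_card_width M)

/-- Information gain of points whose features in a Hilbert space are `τ`-close to the span of a
finite family. -/
lemma gain_le_of_features {d : ℕ} {κ : Pt d → Pt d → ℝ} {η : ℝ} (hη : 0 < η) (x : ι → Pt d)
    (u ρ : ι → V) {J : Type*} [Fintype J] (g : J → V) (M : Matrix ι J ℝ) {b τ : ℝ}
    (hK : ∀ i j, κ (x i) (x j) = inner ℝ (u i) (u j)) (hp : ∀ i, u i - ρ i = ∑ a, M i a • g a)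
    (hu : ∀ i, ‖u i‖ ^ 2 ≤ b) (hρ : ∀ i, ‖ρ i‖ ^ 2 ≤ τ) :
    gain κ η x ≤ 1 / 2 * (Fintype.card J *
      Real.log (1 + Fintype.card ι * ((4 * b + 4 * τ) / η ^ 2)) +
        Fintype.card ι * (2 * τ / η ^ 2)) := by
  set p : ι → V := fun i => u i - ρ i with hpdef
  have hη2 : 0 < η ^ 2 := by positivity
  set G := gram κ x with hG
  have hGu : G = Matrix.gram ℝ u := by ext i j; exact hK i j
  have hGpsd : G.PosSemidef := hGu ▸ Matrix.posSemidef_gram ℝ u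
  -- Parallelogram law for Gram matrices with `u = p + ρ`. Dropping the Gram matrix of `p - ρ`
  -- bounds the kernel matrix by a low-rank part and a small part, without cross terms.
  have hdec : G + Matrix.gram ℝ (fun i => p i - ρ i) =
      (2 : ℝ) • Matrix.gram ℝ p + (2 : ℝ) • Matrix.gram ℝ ρ := by
    ext i j
    simp only [hGu, Matrix.add_apply, Matrix.smul_apply, Matrix.gram_apply, hpdef, inner_sub_left,
      inner_sub_right, smul_eq_mul]
    ring
  set K1 : Matrix ι ι ℝ := (2 / η ^ 2) • Matrix.gram ℝ p with hK1
  set K2 : Matrix ι ι ℝ := (2 / η ^ 2) • Matrix.gram ℝ ρ with hK2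
  have h1 : K1.PosSemidef := (Matrix.posSemidef_gram ℝ p).smul (by positivity)
  have h2 : K2.PosSemidef := (Matrix.posSemidef_gram ℝ ρ).smul (by positivity)
  have hreg : regGram κ η x = η ^ 2 • (1 + (1 / η ^ 2) • G) := by
    rw [regGram, smul_add, smul_smul, mul_one_div_cancel hη2.ne', one_smul, add_comm]
  have hpos : (1 + (1 / η ^ 2) • G).PosDef :=
    Matrix.PosDef.one.add_posSemidef (hGpsd.smul (by positivity))
  have hgain : gain κ η x = 1 / 2 * Real.log (1 + (1 / η ^ 2) • G).det := by
    rw [gain, hreg, Matrix.det_smul, Real.log_mul (by positivity) hpos.det_pos.ne', Real.log_pow]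
    ring
  have hsum : 1 + K1 + K2 = (1 + (1 / η ^ 2) • G) +
      (1 / η ^ 2) • Matrix.gram ℝ (fun i => p i - ρ i) := by
    rw [add_assoc, add_assoc, ← smul_add, ← smul_add, hdec, ← smul_add, smul_smul]
    congr 2
    ring
  have hdet : (1 + (1 / η ^ 2) • G).det ≤ (1 + K1 + K2).det := by
    rw [hsum]
    exact det_le_det_add hpos ((Matrix.posSemidef_gram ℝ _).smul (by positivity))
  have hpn : ∀ i, ‖p i‖ ^ 2 ≤ 2 * b + 2 * τ := by
    intro i
    have := parallelogram_law_with_norm ℝ (u i) (ρ i)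
    nlinarith [hu i, hρ i, sq_nonneg ‖u i + ρ i‖]
  have htr : ∀ (w : ι → V) (c : ℝ), (∀ i, ‖w i‖ ^ 2 ≤ c) →
      ((2 / η ^ 2) • Matrix.gram ℝ w).trace ≤ Fintype.card ι * (2 * c / η ^ 2) := by
    intro w c hw
    rw [Matrix.trace_smul, Matrix.trace]
    simp only [Matrix.diag_apply, Matrix.gram_apply, real_inner_self_eq_norm_sq]
    calc (2 / η ^ 2) • ∑ i, ‖w i‖ ^ 2 ≤ (2 / η ^ 2) • ∑ _i : ι, c := by
          rw [smul_eq_mul, smul_eq_mul]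
          gcongr with i
          exact hw i
      _ = _ := by rw [Finset.sum_const, Finset.card_univ, nsmul_eq_mul, smul_eq_mul]; ring
  have hrank : (K1.rank : ℝ) ≤ Fintype.card J := by
    have : K1.rank ≤ (Matrix.gram ℝ p).rank := by
      have h : K1 = ((2 / η ^ 2) • (1 : Matrix ι ι ℝ)) * Matrix.gram ℝ p := by
        rw [smul_mul_assoc, one_mul]
      rw [h]
      exact Matrix.rank_mul_le_right _ _
    exact_mod_cast this.trans (rank_gram_le p g M hp)
  have hK1tr : K1.trace ≤ Fintype.card ι * ((4 * b + 4 * τ) / η ^ 2) := by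
    refine (htr p _ hpn).trans_eq ?_
    ring
  have h1tr := trace_nonneg_of_posSemidef h1
  rw [hgain]
  refine mul_le_mul_of_nonneg_left ?_ (by norm_num)
  calc Real.log (1 + (1 / η ^ 2) • G).det ≤ Real.log (1 + K1 + K2).det :=
        Real.log_le_log hpos.det_pos hdet
    _ ≤ Real.log (1 + K1).det + K2.trace := log_det_one_add_add_le h1 h2
    _ ≤ K1.rank * Real.log (1 + K1.trace) + K2.trace := by
        gcongr
        exact log_det_one_add_le_rank h1
    _ ≤ _ := by
        refine add_le_add ?_ (htr ρ τ hρ)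
        refine mul_le_mul hrank ?_ (Real.log_nonneg (by linarith)) (by positivity)
        exact Real.log_le_log (by linarith) (by linarith)

end LogDet

/-! ### Local Taylor features for kernels with a spectral measure. -/

section SpectralFeatures

/-- Taylor remainder of `exp (i θ)` of fractional order. -/
lemma norm_exp_sub_taylor_le {s : ℝ} (hs : 0 < s) (θ : ℝ) :
    ‖Complex.exp (θ * Complex.I) -
      ∑ k ∈ Finset.range ⌈s⌉₊, (θ * Complex.I) ^ k / (k.factorial : ℂ)‖ ≤
      (⌈s⌉₊ + 2) * |θ| ^ s := by
  have hm : 0 < ⌈s⌉₊ := Nat.ceil_pos.2 hs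
  have hn : ‖(θ : ℂ) * Complex.I‖ = |θ| := by simp
  -- For `|θ| ≤ 1` the Taylor remainder of order `⌈s⌉ ≥ s` is used; for `|θ| > 1` every term has
  -- degree below `s` and is at most `|θ|^s`. A real exponent is kept because a Matérn spectral
  -- measure has only limited moments.
  rcases le_or_gt |θ| 1 with h | h
  · refine (Complex.exp_bound (by rwa [hn]) hm).trans ?_
    rw [hn, mul_comm]
    have h1 : |θ| ^ ⌈s⌉₊ ≤ |θ| ^ s := by
      rcases (abs_nonneg θ).eq_or_lt with h0 | h0
      · rw [← h0, zero_pow hm.ne', Real.zero_rpow hs.ne']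
      · rw [← Real.rpow_natCast]
        exact Real.rpow_le_rpow_of_exponent_ge h0 h (Nat.le_ceil s)
    have h2 : ((⌈s⌉₊.succ : ℝ) * ((⌈s⌉₊.factorial : ℝ) * ⌈s⌉₊)⁻¹) ≤ ⌈s⌉₊ + 2 := by
      have h3 : (1 : ℝ) ≤ (⌈s⌉₊.factorial : ℝ) * ⌈s⌉₊ := by
        exact_mod_cast Nat.mul_pos (Nat.factorial_pos _) hm
      calc (⌈s⌉₊.succ : ℝ) * ((⌈s⌉₊.factorial : ℝ) * ⌈s⌉₊)⁻¹ ≤ ⌈s⌉₊.succ * 1 := by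
            gcongr; exact inv_le_one_of_one_le₀ h3
        _ ≤ _ := by push_cast; linarith
    gcongr
  · have h1 : ‖Complex.exp (θ * Complex.I)‖ ≤ |θ| ^ s := by
      rw [Complex.norm_exp_ofReal_mul_I]
      exact Real.one_le_rpow h.le hs.le
    have h2 : ∀ k ∈ Finset.range ⌈s⌉₊, ‖(θ * Complex.I) ^ k / (k.factorial : ℂ)‖ ≤ |θ| ^ s := by
      intro k hk
      have hk' : (k : ℝ) ≤ s := by
        have h3 : k + 1 ≤ ⌈s⌉₊ := Finset.mem_range.1 hk
        have h4 : ((k + 1 : ℕ) : ℝ) ≤ ⌈s⌉₊ := by exact_mod_cast h3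
        have h5 := Nat.ceil_lt_add_one hs.le
        push_cast at h4
        linarith
      rw [norm_div, norm_pow, hn, Complex.norm_natCast]
      calc |θ| ^ k / (k.factorial : ℝ) ≤ |θ| ^ k :=
            div_le_self (by positivity) (by exact_mod_cast Nat.factorial_pos k)
        _ = |θ| ^ (k : ℝ) := (Real.rpow_natCast _ _).symm
        _ ≤ |θ| ^ s := Real.rpow_le_rpow_of_exponent_le h.le hk'
    calc _ ≤ ‖Complex.exp (θ * Complex.I)‖ +
          ‖∑ k ∈ Finset.range ⌈s⌉₊, (θ * Complex.I) ^ k / (k.factorial : ℂ)‖ := norm_sub_le _ _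
      _ ≤ |θ| ^ s + ∑ k ∈ Finset.range ⌈s⌉₊, |θ| ^ s :=
          add_le_add h1 ((norm_sum_le _ _).trans (Finset.sum_le_sum h2))
      _ = (⌈s⌉₊ + 1) * |θ| ^ s := by simp; ring
      _ ≤ _ := by
          have : 0 ≤ |θ| ^ s := by positivity
          nlinarith

/-- Index in `{0, …, N}^d` of the cell of side `r / N` that contains `x`. -/
noncomputable def cellIndex {d : ℕ} (r : ℝ) (N : ℕ) (x : Pt d) (k : Fin d) : Fin (N + 1) :=
  Fin.ofNat (N + 1) ⌊x k * N / r⌋₊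

/-- Corner of a cell. -/
noncomputable def corner {d : ℕ} (r : ℝ) (N : ℕ) (j : Fin d → Fin (N + 1)) : Pt d :=
  WithLp.toLp 2 fun k => (j k : ℕ) * (r / N)

lemma norm_sub_corner_le {d : ℕ} {r : ℝ} (hr : 0 ≤ r) {N : ℕ} (hN : 1 ≤ N) {x : Pt d}
    (hx : x ∈ box d r) : ‖x - corner r N (cellIndex r N x)‖ ≤ √d * (r / N) := by
  have hN0 : (0 : ℝ) < N := by exact_mod_cast hN
  have hcoord : ∀ k, |(x - corner r N (cellIndex r N x)) k| ≤ r / N := by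
    intro k
    have hxk := hx k
    have hle : ⌊x k * N / r⌋₊ ≤ N := by
      rw [← Nat.floor_natCast (R := ℝ) N]
      refine Nat.floor_mono ?_
      rw [Nat.floor_natCast]
      rcases hr.eq_or_lt with rfl | hr
      · simp
      · rw [div_le_iff₀ hr, mul_comm]
        gcongr
        exact hxk.2
    -- The index is a residue modulo `N + 1`; nothing wraps, since the floor is at most `N`, with
    -- `N` attained on the upper faces.
    have hval : ((cellIndex r N x k : ℕ)) = ⌊x k * N / r⌋₊ := by
      rw [cellIndex, Fin.val_ofNat, Nat.mod_eq_of_lt (by omega)]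
    have h1 : (x - corner r N (cellIndex r N x)) k = x k - ⌊x k * N / r⌋₊ * (r / N) := by
      simp [corner, hval]
    rw [h1]
    rcases hr.eq_or_lt with rfl | hr
    · have : x k = 0 := le_antisymm hxk.2 hxk.1
      simp [this]
    · have h2 := Nat.floor_le (show 0 ≤ x k * N / r from
        div_nonneg (mul_nonneg hxk.1 hN0.le) hr.le)
      have h3 := Nat.lt_floor_add_one (x k * N / r)
      have h4 : x k = x k * N / r * (r / N) := by field_simp
      have h5 : 0 < r / N := by positivity
      rw [abs_le]
      constructor <;> nlinarith
  rw [EuclideanSpace.norm_eq]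
  refine Real.sqrt_le_iff.2 ⟨by positivity, ?_⟩
  rw [mul_pow, Real.sq_sqrt (Nat.cast_nonneg d)]
  calc ∑ k, ‖(x - corner r N (cellIndex r N x)) k‖ ^ 2 ≤ ∑ _k : Fin d, (r / N) ^ 2 := by
        refine Finset.sum_le_sum fun k _ => ?_
        rw [Real.norm_eq_abs]
        exact pow_le_pow_left₀ (abs_nonneg _) (hcoord k) 2
    _ = d * (r / N) ^ 2 := by simp

/-- Indices of the Taylor features: a cell, a degree and a list of coordinates. -/
abbrev FeatureIndex (d N m : ℕ) : Type :=
  (Fin d → Fin (N + 1)) × (Σ k : Fin m, (Fin k → Fin d))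

/-- The Taylor feature `exp (i ⟨w, c⟩) i^k / k! ∏ w_{f l}`. -/
noncomputable def taylorFeature {d : ℕ} (r : ℝ) (N m : ℕ) (a : FeatureIndex d N m) (w : Pt d) : ℂ :=
  Complex.exp ((inner ℝ w (corner r N a.1) : ℝ) * Complex.I) *
    (Complex.I ^ (a.2.1 : ℕ) / ((a.2.1 : ℕ).factorial : ℂ)) * ∏ l, ((w (a.2.2 l) : ℝ) : ℂ)

/-- The coefficient of a Taylor feature in the expansion of `exp (i ⟨w, x⟩)`. -/
noncomputable def taylorCoeff {d : ℕ} (r : ℝ) (N m : ℕ) (x : Pt d) (a : FeatureIndex d N m) : ℝ :=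
  if a.1 = cellIndex r N x then ∏ l, (x - corner r N (cellIndex r N x)) (a.2.2 l) else 0

/-- Only the features of the cell of `x` count. The `k`-th power of the inner product expands over
lists of `k` coordinates, which separates `x` from the frequency `w` and keeps the coefficients
real. -/
lemma sum_taylorCoeff {d : ℕ} (r : ℝ) (N m : ℕ) (x w : Pt d) :
    ∑ a, taylorCoeff r N m x a • taylorFeature r N m a w =
      Complex.exp ((inner ℝ w (corner r N (cellIndex r N x)) : ℝ) * Complex.I) *
        ∑ k ∈ Finset.range m,
          (((inner ℝ w (x - corner r N (cellIndex r N x)) : ℝ) : ℂ) * Complex.I) ^ k /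
            (k.factorial : ℂ) := by
  set c := corner r N (cellIndex r N x) with hc
  rw [Fintype.sum_prod_type, Finset.sum_eq_single (cellIndex r N x)]
  · rw [Fintype.sum_sigma, ← Fin.sum_univ_eq_sum_range
      (fun k => (((inner ℝ w (x - c) : ℝ) : ℂ) * Complex.I) ^ k / (k.factorial : ℂ)) m,
      Finset.mul_sum]
    refine Finset.sum_congr rfl fun k _ => ?_
    have h1 : ((inner ℝ w (x - c) : ℝ) : ℂ) = ∑ i, ((w i * (x - c) i : ℝ) : ℂ) := by
      rw [← Complex.ofReal_sum, PiLp.inner_apply]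
      congr 1
      refine Finset.sum_congr rfl fun i _ => ?_
      simp [mul_comm]
    rw [mul_pow, h1, Fintype.sum_pow, Finset.sum_mul, Finset.sum_div, Finset.mul_sum]
    refine Finset.sum_congr rfl fun f _ => ?_
    simp only [taylorCoeff, taylorFeature, if_true, ← hc, Complex.real_smul, Complex.ofReal_mul,
      Finset.prod_mul_distrib, Complex.ofReal_prod]
    ring
  · intro j _ hj
    refine Finset.sum_eq_zero fun b _ => ?_
    simp [taylorCoeff, hj]
  · simp

/-- The degree is at most `m - 1 ≤ s`, so a spectral moment of order `2 s` makes the features square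
integrable. -/
lemma norm_taylorFeature_le {d : ℕ} (r : ℝ) (N m : ℕ) (a : FeatureIndex d N m) {s : ℝ}
    (hs : (m : ℝ) ≤ s + 1) (w : Pt d) : ‖taylorFeature r N m a w‖ ≤ 1 + ‖w‖ ^ s := by
  have h1 : ‖taylorFeature r N m a w‖ ≤ ‖w‖ ^ (a.2.1 : ℕ) := by
    rw [taylorFeature, norm_mul, norm_mul, Complex.norm_exp_ofReal_mul_I, one_mul, norm_div,
      norm_pow, Complex.norm_I, one_pow, Complex.norm_natCast, norm_prod]
    have h2 : ∏ l, ‖((w (a.2.2 l) : ℝ) : ℂ)‖ ≤ ‖w‖ ^ (a.2.1 : ℕ) := by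
      calc ∏ l, ‖((w (a.2.2 l) : ℝ) : ℂ)‖ ≤ ∏ _l : Fin a.2.1, ‖w‖ := by
            refine Finset.prod_le_prod (fun _ _ => norm_nonneg _) fun l _ => ?_
            rw [Complex.norm_real]
            exact PiLp.norm_apply_le w _
        _ = _ := by simp
    have h3 : 1 / ((a.2.1 : ℕ).factorial : ℝ) ≤ 1 := by
      rw [div_le_one (by positivity)]
      exact_mod_cast Nat.factorial_pos _
    calc _ ≤ 1 * ∏ l, ‖((w (a.2.2 l) : ℝ) : ℂ)‖ := by gcongr
      _ ≤ _ := by rwa [one_mul]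
  refine h1.trans ?_
  rcases le_or_gt ‖w‖ 1 with h | h
  · have : ‖w‖ ^ (a.2.1 : ℕ) ≤ 1 := pow_le_one₀ (norm_nonneg _) h
    have h2 : 0 ≤ ‖w‖ ^ s := by positivity
    linarith
  · have hk : ((a.2.1 : ℕ) : ℝ) ≤ s := by
      have h3 : (a.2.1 : ℕ) + 1 ≤ m := a.2.1.2
      have h4 : (((a.2.1 : ℕ) + 1 : ℕ) : ℝ) ≤ m := by exact_mod_cast h3
      push_cast at h4
      linarith
    have := Real.rpow_le_rpow_of_exponent_le h.le hk
    rw [Real.rpow_natCast] at this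
    linarith

lemma continuous_taylorFeature {d : ℕ} (r : ℝ) (N m : ℕ) (a : FeatureIndex d N m) :
    Continuous (taylorFeature r N m a) := by
  unfold taylorFeature
  fun_prop

variable {d : ℕ} {κ : Pt d → Pt d → ℝ} {η r s : ℝ} {Ω : Type*} {mΩ : MeasurableSpace Ω}
  {S : Measure Ω} [IsProbabilityMeasure S] {W : Ω → Pt d}

lemma memLp_taylorFeature (hW : Measurable W) (hpow : MemLp (fun ω => ‖W ω‖ ^ s) 2 S) {m : ℕ}
    (hms : (m : ℝ) ≤ s + 1) (N : ℕ) (a : FeatureIndex d N m) :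
    MemLp (fun ω => taylorFeature r N m a (W ω)) 2 S := by
  have h0 : MemLp (fun _ : Ω => (1 : ℝ)) 2 S := memLp_const 1
  have h1 : MemLp (fun ω => 1 + ‖W ω‖ ^ s) 2 S := h0.add hpow
  have h2 : Measurable fun ω => taylorFeature r N m a (W ω) :=
    (continuous_taylorFeature r N m a).measurable.comp hW
  have h3 : ∀ᵐ ω ∂S, ‖taylorFeature r N m a (W ω)‖ ≤ ‖1 + ‖W ω‖ ^ s‖ :=
    ae_of_all S fun ω => (norm_taylorFeature_le r N m a hms (W ω)).trans (le_abs_self _)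
  exact h1.mono h2.aestronglyMeasurable h3

/-- Information gain of a kernel with a spectral measure that has a moment of order `2 s`. -/
lemma exists_gain_le_of_spectral (hη : 0 < η) (hr : 0 ≤ r) (hs : 0 < s) (hW : Measurable W)
    (hmom : Integrable (fun ω => ‖W ω‖ ^ (2 * s)) S)
    (hκ : ∀ x y, κ x y = ∫ ω, Real.cos (inner ℝ (W ω) (x - y)) ∂S) :
    ∃ D c₁ c₂ : ℝ, 0 ≤ D ∧ 0 ≤ c₁ ∧ 0 ≤ c₂ ∧ ∀ N : ℕ, 1 ≤ N → ∀ (n : ℕ) (x : Fin n → Pt d),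
      (∀ i, x i ∈ box d r) → gain κ η x ≤
        D * (N + 1) ^ d * Real.log (1 + n * c₁) + n * (c₂ * (N : ℝ) ^ (-(2 * s))) := by
  have hexp := fun θ => norm_exp_sub_taylor_le hs θ
  obtain ⟨m, hm⟩ : ∃ m, m = ⌈s⌉₊ := ⟨_, rfl⟩
  rw [← hm] at hexp
  have hms : (m : ℝ) ≤ s + 1 := hm ▸ (Nat.ceil_lt_add_one hs.le).le
  have hpow : MemLp (fun ω => ‖W ω‖ ^ s) 2 S := by
    rw [memLp_two_iff_integrable_sq (hW.norm.pow_const s).aestronglyMeasurable]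
    refine hmom.congr (ae_of_all _ fun ω => ?_)
    change ‖W ω‖ ^ (2 * s) = (‖W ω‖ ^ s) ^ 2
    rw [← Real.rpow_natCast, ← Real.rpow_mul (norm_nonneg _)]
    congr 1
    push_cast
    ring
  set h : Lp ℝ 2 S := hpow.toLp _ with hh
  have hφ : ∀ x : Pt d, MemLp (fun ω => Complex.exp ((inner ℝ (W ω) x : ℝ) * Complex.I)) 2 S := by
    intro x
    refine MemLp.of_bound (by fun_prop) 1 (ae_of_all _ fun ω => ?_)
    rw [Complex.norm_exp_ofReal_mul_I]
  have hg : ∀ (N : ℕ) (a : FeatureIndex d N m),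
      MemLp (fun ω => taylorFeature r N m a (W ω)) 2 S := by
    exact fun N a => memLp_taylorFeature hW hpow hms N a
  set c := (m + 2) * (√d * r) ^ s * ‖h‖ with hc
  have hc0 : 0 ≤ c := by positivity
  -- The first constant counts the lists per cell. In the third, the factor 2 of the remainder
  -- cancels the 1/2 of the gain.
  refine ⟨1 / 2 * Fintype.card (Σ k : Fin m, (Fin k → Fin d)), (4 * 1 + 4 * c ^ 2) / η ^ 2,
    c ^ 2 / η ^ 2, by positivity, by positivity, by positivity, ?_⟩
  intro N hN n x hx
  have hN0 : (0 : ℝ) < N := by exact_mod_cast hN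
  -- The feature map is the character `exp(i⟨W, x⟩)` in complex `L²`, seen as a real Hilbert space;
  -- real parts of inner products are the cosines in the kernel.
  set u : Fin n → Lp ℂ 2 S := fun i => (hφ (x i)).toLp _ with hu
  set G : FeatureIndex d N m → Lp ℂ 2 S := fun a => (hg N a).toLp _ with hG
  set ρ : Fin n → Lp ℂ 2 S := fun i => u i - ∑ a, taylorCoeff r N m (x i) a • G a with hρ
  have hin : ∀ i j, κ (x i) (x j) = inner ℝ (u i) (u j) := by
    intro i j
    rw [L2.inner_def, hκ]
    refine integral_congr_ae ?_
    filter_upwards [(hφ (x i)).coeFn_toLp, (hφ (x j)).coeFn_toLp] with ω h1 h2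
    rw [hu, h1, h2, Complex.inner, ← Complex.exp_conj, ← Complex.exp_add, ← Real.cos_neg]
    simp only [map_mul, Complex.conj_ofReal, Complex.conj_I]
    have : (inner ℝ (W ω) (x j) : ℝ) * Complex.I + (inner ℝ (W ω) (x i) : ℝ) * -Complex.I =
        ((-(inner ℝ (W ω) (x i - x j)) : ℝ) : ℂ) * Complex.I := by
      rw [inner_sub_right]; push_cast; ring
    rw [this, Complex.exp_ofReal_mul_I_re]
  -- The Taylor error is at most a constant times `(‖W‖ √d r / N)^s`, and the moment controls its
  -- `L²` norm.
  have hρn : ∀ i, ‖ρ i‖ ≤ c * (N : ℝ) ^ (-s) := by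
    intro i
    have hae : ∀ᵐ ω ∂S, ‖ρ i ω‖ ≤ ((m + 2) * (√d * (r / N)) ^ s) * ‖h ω‖ := by
      have hsm : ∀ᵐ ω ∂S, ∀ a, (taylorCoeff r N m (x i) a • G a : Lp ℂ 2 S) ω =
          taylorCoeff r N m (x i) a • G a ω :=
        ae_all_iff.2 fun a => Lp.coeFn_smul _ _
      have hGa : ∀ᵐ ω ∂S, ∀ a, G a ω = taylorFeature r N m a (W ω) :=
        ae_all_iff.2 fun a => (hg N a).coeFn_toLp
      filter_upwards [Lp.coeFn_sub (u i) (∑ a, taylorCoeff r N m (x i) a • G a),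
        Lp.coeFn_fun_finsetSum Finset.univ (fun a => taylorCoeff r N m (x i) a • G a), hsm, hGa,
        (hφ (x i)).coeFn_toLp, hpow.coeFn_toLp] with ω h1 h2 h3 h4 h5 h6
      have h7 : ρ i ω = Complex.exp ((inner ℝ (W ω) (corner r N (cellIndex r N (x i))) : ℝ) *
          Complex.I) * (Complex.exp
            ((inner ℝ (W ω) (x i - corner r N (cellIndex r N (x i))) : ℝ) * Complex.I) -
          ∑ k ∈ Finset.range m,
          (((inner ℝ (W ω) (x i - corner r N (cellIndex r N (x i))) : ℝ) : ℂ) * Complex.I) ^ k /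
            (k.factorial : ℂ)) := by
        rw [hρ, h1, Pi.sub_apply, h2]
        simp only [h3, h4]
        rw [sum_taylorCoeff, hu, h5, mul_sub, ← Complex.exp_add]
        congr 2
        rw [← add_mul, ← Complex.ofReal_add, ← inner_add_right, add_sub_cancel]
      rw [h7, norm_mul, Complex.norm_exp_ofReal_mul_I, one_mul, hh, h6,
        Real.norm_of_nonneg (by positivity)]
      refine (hexp _).trans ?_
      rw [mul_assoc, ← Real.mul_rpow (by positivity) (norm_nonneg _)]
      refine mul_le_mul_of_nonneg_left ?_ (by positivity)
      refine Real.rpow_le_rpow (abs_nonneg _) ?_ hs.le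
      refine (abs_real_inner_le_norm _ _).trans ?_
      rw [mul_comm]
      gcongr
      exact norm_sub_corner_le hr hN (hx i)
    refine (Lp.norm_le_mul_norm_of_ae_le_mul hae).trans_eq ?_
    rw [hc, ← mul_div_assoc, Real.div_rpow (by positivity) hN0.le, Real.rpow_neg hN0.le]
    ring
  have hρ2 : ∀ i, ‖ρ i‖ ^ 2 ≤ c ^ 2 * (N : ℝ) ^ (-(2 * s)) := by
    intro i
    refine (pow_le_pow_left₀ (norm_nonneg _) (hρn i) 2).trans_eq ?_
    rw [mul_pow, ← Real.rpow_natCast ((N : ℝ) ^ (-s)), ← Real.rpow_mul hN0.le]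
    congr 2
    push_cast
    ring
  have hN1 : (N : ℝ) ^ (-(2 * s)) ≤ 1 :=
    Real.rpow_le_one_of_one_le_of_nonpos (by exact_mod_cast hN) (by linarith)
  have hu1 : ∀ i, ‖u i‖ ^ 2 ≤ 1 := by
    intro i
    rw [← real_inner_self_eq_norm_sq, ← hin, hκ]
    simp
  refine (gain_le_of_features hη x u ρ G (fun i a => taylorCoeff r N m (x i) a) hin
    (fun i => by rw [hρ]; simp) hu1 hρ2).trans ?_
  have hcard : (Fintype.card (FeatureIndex d N m) : ℝ) =
      (N + 1) ^ d * Fintype.card (Σ k : Fin m, (Fin k → Fin d)) := by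
    rw [Fintype.card_prod]
    simp
  rw [hcard, Fintype.card_fin]
  have hlog : Real.log (1 + n * ((4 * 1 + 4 * (c ^ 2 * (N : ℝ) ^ (-(2 * s)))) / η ^ 2)) ≤
      Real.log (1 + n * ((4 * 1 + 4 * c ^ 2) / η ^ 2)) := by
    have : c ^ 2 * (N : ℝ) ^ (-(2 * s)) ≤ c ^ 2 := mul_le_of_le_one_right (by positivity) hN1
    refine Real.log_le_log (by positivity) ?_
    gcongr
  have hD : (0 : ℝ) ≤ (N + 1) ^ d * Fintype.card (Σ k : Fin m, (Fin k → Fin d)) := by positivity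
  have h1 := mul_le_mul_of_nonneg_left hlog hD
  have h2 : (n : ℝ) * (2 * (c ^ 2 * (N : ℝ) ^ (-(2 * s))) / η ^ 2) =
      2 * (n * (c ^ 2 / η ^ 2 * (N : ℝ) ^ (-(2 * s)))) := by ring
  rw [h2]
  linarith

end SpectralFeatures

/-! ### Information gain of the admissible kernels is `o(√n)`. -/

section KernelRates

variable {d : ℕ} {κ : Pt d → Pt d → ℝ} {η r s : ℝ}

lemma zero_mem_box (hr : 0 ≤ r) : (0 : Pt d) ∈ box d r := fun _ => ⟨le_rfl, hr⟩

/-- The choice `N ≈ n^(1/(2s+d))` balances the number of cells `N^d` with the total error `n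
N^(-2s)`. -/
lemma infoGain_le_rpow_mul_log (hκ : (Matrix.of κ).PosSemidef) (hη : 0 < η) (hr : 0 ≤ r)
    (hs : 0 < s) {D c₁ c₂ : ℝ} (hD : 0 ≤ D) (h₁ : 0 ≤ c₁) (h₂ : 0 ≤ c₂)
    (h : ∀ N : ℕ, 1 ≤ N → ∀ (n : ℕ) (x : Fin n → Pt d), (∀ i, x i ∈ box d r) → gain κ η x ≤
        D * (N + 1) ^ d * Real.log (1 + n * c₁) + n * (c₂ * (N : ℝ) ^ (-(2 * s))))
    {n : ℕ} (hn : 1 ≤ n) :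
    infoGain κ η n (box d r) ≤ (n : ℝ) ^ ((d : ℝ) / (2 * s + d)) *
      (D * 3 ^ d * (Real.log (1 + c₁) + Real.log n) + c₂) := by
  have hd : 0 < 2 * s + d := by positivity
  have hn1 : (1 : ℝ) ≤ n := by exact_mod_cast hn
  have hn0 : (0 : ℝ) < n := by linarith
  set b : ℝ := (n : ℝ) ^ (1 / (2 * s + d)) with hb
  have hb1 : 1 ≤ b := Real.one_le_rpow hn1 (by positivity)
  have hNb : b ≤ (⌈b⌉₊ : ℝ) := Nat.le_ceil b
  have hNb' : (⌈b⌉₊ : ℝ) + 1 ≤ 3 * b := by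
    have := Nat.ceil_lt_add_one (zero_le_one.trans hb1)
    linarith
  have hN : 1 ≤ ⌈b⌉₊ := Nat.one_le_ceil_iff.2 (by linarith)
  have hbd : b ^ d = (n : ℝ) ^ ((d : ℝ) / (2 * s + d)) := by
    rw [hb, ← Real.rpow_natCast, ← Real.rpow_mul hn0.le]
    congr 1
    field_simp
  refine infoGain_le hκ hη ⟨0, zero_mem_box hr⟩ fun x hx => (h _ hN n x hx).trans ?_
  have hlog : Real.log (1 + n * c₁) ≤ Real.log (1 + c₁) + Real.log n := by
    rw [← Real.log_mul (by positivity) hn0.ne']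
    refine Real.log_le_log (by positivity) ?_
    nlinarith
  have hlog0 : 0 ≤ Real.log (1 + n * c₁) := Real.log_nonneg (by nlinarith)
  have e1 : D * ((⌈b⌉₊ : ℝ) + 1) ^ d * Real.log (1 + n * c₁) ≤
      D * (3 * b) ^ d * (Real.log (1 + c₁) + Real.log n) := by gcongr
  have e2 : (n : ℝ) * (c₂ * (⌈b⌉₊ : ℝ) ^ (-(2 * s))) ≤
      (n : ℝ) ^ ((d : ℝ) / (2 * s + d)) * c₂ := by
    have h3 : (⌈b⌉₊ : ℝ) ^ (-(2 * s)) ≤ b ^ (-(2 * s)) :=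
      Real.rpow_le_rpow_of_nonpos (by linarith) hNb (by linarith)
    have h4 : (n : ℝ) * b ^ (-(2 * s)) = (n : ℝ) ^ ((d : ℝ) / (2 * s + d)) := by
      have h5 : 1 + 1 / (2 * s + d) * -(2 * s) = d / (2 * s + d) := by field_simp; ring
      rw [hb, ← Real.rpow_mul hn0.le, ← h5, Real.rpow_add hn0, Real.rpow_one]
    calc (n : ℝ) * (c₂ * (⌈b⌉₊ : ℝ) ^ (-(2 * s))) ≤ n * (c₂ * b ^ (-(2 * s))) := by gcongr
      _ = _ := by rw [← h4]; ring
  rw [mul_pow, hbd] at e1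
  linarith

/-- A polynomial feature expansion gives an information gain of smaller order than `√n`. -/
lemma infoGain_isLittleO (hκ : (Matrix.of κ).PosSemidef) (hη : 0 < η) (hr : 0 ≤ r)
    (hs : (d : ℝ) < 2 * s) {D c₁ c₂ : ℝ} (hD : 0 ≤ D) (h₁ : 0 ≤ c₁) (h₂ : 0 ≤ c₂)
    (h : ∀ N : ℕ, 1 ≤ N → ∀ (n : ℕ) (x : Fin n → Pt d), (∀ i, x i ∈ box d r) → gain κ η x ≤
        D * (N + 1) ^ d * Real.log (1 + n * c₁) + n * (c₂ * (N : ℝ) ^ (-(2 * s)))) :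
    (fun n : ℕ => infoGain κ η n (box d r)) =o[atTop] (fun n : ℕ => √(n : ℝ)) := by
  have hd0 : (0 : ℝ) ≤ d := Nat.cast_nonneg d
  have hs0 : 0 < s := by linarith
  set θ : ℝ := d / (2 * s + d) with hθ
  have hθ2 : θ < 1 / 2 := by
    rw [hθ, div_lt_div_iff₀ (by linarith) (by norm_num)]
    linarith
  have h1 : (fun n : ℕ => infoGain κ η n (box d r)) =O[atTop] fun n : ℕ => (n : ℝ) ^ θ *
      (D * 3 ^ d * (Real.log (1 + c₁) + Real.log n) + c₂) := by
    refine IsBigO.of_bound 1 ?_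
    filter_upwards [eventually_ge_atTop 1] with n hn
    rw [one_mul, Real.norm_of_nonneg (infoGain_nonneg hκ hη _ _)]
    exact (infoGain_le_rpow_mul_log hκ hη hr hs0 hD h₁ h₂ h hn).trans (le_abs_self _)
  have hε : 0 < 1 / 2 - θ := by linarith
  have hc : ∀ c : ℝ, (fun _ : ℝ => c) =o[atTop] fun x : ℝ => x ^ (1 / 2 - θ) := fun c =>
    isLittleO_const_left.2 (Or.inr (tendsto_norm_atTop_atTop.comp (tendsto_rpow_atTop hε)))
  have h2 : (fun x : ℝ => D * 3 ^ d * (Real.log (1 + c₁) + Real.log x) + c₂) =o[atTop]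
      fun x : ℝ => x ^ (1 / 2 - θ) :=
    (((hc _).add (isLittleO_log_rpow_atTop hε)).const_mul_left _).add (hc _)
  have h3 := ((isBigO_refl (fun x : ℝ => x ^ θ) atTop).mul_isLittleO h2).comp_tendsto
    tendsto_natCast_atTop_atTop
  refine h1.trans_isLittleO (h3.congr' EventuallyEq.rfl ?_)
  filter_upwards [eventually_ge_atTop 1] with n hn
  have hn0 : (0 : ℝ) < n := by exact_mod_cast hn
  rw [Function.comp_apply, ← Real.rpow_add hn0, Real.sqrt_eq_rpow]
  congr 1
  ring

/-- The `d` coordinates are exact features, so the error term is zero and any `s` with `d < 2 s`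
will do. -/
lemma infoGain_linearKernel_isLittleO (hκ : (Matrix.of (linearKernel d)).PosSemidef)
    (hη : 0 < η) (hr : 0 ≤ r) :
    (fun n : ℕ => infoGain (linearKernel d) η n (box d r)) =o[atTop]
      (fun n : ℕ => √(n : ℝ)) := by
  obtain ⟨C, hC⟩ := (isCompact_box d r).isBounded.exists_norm_le
  refine infoGain_isLittleO (s := d + 1) (D := 1 / 2 * d) (c₁ := 4 * C ^ 2 / η ^ 2) (c₂ := 0)
    hκ hη hr ?_ (by positivity) (by positivity) le_rfl ?_
  · have : (0 : ℝ) ≤ d := Nat.cast_nonneg d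
    linarith
  intro N hN n x hx
  have h := gain_le_of_features (κ := linearKernel d) (τ := 0) (b := C ^ 2) hη x x 0
    (fun i : Fin d => EuclideanSpace.single i (1 : ℝ)) (fun i k => x i k) (fun _ _ => rfl)
    (fun i => by
      ext k
      simp [Finset.sum_apply, Pi.single_apply]) (fun i => pow_le_pow_left₀ (norm_nonneg _)
      (hC _ (hx i)) 2) (by simp)
  refine h.trans ?_
  rw [Fintype.card_fin, Fintype.card_fin]
  have hl : 0 ≤ Real.log (1 + n * (4 * C ^ 2 / η ^ 2)) :=
    Real.log_nonneg (by have : 0 ≤ n * (4 * C ^ 2 / η ^ 2) := by positivity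
                        linarith)
  have hp : (1 : ℝ) ≤ ((N : ℝ) + 1) ^ d := one_le_pow₀ (by
    have : (0 : ℝ) ≤ N := Nat.cast_nonneg N
    linarith)
  have : (0 : ℝ) ≤ d := Nat.cast_nonneg d
  calc _ = 1 / 2 * d * 1 * Real.log (1 + n * (4 * C ^ 2 / η ^ 2)) := by
        rw [show 4 * C ^ 2 + 4 * (0 : ℝ) = 4 * C ^ 2 by ring]; ring
    _ ≤ 1 / 2 * d * (N + 1) ^ d * Real.log (1 + n * (4 * C ^ 2 / η ^ 2)) := by gcongr
    _ = _ := by ring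

lemma infoGain_isLittleO_of_spectral {Ω : Type*} {mΩ : MeasurableSpace Ω}
    {S : Measure Ω} [IsProbabilityMeasure S] {W : Ω → Pt d} (hκ : (Matrix.of κ).PosSemidef)
    (hη : 0 < η) (hr : 0 ≤ r) (hs : 0 < s) (hds : (d : ℝ) < 2 * s) (hW : Measurable W)
    (hmom : Integrable (fun ω => ‖W ω‖ ^ (2 * s)) S)
    (h : ∀ x y, κ x y = ∫ ω, Real.cos (inner ℝ (W ω) (x - y)) ∂S) :
    (fun n : ℕ => infoGain κ η n (box d r)) =o[atTop] (fun n : ℕ => √(n : ℝ)) := by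
  obtain ⟨D, c₁, c₂, hD, h₁, h₂, hle⟩ := exists_gain_le_of_spectral hη hr hs hW hmom h
  exact infoGain_isLittleO hκ hη hr hds hD h₁ h₂ hle

lemma integral_cos_stdGaussian (z : Pt d) :
    ∫ g, Real.cos (inner ℝ g z) ∂(stdGaussian (Pt d)) = Real.exp (-‖z‖ ^ 2 / 2) := by
  have h := charFun_stdGaussian z
  rw [charFun_apply] at h
  have h2 := congrArg Complex.re h
  have h3 : Integrable (fun g => Complex.exp ((inner ℝ g z : ℝ) * Complex.I))
      (stdGaussian (Pt d)) := by
    refine Integrable.of_bound (by fun_prop) 1 (ae_of_all _ fun g => ?_)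
    rw [Complex.norm_exp_ofReal_mul_I]
  rw [← RCLike.re_eq_complex_re, ← integral_re h3] at h2
  simp only [RCLike.re_eq_complex_re, Complex.exp_ofReal_mul_I_re] at h2
  rw [h2, ← Complex.ofReal_pow, ← Complex.ofReal_neg, ← Complex.ofReal_ofNat,
    ← Complex.ofReal_div, Complex.exp_ofReal_re]

lemma integrable_norm_rpow_stdGaussian {p : ℝ} (hp : 0 < p) :
    Integrable (fun g => ‖g‖ ^ p) (stdGaussian (Pt d)) := by
  have := (IsGaussian.memLp_id (stdGaussian (Pt d)) (ENNReal.ofReal p)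
    ENNReal.ofReal_ne_top).integrable_norm_rpow (by simpa using hp) ENNReal.ofReal_ne_top
  simpa [ENNReal.toReal_ofReal hp.le] using this

/-- The spectral law is a Gaussian of scale `1/l`, with all moments. -/
lemma infoGain_seKernel_isLittleO {l : ℝ} (hl : 0 < l)
    (hκ : (Matrix.of (seKernel d l)).PosSemidef) (hη : 0 < η) (hr : 0 ≤ r) :
    (fun n : ℕ => infoGain (seKernel d l) η n (box d r)) =o[atTop]
      (fun n : ℕ => √(n : ℝ)) := by
  have hd0 : (0 : ℝ) ≤ d := Nat.cast_nonneg d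
  refine infoGain_isLittleO_of_spectral (s := d + 1) (S := stdGaussian (Pt d))
    (W := fun g => l⁻¹ • g) hκ hη hr (by positivity) (by linarith) (by fun_prop) ?_ ?_
  · simp_rw [norm_smul]
    have := (integrable_norm_rpow_stdGaussian (d := d) (p := 2 * ((d : ℝ) + 1))
      (by positivity)).const_mul (‖l⁻¹‖ ^ (2 * ((d : ℝ) + 1)))
    refine this.congr (ae_of_all _ fun g => ?_)
    exact (Real.mul_rpow (norm_nonneg _) (norm_nonneg _)).symm
  · intro x y
    simp_rw [real_inner_smul_left, ← real_inner_smul_right]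
    rw [integral_cos_stdGaussian, seKernel, norm_smul, norm_inv, Real.norm_of_nonneg hl.le]
    congr 1
    field_simp

lemma gammaMeasure_one_eq (ν : ℝ) :
    gammaMeasure ν 1 = (volume.restrict (Set.Ioi 0)).withDensity
      (fun t => ENNReal.ofReal (Real.exp (-t) * t ^ (ν - 1) / Real.Gamma ν)) := by
  rw [gammaMeasure, ← withDensity_indicator measurableSet_Ioi]
  refine withDensity_congr_ae ?_
  -- The density is supported on the closed half-line; the point 0 is null.
  filter_upwards [compl_mem_ae_iff.2 (measure_singleton (0 : ℝ))] with t ht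
  rw [gammaPDF_eq]
  rcases lt_or_gt_of_ne (show t ≠ 0 from ht) with h | h
  · simp [h.le, not_le.2 h]
  · rw [if_pos h.le, Set.indicator_of_mem (Set.mem_Ioi.2 h)]
    simp only [Real.one_rpow, one_mul]
    congr 1
    ring

lemma integral_gammaMeasure_one {ν : ℝ} (hν : 0 < ν) (φ : ℝ → ℝ) :
    ∫ t, φ t ∂(gammaMeasure ν 1) =
      (∫ t in Set.Ioi 0, Real.exp (-t) * t ^ (ν - 1) * φ t) / Real.Gamma ν := by
  rw [gammaMeasure_one_eq, integral_withDensity_eq_integral_toReal_smul (by fun_prop)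
    (ae_of_all _ fun _ => ENNReal.ofReal_lt_top), ← integral_div]
  refine setIntegral_congr_fun measurableSet_Ioi fun t ht => ?_
  have ht0 : 0 < t := ht
  have := Real.Gamma_pos_of_pos hν
  simp only [smul_eq_mul]
  rw [ENNReal.toReal_ofReal (by positivity)]
  ring

lemma integrable_rpow_gammaMeasure_one {ν : ℝ} (hν : 0 < ν) (hs : s < ν) :
    Integrable (fun t => t ^ (-s)) (gammaMeasure ν 1) := by
  rw [gammaMeasure_one_eq, integrable_withDensity_iff_integrable_smul' (by fun_prop)
    (ae_of_all _ fun _ => ENNReal.ofReal_lt_top)]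
  have h := (Real.GammaIntegral_convergent (sub_pos.2 hs)).div_const (Real.Gamma ν)
  refine h.congr ?_
  filter_upwards [ae_restrict_mem measurableSet_Ioi] with t ht
  have ht0 : 0 < t := ht
  have := Real.Gamma_pos_of_pos hν
  rw [ENNReal.toReal_ofReal (by positivity), smul_eq_mul,
    show ν - s - 1 = (ν - 1) + -s by ring, Real.rpow_add ht0]
  ring

/-- The substitution `t ↦ a/t`. -/
lemma integral_exp_neg_sub_div_mul_rpow {a ν : ℝ} (ha : 0 < a) :
    ∫ t in Set.Ioi (0 : ℝ), Real.exp (-t - a / t) * t ^ (-ν - 1) =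
      a ^ (-ν) * ∫ t in Set.Ioi (0 : ℝ), Real.exp (-t) * t ^ (ν - 1) * Real.exp (-a / t) := by
  set G : ℝ → ℝ := fun t => Real.exp (-t - a / t) * t ^ (-ν - 1) with hG
  have h1 := integral_comp_mul_left_Ioi G 0 ha
  rw [mul_zero, smul_eq_mul, ← integral_comp_rpow_Ioi (fun y => G (a * y)) (p := -1)
    (by norm_num)] at h1
  have h2 : ∫ t in Set.Ioi 0, G t = a * (a⁻¹ * ∫ t in Set.Ioi 0, G t) := by
    rw [mul_inv_cancel_left₀ ha.ne']
  rw [h2, ← h1, ← integral_const_mul, ← integral_const_mul]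
  refine setIntegral_congr_fun measurableSet_Ioi fun t ht => ?_
  have ht0 : 0 < t := ht
  simp only [hG, smul_eq_mul, Real.rpow_neg_one]
  have e1 : a / (a * t⁻¹) = t := by field_simp
  rw [e1, Real.mul_rpow ha.le (by positivity), Real.inv_rpow ht0.le, ← Real.rpow_neg ht0.le,
    show -(a * t⁻¹) - t = -t + -a / t by ring, Real.exp_add,
    show -(-ν - 1) = (ν - 1) + 2 by ring, Real.rpow_add ht0,
    show (-ν - 1 : ℝ) = -ν + -1 by ring, Real.rpow_add ha, Real.rpow_neg_one,
    show (-1 - 1 : ℝ) = -2 by norm_num, Real.rpow_neg ht0.le]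
  have : t ^ (2 : ℝ) ≠ 0 := by positivity
  simp only [abs_neg, abs_one, one_mul]
  field_simp

/-- The Matérn kernel is a mixture of squared exponential kernels whose squared length scales are
gamma distributed up to a factor. This replaces an analysis of the Bessel function. -/
lemma maternKernel_eq {ν ρ : ℝ} (hν : 0 < ν) (hρ : 0 < ρ) (x y : Pt d) :
    maternKernel d ν ρ x y =
      ∫ t, Real.exp (-(ν * ‖x - y‖ ^ 2 / (2 * ρ ^ 2)) / t) ∂(gammaMeasure ν 1) := by
  have := isProbabilityMeasure_gammaMeasure hν one_pos
  rw [maternKernel]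
  split_ifs with hxy
  · simp [hxy]
  have hz : 0 < √(2 * ν) * ‖x - y‖ / ρ := by
    have : 0 < ‖x - y‖ := norm_pos_iff.2 (sub_ne_zero.2 hxy)
    positivity
  have ha : ν * ‖x - y‖ ^ 2 / (2 * ρ ^ 2) = (√(2 * ν) * ‖x - y‖ / ρ / 2) ^ 2 := by
    rw [div_pow, div_pow, mul_pow, Real.sq_sqrt (by positivity)]
    ring
  rw [ha]
  generalize √(2 * ν) * ‖x - y‖ / ρ = z at hz
  rw [integral_gammaMeasure_one hν, besselSecond]
  have hJ := integral_exp_neg_sub_div_mul_rpow (ν := ν) (a := (z / 2) ^ 2) (by positivity)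
  have e : ∀ t : ℝ, z ^ 2 / (4 * t) = (z / 2) ^ 2 / t := fun t => by ring
  simp_rw [e]
  rw [hJ]
  have h2 : ((z / 2) ^ 2) ^ (-ν) = (z / 2) ^ (-ν) * (z / 2) ^ (-ν) := by
    rw [sq, Real.mul_rpow (by positivity) (by positivity)]
  have h3 : z ^ ν = (z / 2) ^ ν * 2 ^ ν := by
    rw [← Real.mul_rpow (by positivity) (by positivity)]
    congr 1
    ring
  have h4 : (z / 2) ^ ν * (z / 2) ^ (-ν) = 1 := by
    rw [← Real.rpow_add (by positivity)]; simp
  have h5 : (2 : ℝ) ^ (1 - ν) * 2 ^ ν = 2 := by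
    rw [← Real.rpow_add (by norm_num)]; simp
  rw [h2, h3]
  generalize (∫ t in Set.Ioi 0, Real.exp (-t) * t ^ (ν - 1) * Real.exp (-(z / 2) ^ 2 / t)) = J
  calc _ = ((2 : ℝ) ^ (1 - ν) * 2 ^ ν) / 2 * ((z / 2) ^ ν * (z / 2) ^ (-ν)) ^ 2 *
        (J / Real.Gamma ν) := by ring
    _ = _ := by rw [h4, h5]; ring

/-- By the gamma mixture, the spectral law is that of a Gaussian vector divided by the root of an
independent gamma variable of shape `ν`. Its moment of order `2 s` exists for `s < ν`, and `d < 2 s`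
is needed; the midpoint of `d/2` and `ν` satisfies both. -/
lemma infoGain_maternKernel_isLittleO {ν ρ : ℝ} (hν : (d : ℝ) / 2 < ν) (hρ : 0 < ρ)
    (hκ : (Matrix.of (maternKernel d ν ρ)).PosSemidef) (hη : 0 < η) (hr : 0 ≤ r) :
    (fun n : ℕ => infoGain (maternKernel d ν ρ) η n (box d r)) =o[atTop]
      (fun n : ℕ => √(n : ℝ)) := by
  have hd0 : (0 : ℝ) ≤ d := Nat.cast_nonneg d
  have hν0 : 0 < ν := by linarith
  have := isProbabilityMeasure_gammaMeasure hν0 one_pos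
  set W : ℝ × Pt d → Pt d := fun ω => √(ν / ρ ^ 2 / ω.1) • ω.2 with hWdef
  have hW : Measurable W := by fun_prop
  have hpos : ∀ᵐ t ∂(gammaMeasure ν 1), 0 < t := by
    rw [gammaMeasure_one_eq]
    exact (withDensity_absolutelyContinuous _ _).ae_le (ae_restrict_mem measurableSet_Ioi)
  refine infoGain_isLittleO_of_spectral (s := (d / 2 + ν) / 2)
    (S := (gammaMeasure ν 1).prod (stdGaussian (Pt d))) (W := W) hκ hη hr (by positivity)
    (by linarith) hW ?_ ?_
  · have h1 := ((integrable_rpow_gammaMeasure_one hν0 (s := (d / 2 + ν) / 2)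
      (by linarith)).const_mul ((ν / ρ ^ 2) ^ ((d / 2 + ν) / 2))).mul_prod
      (integrable_norm_rpow_stdGaussian (d := d) (p := 2 * ((d / 2 + ν) / 2)) (by positivity))
    refine h1.congr ?_
    filter_upwards [Measure.quasiMeasurePreserving_fst.ae hpos] with ω hω
    rw [hWdef, norm_smul, Real.mul_rpow (norm_nonneg _) (norm_nonneg _),
      Real.norm_of_nonneg (Real.sqrt_nonneg _), Real.rpow_mul (Real.sqrt_nonneg _),
      Real.rpow_two, Real.sq_sqrt (by positivity), Real.div_rpow (by positivity) hω.le,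
      Real.rpow_neg hω.le]
    ring
  · intro x y
    rw [integral_prod, maternKernel_eq hν0 hρ]
    · refine integral_congr_ae ?_
      filter_upwards [hpos] with t ht
      simp only [hWdef]
      simp_rw [real_inner_smul_left, ← real_inner_smul_right]
      rw [integral_cos_stdGaussian, norm_smul, Real.norm_of_nonneg (Real.sqrt_nonneg _), mul_pow,
        Real.sq_sqrt (by positivity)]
      congr 1
      field_simp
    · refine Integrable.of_bound ?_ 1 (ae_of_all _ fun ω => ?_)
      · have : Measurable fun ω => (inner ℝ (W ω) (x - y) : ℝ) := by fun_prop
        exact this.cos.aestronglyMeasurable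
      · exact Real.abs_cos_le_one _

lemma AdmissibleKernel.isLittleO (h : AdmissibleKernel d r η κ)
    (hκ : (Matrix.of κ).PosSemidef) (hη : 0 < η) (hr : 0 ≤ r) :
    (fun n : ℕ => infoGain κ η n (box d r)) =o[atTop] (fun n : ℕ => √(n : ℝ)) := by
  rcases h with rfl | ⟨l, hl, rfl⟩ | ⟨ν, ρ, hν, hρ, rfl⟩ | h
  · exact infoGain_linearKernel_isLittleO hκ hη hr
  · exact infoGain_seKernel_isLittleO hl hκ hη hr
  · exact infoGain_maternKernel_isLittleO hν hρ hκ hη hr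
  · exact h

end KernelRates

/-! ### Deterministic bounds along one trajectory. -/

section Pathwise

variable {d : ℕ} {κ : Pt d → Pt d → ℝ} {η r B δ k γ : ℝ} {X A : Set (Pt d)}
  {x x' : ℕ → Pt d} {q : ℕ → Query} {y : ℕ → ℝ} {a : Query}

/-- Compactness makes the real supremum an attained maximum rather than a default value. -/
lemma isMax_supOn {g : Pt d → ℝ} (hX : IsCompact X) (hne : X.Nonempty) (hg : ContinuousOn g X) :
    (∃ p ∈ X, g p = supOn X g) ∧ ∀ p ∈ X, g p ≤ supOn X g := by
  obtain ⟨p, hp, hmax⟩ := hX.exists_isMaxOn hne hg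
  have h : IsLUB (g '' X) (g p) :=
    ⟨by rintro _ ⟨u, hu, rfl⟩; exact hmax hu, fun b hb => hb ⟨p, hp, rfl⟩⟩
  have h2 : supOn X g = g p := h.csSup_eq (hne.image g)
  exact ⟨⟨p, hp, h2.symm⟩, fun u hu => h2 ▸ hmax hu⟩

lemma beta_nonneg (hB : 0 ≤ B) (t : ℕ) : 0 ≤ beta κ η B δ A t := by
  unfold beta
  positivity

lemma beta_mono (hκ : (Matrix.of κ).PosSemidef) (hη : 0 < η) (hk : ∀ p ∈ A, κ p p ≤ k)
    (hA : A.Nonempty) : Monotone (beta κ η B δ A) := by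
  intro s t hst
  have := infoGain_mono hκ hη hk hA hst
  simp only at this
  unfold beta
  gcongr

lemma beta_mono_set (hκ : (Matrix.of κ).PosSemidef) (hη : 0 < η) (hk : ∀ p ∈ A, κ p p ≤ k)
    (hX : X.Nonempty) (hXA : X ⊆ A) (t : ℕ) : beta κ η B δ X t ≤ beta κ η B δ A t := by
  have := infoGain_mono_set hκ hη hk hX hXA t
  unfold beta
  gcongr

lemma gain_steps_le_infoGain (hκ : (Matrix.of κ).PosSemidef) (hη : 0 < η)
    (hk : ∀ p ∈ A, κ p p ≤ k) (hA : A.Nonempty) {t : ℕ} (hx : ∀ s ∈ stepsOf q a t, x s ∈ A) :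
    gain κ η (fun i : stepsOf q a t => x i) ≤ infoGain κ η t A := by
  refine (gain_le_infoGain hκ hη hk (fun i : stepsOf q a t => x i) fun i => hx i i.2).trans ?_
  rw [Fintype.card_coe]
  exact infoGain_mono hκ hη hk hA (card_stepsOf_le q a t)

/-- Confidence band from a bound on the likelihood ratio. -/
lemma InRKHSBall.abs_sub_postMean_le_width {g : Pt d → ℝ} (h : InRKHSBall κ X B g)
    (hκ : (Matrix.of κ).PosSemidef) (hη : 0 < η) (hx : ∀ t, x t ∈ X) (hB : 0 ≤ B) (hδ : 0 < δ)
    (hk : ∀ p ∈ A, κ p p ≤ k) (hA : A.Nonempty) {t : ℕ} (hxA : ∀ s ∈ stepsOf q a t, x s ∈ A)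
    (hl : likelihood κ η (stepsOf q a t) x (fun s => y s - g (x s)) ≤ Real.exp 1 / δ)
    {p : Pt d} (hp : p ∈ X) :
    |g p - postMean κ η (stepsOf q a t) x y p| ≤ width κ η (beta κ η B δ A) a x q t p := by
  have hc : Real.exp (1 + Real.log (1 / δ)) = Real.exp 1 / δ := by
    rw [Real.exp_add, Real.exp_log (by positivity)]; ring
  refine (h.abs_sub_postMean_le hκ hη hx (hc ▸ hl) hB hp).trans ?_
  have hg := gain_steps_le_infoGain (q := q) (a := a) hκ hη hk hA hxA
  unfold width beta
  refine mul_le_mul_of_nonneg_right ?_ (Real.sqrt_nonneg _)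
  have : √(2 * (gain κ η (fun i : stepsOf q a t => x i) + (1 + Real.log (1 / δ)))) ≤
      √(2 * (infoGain κ η t A + 1 + Real.log (1 / δ))) := by
    refine Real.sqrt_le_sqrt ?_
    linarith
  linarith

/-- Number of steps at which a lower bound on the width holds. -/
lemma card_mul_sq_le (hκ : (Matrix.of κ).PosSemidef) (hη : 0 < η) (hkx : ∀ t, κ (x t) (x t) ≤ k)
    (hk : ∀ p ∈ A, κ p p ≤ k) (hA : A.Nonempty) (hB : 0 ≤ B) {c : ℝ} (hc : 0 ≤ c) {t : ℕ}
    (hx : ∀ s ∈ stepsOf q a t, x s ∈ A) {F : Finset ℕ} (hF : F ⊆ stepsOf q a t)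
    (hw : ∀ s ∈ F, c ≤ width κ η (beta κ η B δ A) a x q s (x s)) :
    F.card * c ^ 2 ≤ 2 * (k + η ^ 2) * beta κ η B δ A t ^ 2 * infoGain κ η t A := by
  have hb := beta_nonneg (κ := κ) (η := η) (δ := δ) (A := A) hB
  have hk0 : 0 ≤ k := by
    obtain ⟨p, hp⟩ := hA
    exact (hκ.diag_nonneg (i := p)).trans (hk p hp)
  calc F.card * c ^ 2 = ∑ s ∈ F, c ^ 2 := by simp
    _ ≤ ∑ s ∈ F, beta κ η B δ A t ^ 2 * postStd κ η (stepsOf q a s) x (x s) ^ 2 := by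
        refine Finset.sum_le_sum fun s hs => ?_
        rw [← mul_pow]
        refine pow_le_pow_left₀ hc ((hw s hs).trans ?_) 2
        refine mul_le_mul_of_nonneg_right ?_ (Real.sqrt_nonneg _)
        exact beta_mono hκ hη hk hA (mem_stepsOf.1 (hF hs)).1.le
    _ ≤ ∑ s ∈ stepsOf q a t,
          beta κ η B δ A t ^ 2 * postStd κ η (stepsOf q a s) x (x s) ^ 2 :=
        Finset.sum_le_sum_of_subset_of_nonneg hF fun _ _ _ => by positivity
    _ = beta κ η B δ A t ^ 2 * ∑ s ∈ stepsOf q a t, postStd κ η (stepsOf q a s) x (x s) ^ 2 := by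
        rw [Finset.mul_sum]
    _ ≤ beta κ η B δ A t ^ 2 * (2 * (k + η ^ 2) * infoGain κ η t A) := by
        refine mul_le_mul_of_nonneg_left ?_ (by positivity)
        refine (sum_sq_postStd_le hκ hη x hkx q a t).trans ?_
        exact mul_le_mul_of_nonneg_left (gain_steps_le_infoGain hκ hη hk hA hx) (by positivity)
    _ = _ := by ring

/-- `β_t²` is at most a constant plus a multiple of `I_t`, and `I_t² = o(t)`. The factor 2 leaves
half of the steps for direct queries, and the summand `γ²` pays for the exit step. -/
lemma exists_forall_beta_sq_mul_infoGain_le (hκ : (Matrix.of κ).PosSemidef) (hη : 0 < η)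
    (hk : 0 ≤ k) (hγ : 0 < γ)
    (h : (fun n : ℕ => infoGain κ η n A) =o[atTop] (fun n : ℕ => √(n : ℝ))) :
    ∃ t₀ : ℕ, 1 ≤ t₀ ∧ ∀ t ≥ t₀,
      2 * (γ ^ 2 + 2 * (k + η ^ 2) * beta κ η B δ A t ^ 2 * infoGain κ η t A) ≤ γ ^ 2 * t := by
  have hsq : Tendsto (fun n : ℕ => √(n : ℝ)) atTop atTop :=
    Real.tendsto_sqrt_atTop.comp tendsto_natCast_atTop_atTop
  have hone : ∀ c : ℝ, (fun _ : ℕ => c) =o[atTop] fun n : ℕ => √(n : ℝ) := fun c =>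
    isLittleO_const_left.2 (Or.inr (tendsto_norm_atTop_atTop.comp hsq))
  have hmul : ∀ n : ℕ, √(n : ℝ) * √(n : ℝ) = n := fun n => Real.mul_self_sqrt (Nat.cast_nonneg n)
  have h1 : (fun n : ℕ => (8 * B ^ 2 + 4 * |1 + Real.log (1 / δ)| + 4 * infoGain κ η n A) *
      infoGain κ η n A) =o[atTop] fun n : ℕ => (n : ℝ) := by
    have := ((hone (8 * B ^ 2 + 4 * |1 + Real.log (1 / δ)|)).add (h.const_mul_left 4)).mul h
    simpa only [hmul] using this
  have h2 : (fun _ : ℕ => 2 * γ ^ 2) =o[atTop] fun n : ℕ => (n : ℝ) :=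
    isLittleO_const_left.2 (Or.inr (tendsto_norm_atTop_atTop.comp tendsto_natCast_atTop_atTop))
  have h3 := h2.add (h1.const_mul_left (2 * (2 * (k + η ^ 2))))
  have h4 := h3.def (c := γ ^ 2) (by positivity)
  obtain ⟨N, hN⟩ := eventually_atTop.1 h4
  refine ⟨max N 1, le_max_right _ _, fun t ht => ?_⟩
  have h5 := (Real.le_norm_self _).trans (hN t ((le_max_left _ _).trans ht))
  rw [Real.norm_of_nonneg (Nat.cast_nonneg t)] at h5
  refine le_trans ?_ h5
  have hI := infoGain_nonneg hκ hη t A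
  have hb : beta κ η B δ A t ^ 2 ≤
      8 * B ^ 2 + 4 * |1 + Real.log (1 / δ)| + 4 * infoGain κ η t A := by
    unfold beta
    have e1 : √(2 * (infoGain κ η t A + 1 + Real.log (1 / δ))) ≤
        √(2 * (infoGain κ η t A + |1 + Real.log (1 / δ)|)) := by
      refine Real.sqrt_le_sqrt ?_
      have := le_abs_self (1 + Real.log (1 / δ))
      linarith
    have e2 := Real.sq_sqrt (show 0 ≤ 2 * (infoGain κ η t A + |1 + Real.log (1 / δ)|) by positivity)
    have e3 := Real.sqrt_nonneg (2 * (infoGain κ η t A + 1 + Real.log (1 / δ)))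
    have e4 : √(2 * (infoGain κ η t A + 1 + Real.log (1 / δ))) ^ 2 ≤
        2 * (infoGain κ η t A + |1 + Real.log (1 / δ)|) := by
      rw [← e2]; gcongr
    nlinarith [sq_nonneg (2 * B - √(2 * (infoGain κ η t A + 1 + Real.log (1 / δ))))]
  have h6 := mul_le_mul_of_nonneg_right hb hI
  have h7 := mul_le_mul_of_nonneg_left h6 (show 0 ≤ 2 * (2 * (k + η ^ 2)) by positivity)
  linarith

/-- Simple regret is at most the regret of each step within the budget. -/
lemma simpleRegret_le {f : Pt d → ℝ} {lc ll Λ : ℝ} (hlc : 0 < lc) (hll : lc < ll) {t : ℕ}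
    (ht : (t + 1) * ll ≤ Λ) :
    simpleRegret X f lc ll x x' q Λ ≤ stepRegret X f (q t) (x t) (x' t) := by
  have hcost : ∀ a, lc ≤ cost lc ll a ∧ cost lc ll a ≤ ll := by
    intro a
    cases a
    · exact ⟨le_rfl, hll.le⟩
    · exact ⟨hll.le, le_rfl⟩
  refine csInf_le ?_ ⟨t, ?_, rfl⟩
  -- Every query costs at least `lc`, so only finitely many steps are affordable. Boundedness below
  -- is needed for the real infimum.
  · refine ((Set.finite_Iic ⌊Λ / lc⌋₊).image
      fun t => stepRegret X f (q t) (x t) (x' t)).bddBelow.mono ?_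
    rintro _ ⟨s, hs, rfl⟩
    refine ⟨s, ?_, rfl⟩
    have h1 : ∑ _i ∈ Finset.range (s + 1), lc ≤ Λ :=
      (Finset.sum_le_sum fun i _ => (hcost (q i)).1).trans hs
    rw [Finset.sum_const, Finset.card_range, nsmul_eq_mul] at h1
    push_cast at h1
    refine Nat.le_floor ?_
    rw [le_div_iff₀ hlc]
    linarith
  · calc ∑ s ∈ Finset.range (t + 1), cost lc ll (q s) ≤ ∑ _s ∈ Finset.range (t + 1), ll :=
          Finset.sum_le_sum fun i _ => (hcost (q i)).2
      _ = (t + 1) * ll := by simp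
      _ ≤ Λ := ht

lemma stepRegret_le {f : Pt d → ℝ} (a : Query) (p p' : Pt d) :
    stepRegret X f a p p' ≤ supOn X f - f p := by
  cases a
  · exact min_le_left _ _
  · exact le_rfl

lemma rate_nonneg (hB : 0 ≤ B) (n : ℕ) : 0 ≤ rate κ η B δ n A := by
  unfold rate
  positivity

end Pathwise

/-! ### Consequences of the confidence bands for the two phases. -/

section Regret

variable {d : ℕ} {κ : Pt d → Pt d → ℝ} {η r B δ k γ ζ L₁ L₂ : ℝ} {X A : Set (Pt d)}
  {x x' : ℕ → Pt d} {q : ℕ → Query} {y : ℕ → ℝ} {βr βl : ℕ → ℝ} {f fr fc : Pt d → ℝ} {T t : ℕ}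

lemma le_ucb {g : Pt d → ℝ} {β : ℕ → ℝ} {a : Query} {p : Pt d}
    (h : |g p - postMean κ η (stepsOf q a t) x y p| ≤ width κ η β a x q t p) :
    g p ≤ ucb κ η β a x q y t p := by
  have := (abs_le.1 h).2
  unfold ucb
  linarith

lemma ucb_le {g : Pt d → ℝ} {β : ℕ → ℝ} {a : Query} {p : Pt d}
    (h : |g p - postMean κ η (stepsOf q a t) x y p| ≤ width κ η β a x q t p) :
    ucb κ η β a x q y t p ≤ g p + 2 * width κ η β a x q t p := by
  have := (abs_le.1 h).1
  unfold ucb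
  linarith

lemma lcb_le {g : Pt d → ℝ} {β : ℕ → ℝ} {a : Query} {p : Pt d}
    (h : |g p - postMean κ η (stepsOf q a t) x y p| ≤ width κ η β a x q t p) :
    lcb κ η β a x q y t p ≤ g p := by
  have := (abs_le.1 h).1
  unfold lcb
  linarith

/-- A function with bounded bias has a small gap at the maximizers of the other function. -/
lemma gap_le (hX : IsCompact X) (hne : X.Nonempty) (hf : ContinuousOn f X)
    (hL₂ : 0 < L₂)
    (hbias : ∀ p ∈ X, |(supOn X fc - fc p) - (supOn X f - f p)| ≤ ζ)
    (hup : ∀ p ∈ X, supOn X fr - fr p ≤ L₂ * (supOn X fc - fc p)) :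
    ∃ p ∈ X, f p = supOn X f ∧ supOn X fr - L₂ * ζ ≤ fr p := by
  obtain ⟨p, hp, hfp⟩ := (isMax_supOn hX hne hf).1
  refine ⟨p, hp, hfp, ?_⟩
  have h1 := (abs_le.1 (hbias p hp)).2
  rw [hfp, sub_self, sub_zero] at h1
  have := (hup p hp).trans (mul_le_mul_of_nonneg_left h1 hL₂.le)
  linarith

/-- Optimism: the maximum of `fr` is at most the upper bound at its maximizer, hence at most that at
`x T`, which exceeds the lower bound by twice a width of at most `γ`. -/
lemma supOn_sub_le_lcb_exit (htraj : IsTrajectory κ η X βr βl L₂ ζ γ x q y)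
    (hT : IsExit κ η βr γ x q T) (hX : IsCompact X) (hne : X.Nonempty) (hfr : ContinuousOn fr X)
    (hband : ∀ t, ∀ p ∈ X, |fr p - postMean κ η (stepsOf q .comp t) x y p| ≤
      width κ η βr .comp x q t p) :
    supOn X fr - 2 * γ ≤ lcb κ η βr .comp x q y T (x T) := by
  obtain ⟨p, hp, hfp⟩ := (isMax_supOn hX hne hfr).1
  have h1 := htraj.phase_one_point T hT.2 hp
  have h2 := le_ucb (hband T p hp)
  have h3 := hT.1
  simp only [Set.mem_ofPred_eq] at h1
  unfold lcb
  unfold ucb at h1 h2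
  linarith

lemma supOn_sub_le_exit (htraj : IsTrajectory κ η X βr βl L₂ ζ γ x q y)
    (hT : IsExit κ η βr γ x q T) (hX : IsCompact X) (hne : X.Nonempty) (hfr : ContinuousOn fr X)
    (hband : ∀ t, ∀ p ∈ X, |fr p - postMean κ η (stepsOf q .comp t) x y p| ≤
      width κ η βr .comp x q t p) :
    supOn X fr - 2 * γ ≤ fr (x T) :=
  (supOn_sub_le_lcb_exit htraj hT hX hne hfr hband).trans (lcb_le (hband T _ (htraj.mem T)))

/-- Ensures that the threshold in the second phase never excludes a maximizer of `f`. -/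
lemma lcb_exit_le_supOn (htraj : IsTrajectory κ η X βr βl L₂ ζ γ x q y)
    (hX : IsCompact X) (hne : X.Nonempty) (hfr : ContinuousOn fr X)
    (hband : ∀ t, ∀ p ∈ X, |fr p - postMean κ η (stepsOf q .comp t) x y p| ≤
      width κ η βr .comp x q t p) :
    lcb κ η βr .comp x q y T (x T) ≤ supOn X fr :=
  (lcb_le (hband T _ (htraj.mem T))).trans ((isMax_supOn hX hne hfr).2 _ (htraj.mem T))

/-- After the first phase, direct queries are made in the reduced set, at the maximizers of an
upper confidence bound of `f` over a set that contains a maximizer of `f`. -/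
lemma label_step (htraj : IsTrajectory κ η X βr βl L₂ ζ γ x q y)
    (hT : IsExit κ η βr γ x q T) (hX : IsCompact X) (hne : X.Nonempty) (hfr : ContinuousOn fr X)
    (hband : ∀ t, ∀ p ∈ X, |fr p - postMean κ η (stepsOf q .comp t) x y p| ≤
      width κ η βr .comp x q t p)
    (hf : ContinuousOn f X) (hL₂ : 0 < L₂)
    (hbias : ∀ p ∈ X, |(supOn X fc - fc p) - (supOn X f - f p)| ≤ ζ)
    (hup : ∀ p ∈ X, supOn X fr - fr p ≤ L₂ * (supOn X fc - fc p)) (ht : q t = .label) :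
    x t ∈ reducedSet X fr L₂ ζ γ ∧
      ∃ p ∈ X, f p = supOn X f ∧ ucb κ η βl .label x q y t p ≤ ucb κ η βl .label x q y t (x t) := by
  have hTt : T < t := by
    by_contra hle
    have := htraj.phase_one_query t fun s hs => hT.2 s (by omega)
    rw [ht] at this
    cases this
  have hw : width κ η βr .comp x q t (x t) < γ := by
    by_contra hle
    have := (htraj.phase_two_query T t hT hTt).2 (not_lt.1 hle)
    rw [ht] at this
    cases this
  obtain ⟨p, hp, hfp, hgap⟩ := gap_le hX hne hf hL₂ hbias hup
  have hl := supOn_sub_le_lcb_exit htraj hT hX hne hfr hband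
  have hl' := lcb_exit_le_supOn (T := T) htraj hX hne hfr hband
  -- The upper bound at `p` is at least `fr p`, hence at least the maximum of `fr` minus `L₂ ζ`, and
  -- the threshold is no higher.
  have hpf : p ∈ feasible κ η X βr L₂ ζ x q y T t := by
    refine ⟨hp, ?_⟩
    have := le_ucb (hband t p hp)
    linarith
  obtain ⟨hfeas, hmax⟩ := htraj.phase_two_point T t hT hTt ⟨p, hpf⟩
  refine ⟨⟨htraj.mem t, ?_⟩, p, hp, hfp, hmax hpf⟩
  -- Of the `4γ` in the reduced set, `2γ` come from the current width and `2γ` from the lower bound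
  -- at the exit.
  have h1 := hfeas.2
  have h2 := ucb_le (hband t _ (htraj.mem t))
  linarith

/-- If all widths up to time `t` exceeded `γ`, the sum of the squared widths would exceed what the
information gain allows. -/
lemma exists_exit (hκ : (Matrix.of κ).PosSemidef) (hη : 0 < η) (hk : ∀ p ∈ X, κ p p ≤ k)
    (hB : 0 ≤ B) (hγ : 0 < γ) (hX : X.Nonempty)
    (htraj : IsTrajectory κ η X (beta κ η B δ X) βl L₂ ζ γ x q y) {t : ℕ}
    (ht : 2 * (γ ^ 2 + 2 * (k + η ^ 2) * beta κ η B δ X t ^ 2 * infoGain κ η t X) ≤ γ ^ 2 * t) :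
    ∃ T < t, IsExit κ η (beta κ η B δ X) γ x q T := by
  classical
  have h : ∃ s, s < t ∧ width κ η (beta κ η B δ X) .comp x q s (x s) ≤ γ := by
    by_contra! hcon
    have hsub : Finset.range t ⊆ stepsOf q .comp t := by
      intro s hs
      rw [Finset.mem_range] at hs
      exact mem_stepsOf.2 ⟨hs, htraj.phase_one_query s fun u hu => hcon u (hu.trans hs)⟩
    have := card_mul_sq_le hκ hη (fun t => hk _ (htraj.mem t)) hk hX hB hγ.le
      (fun s _ => htraj.mem s) hsub fun s hs => (hcon s (Finset.mem_range.1 hs)).le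
    rw [Finset.card_range] at this
    have h2 : 0 < γ ^ 2 := by positivity
    have h3 : (0 : ℝ) ≤ t * γ ^ 2 := by positivity
    linarith
  refine ⟨Nat.find h, (Nat.find_spec h).1, (Nat.find_spec h).2, fun s hs => ?_⟩
  have := Nat.find_min h hs
  rw [not_and, not_le] at this
  exact this (hs.trans (Nat.find_spec h).1)

/-- At least half of the queries are direct queries. -/
lemma le_two_mul_card_label (hκ : (Matrix.of κ).PosSemidef) (hη : 0 < η)
    (hk : ∀ p ∈ X, κ p p ≤ k) (hB : 0 ≤ B) (hγ : 0 < γ) (hX : X.Nonempty)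
    (htraj : IsTrajectory κ η X (beta κ η B δ X) βl L₂ ζ γ x q y)
    (hT : IsExit κ η (beta κ η B δ X) γ x q T) {t : ℕ}
    (ht : 2 * (γ ^ 2 + 2 * (k + η ^ 2) * beta κ η B δ X t ^ 2 * infoGain κ η t X) ≤ γ ^ 2 * t) :
    (t : ℝ) ≤ 2 * (stepsOf q .label t).card := by
  classical
  -- The exit step is the only comparison whose width may be below `γ`, so it is removed before
  -- counting.
  have hsub : (stepsOf q .comp t).erase T ⊆ stepsOf q .comp t := Finset.erase_subset _ _
  have hcomp := card_mul_sq_le hκ hη (fun t => hk _ (htraj.mem t)) hk hX hB hγ.le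
    (fun s _ => htraj.mem s) hsub fun s hs => by
      rw [Finset.mem_erase, mem_stepsOf] at hs
      rcases lt_or_gt_of_ne hs.1 with h | h
      · exact (hT.2 s h).le
      · exact (htraj.phase_two_query T s hT h).1 hs.2.2
  have h1 : ((stepsOf q .comp t).card : ℝ) ≤ ((stepsOf q .comp t).erase T).card + 1 := by
    have := Finset.pred_card_le_card_erase (s := stepsOf q .comp t) (a := T)
    exact_mod_cast (show (stepsOf q .comp t).card ≤ ((stepsOf q .comp t).erase T).card + 1 by omega)
  have h2 : (stepsOf q .comp t).card + (stepsOf q .label t).card = t := by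
    have := Finset.card_filter_add_card_filter_not (s := Finset.range t) (fun s => q s = .comp)
    have hlab : stepsOf q .label t = (Finset.range t).filter fun s => ¬ q s = .comp := by
      ext s
      cases h : q s <;> simp [mem_stepsOf, h]
    rw [hlab]
    convert this using 2
    · exact congrArg Finset.card (by ext s; simp [mem_stepsOf])
    · rw [Finset.card_range]
  have h3 : ((stepsOf q .comp t).card : ℝ) + (stepsOf q .label t).card = t := by exact_mod_cast h2
  have h4 : 0 < γ ^ 2 := by positivity
  have h5 : γ ^ 2 * (2 * ((stepsOf q .comp t).card : ℝ)) ≤ γ ^ 2 * t := by nlinarith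
  have h6 := le_of_mul_le_mul_left h5 h4
  linarith

/-- A lower bound on the regret of the direct queries. -/
lemma le_of_forall_le_regret (hκ : (Matrix.of κ).PosSemidef) (hη : 0 < η)
    (hkx : ∀ t, κ (x t) (x t) ≤ k) (hk : ∀ p ∈ A, κ p p ≤ k) (hA : A.Nonempty) (hB : 0 ≤ B)
    {ρ : ℝ} (hρ : 0 ≤ ρ) {t : ℕ} (ht : 0 < t) (hcard : (t : ℝ) ≤ 2 * (stepsOf q .label t).card)
    (hx : ∀ s ∈ stepsOf q .label t, x s ∈ A)
    (hreg : ∀ s ∈ stepsOf q .label t,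
      ρ ≤ 2 * width κ η (beta κ η B δ A) .label x q s (x s)) :
    ρ ≤ 4 * √(k + η ^ 2) * beta κ η B δ A t * √(infoGain κ η t A / t) := by
  have ht0 : (0 : ℝ) < t := by exact_mod_cast ht
  have hk0 : 0 ≤ k := by
    obtain ⟨p, hp⟩ := hA
    exact (hκ.diag_nonneg (i := p)).trans (hk p hp)
  have hI := infoGain_nonneg hκ hη t A
  -- The widths are at least `ρ/2` at no fewer than `t/2` steps; this is the origin of the factor 4.
  have h := card_mul_sq_le (δ := δ) hκ hη hkx hk hA hB (c := ρ / 2) (by positivity) hx subset_rfl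
    fun s hs => by linarith [hreg s hs]
  have hb := beta_nonneg (κ := κ) (η := η) (δ := δ) (A := A) hB t
  refine abs_le_of_sq_le_sq' ?_ (by positivity) |>.2
  rw [mul_pow, mul_pow, mul_pow, Real.sq_sqrt (by positivity), Real.sq_sqrt (by positivity)]
  have h2 : (t : ℝ) * ρ ^ 2 ≤ 2 * (stepsOf q .label t).card * ρ ^ 2 := by gcongr
  rw [← mul_div_assoc, le_div_iff₀ ht0]
  linarith

/-- The confidence multiplier is at most a multiple of the factor in the rate. -/
lemma beta_le (hI : 0 ≤ infoGain κ η t A) (hB : 0 < B) (hδ : 0 < δ) (hδ1 : δ < 1) :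
    beta κ η B δ A t ≤ (2 + 2 / B) * (B + √(infoGain κ η t A + Real.log (1 / δ))) := by
  have hl : 0 ≤ Real.log (1 / δ) := Real.log_nonneg (by rw [le_div_iff₀ hδ]; linarith)
  unfold beta
  set v := infoGain κ η t A + Real.log (1 / δ) with hv
  have hv0 : 0 ≤ v := by positivity
  have h1 : √(2 * (infoGain κ η t A + 1 + Real.log (1 / δ))) ≤ 2 * √v + 2 := by
    refine Real.sqrt_le_iff.2 ⟨by positivity, ?_⟩
    have := Real.sq_sqrt hv0
    have h2 := Real.sqrt_nonneg v
    nlinarith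
  -- The additive constant 2 is absorbed into a multiple of `B`, so the factor does not depend on
  -- `δ`.
  have h2 : 2 / B * B = 2 := by field_simp
  have h3 : 0 ≤ 2 / B * √v := by positivity
  nlinarith

end Regret

/-! ### The regret bound on the good event. -/

section Bound

variable {d : ℕ} {κ : Pt d → Pt d → ℝ} {η r B δ k γ ζ L₁ L₂ lc ll : ℝ} {X : Set (Pt d)}
  {x x' : ℕ → Pt d} {q : ℕ → Query} {y : ℕ → ℝ} {f fr fc : Pt d → ℝ}

lemma reducedSet_nonempty (hX : IsCompact X) (hne : X.Nonempty) (hfr : ContinuousOn fr X)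
    (hγ : 0 ≤ γ) (hζ : 0 ≤ ζ) (hL₂ : 0 ≤ L₂) : (reducedSet X fr L₂ ζ γ).Nonempty := by
  obtain ⟨p, hp, hfp⟩ := (isMax_supOn hX hne hfr).1
  refine ⟨p, hp, ?_⟩
  have := mul_nonneg hL₂ hζ
  linarith

/-- The regret bound on the event that both likelihood ratios stay below `e / δ`. -/
lemma simpleRegret_le_min (hκ : (Matrix.of κ).PosSemidef) (hκc : Continuous (Function.uncurry κ))
    (hη : 0 < η) (hζ : 0 ≤ ζ) (hγ : 0 < γ) (hB : 0 ≤ B) (hδ : 0 < δ) (hδ1 : δ < 1)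
    (hlc : 0 < lc) (hll : lc < ll) (hk : ∀ p ∈ box d r, κ p p ≤ k) {t₀ : ℕ} (ht₀ : 1 ≤ t₀)
    (hlate : ∀ t ≥ t₀, 2 * (γ ^ 2 + 2 * (k + η ^ 2) * beta κ η B δ (box d r) t ^ 2 *
      infoGain κ η t (box d r)) ≤ γ ^ 2 * t)
    (hXr : X ⊆ box d r) (hX : IsCompact X) (hne : X.Nonempty)
    (hf : InRKHSBall κ X B f) (hfr : InRKHSBall κ X B fr)
    (hbias : ∀ p ∈ X, |(supOn X fc - fc p) - (supOn X f - f p)| ≤ ζ)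
    (hL₁ : 0 < L₁) (hL₂ : 0 < L₂)
    (huse : ∀ p ∈ X, 1 / L₁ * (supOn X fc - fc p) ≤ supOn X fr - fr p ∧
      supOn X fr - fr p ≤ L₂ * (supOn X fc - fc p))
    (htraj : IsTrajectory κ η X (beta κ η B δ X) (beta κ η B δ (reducedSet X fr L₂ ζ γ))
      L₂ ζ γ x q y)
    (hcomp : ∀ t, likelihood κ η (stepsOf q .comp t) x (fun s => y s - fr (x s)) ≤
      Real.exp 1 / δ)
    (hlabel : ∀ t, likelihood κ η (stepsOf q .label t) x (fun s => y s - f (x s)) ≤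
      Real.exp 1 / δ) {Λ : ℝ} (hΛ : t₀ * ll ≤ Λ) :
    simpleRegret X f lc ll x x' q Λ ≤
      min (2 * L₁ * γ + ζ +
          (4 * √(k + η ^ 2) * (2 + 2 / B) + 1) * rate κ η B δ ⌈Λ / lc⌉₊ X)
        ((4 * √(k + η ^ 2) * (2 + 2 / B) + 1) *
          rate κ η B δ ⌊Λ / ll⌋₊ (reducedSet X fr L₂ ζ γ)) := by
  set H := reducedSet X fr L₂ ζ γ with hH
  have hfc := hf.continuousOn hκ hκc
  have hfrc := hfr.continuousOn hκ hκc
  have hkX : ∀ p ∈ X, κ p p ≤ k := fun p hp => hk p (hXr hp)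
  have hHX : H ⊆ X := fun p hp => hp.1
  have hkH : ∀ p ∈ H, κ p p ≤ k := fun p hp => hkX p (hHX hp)
  have hHne : H.Nonempty := reducedSet_nonempty hX hne hfrc hγ.le hζ hL₂.le
  have hk0 : 0 ≤ k := by
    obtain ⟨p, hp⟩ := hne
    exact (hκ.diag_nonneg (i := p)).trans (hkX p hp)
  -- `t₀` was chosen for the whole cube, so that it does not depend on `X`; monotonicity in the set
  -- transfers it.
  have hlateX : ∀ t ≥ t₀, 2 * (γ ^ 2 + 2 * (k + η ^ 2) * beta κ η B δ X t ^ 2 *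
      infoGain κ η t X) ≤ γ ^ 2 * t := by
    intro t ht
    refine le_trans ?_ (hlate t ht)
    have h1 := infoGain_mono_set hκ hη hk hne hXr t
    have h2 := beta_mono_set (B := B) (δ := δ) hκ hη hk hne hXr t
    have h3 := beta_nonneg (κ := κ) (η := η) (δ := δ) (A := X) hB t
    have h4 := infoGain_nonneg hκ hη t X
    gcongr
  obtain ⟨T, hTt, hT⟩ := exists_exit hκ hη hkX hB hγ hne htraj (hlateX t₀ le_rfl)
  have hband : ∀ t, ∀ p ∈ X, |fr p - postMean κ η (stepsOf q .comp t) x y p| ≤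
      width κ η (beta κ η B δ X) .comp x q t p := fun t p hp =>
    hfr.abs_sub_postMean_le_width hκ hη htraj.mem hB hδ hkX hne (fun s _ => htraj.mem s)
      (hcomp t) hp
  -- The order matters: membership in the reduced set uses only the Borda band, and it is what
  -- allows the band of `f` to use the smaller information gain of that set.
  have hstep : ∀ t, q t = .label → x t ∈ H ∧ ∃ p ∈ X, f p = supOn X f ∧
      ucb κ η (beta κ η B δ H) .label x q y t p ≤ ucb κ η (beta κ η B δ H) .label x q y t (x t) :=
    fun t ht => label_step htraj hT hX hne hfrc hband hfc hL₂ hbias (fun p hp => (huse p hp).2) ht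
  have hxH : ∀ t, ∀ s ∈ stepsOf q .label t, x s ∈ H := fun t s hs =>
    (hstep s (mem_stepsOf.1 hs).2).1
  have hbandl : ∀ t, ∀ p ∈ X, |f p - postMean κ η (stepsOf q .label t) x y p| ≤
      width κ η (beta κ η B δ H) .label x q t p := fun t p hp =>
    hf.abs_sub_postMean_le_width hκ hη htraj.mem hB hδ hkH hHne (hxH t) (hlabel t) hp
  have hregret : ∀ t : ℕ, (t + 1) * ll ≤ Λ →
      simpleRegret X f lc ll x x' q Λ ≤ supOn X f - f (x t) := fun t ht =>
    (simpleRegret_le hlc hll ht).trans (stepRegret_le _ _ _)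
  have hll0 : 0 < ll := hlc.trans hll
  have hearly : ∀ t < t₀, ((t : ℝ) + 1) * ll ≤ Λ := by
    intro t ht
    refine le_trans ?_ hΛ
    have : ((t : ℝ) + 1) ≤ t₀ := by exact_mod_cast ht
    gcongr
  have hC : 0 < 4 * √(k + η ^ 2) * (2 + 2 / B) + 1 := by positivity
  refine le_min ?_ ?_
  · have h1 := hregret T (hearly T hTt)
    have h2 := supOn_sub_le_exit htraj hT hX hne hfrc hband
    have h3 := (abs_le.1 (hbias _ (htraj.mem T))).1
    have h4 := (huse _ (htraj.mem T)).1
    have h5 : supOn X fc - fc (x T) ≤ L₁ * (2 * γ) := by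
      rw [one_div, inv_mul_le_iff₀ hL₁] at h4
      exact h4.trans (mul_le_mul_of_nonneg_left (by linarith) hL₁.le)
    -- The rate term of the first bound is used only through its sign.
    have h6 := mul_nonneg hC.le (rate_nonneg (κ := κ) (η := η) (δ := δ) (A := X) hB ⌈Λ / lc⌉₊)
    linarith
  set n := ⌊Λ / ll⌋₊ with hn
  have hr0 := rate_nonneg (κ := κ) (η := η) (δ := δ) (A := H) hB n
  rcases le_or_gt (simpleRegret X f lc ll x x' q Λ) 0 with hR | hR
  · exact hR.trans (mul_nonneg hC.le hr0)
  -- For `B = 0` the quotient `2 / B` has the default value 0 and cannot absorb the constant; but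
  -- then `f` vanishes on `X` and the regret is not positive.
  have hBpos : 0 < B := by
    refine hB.lt_of_ne fun h0 => ?_
    have hzero : ∀ p ∈ X, f p = 0 := fun p hp => by
      have := hf.abs_le hκ hp
      rw [← h0, zero_mul] at this
      exact abs_nonpos_iff.1 this
    obtain ⟨p, hp, hfp⟩ := (isMax_supOn hX hne hfc).1
    have := hregret 0 (by exact_mod_cast hearly 0 ht₀)
    rw [← hfp, hzero p hp, hzero _ (htraj.mem 0)] at this
    linarith
  have htn : t₀ ≤ n := by
    refine Nat.le_floor ?_
    rwa [le_div_iff₀ hll0]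
  have hnΛ : n * ll ≤ Λ := by
    rw [← le_div_iff₀ hll0]
    refine Nat.floor_le (div_nonneg ?_ hll0.le)
    exact (mul_nonneg (Nat.cast_nonneg t₀) hll0.le).trans hΛ
  have hcard := le_two_mul_card_label hκ hη hkX hB hγ hne htraj hT (hlateX n htn)
  have hmain := le_of_forall_le_regret (δ := δ) hκ hη (fun t => hkX _ (htraj.mem t)) hkH hHne hB
    hR.le (show 0 < n by omega) hcard (hxH n) fun s hs => by
      have hs' := mem_stepsOf.1 hs
      obtain ⟨-, p, hp, hfp, hle⟩ := hstep s hs'.2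
      have h1 := hregret s (by
        refine le_trans ?_ hnΛ
        have : ((s : ℝ) + 1) ≤ n := by exact_mod_cast hs'.1
        gcongr)
      have h2 := le_ucb (hbandl s p hp)
      have h3 := ucb_le (hbandl s _ (htraj.mem s))
      linarith
  have hI := infoGain_nonneg hκ hη n H
  have hb := beta_le (t := n) hI hBpos hδ hδ1
  calc simpleRegret X f lc ll x x' q Λ ≤
        4 * √(k + η ^ 2) * beta κ η B δ H n * √(infoGain κ η n H / n) := hmain
    _ ≤ 4 * √(k + η ^ 2) * ((2 + 2 / B) * (B + √(infoGain κ η n H + Real.log (1 / δ)))) *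
          √(infoGain κ η n H / n) := by gcongr
    _ = 4 * √(k + η ^ 2) * (2 + 2 / B) * rate κ η B δ n H := by rw [rate]; ring
    _ ≤ _ := by linarith

end Bound

end DuelingChoice

/-! ### The theorem: choice of constants and union bound. -/

theorem theorem2
    (d : ℕ) (r η : ℝ) (hr : 0 ≤ r)
    -- the noise level; at least `1/2`, so that it also covers the `{0, 1}`-valued comparisons
    (hη : 1 / 2 ≤ η)
    (κ : DuelingChoice.Pt d → DuelingChoice.Pt d → ℝ)
    (hκ : (Matrix.of κ).PosSemidef) (hκc : Continuous (Function.uncurry κ))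
    (hκa : DuelingChoice.AdmissibleKernel d r η κ)
    (ζ γ B : ℝ) (hζ : 0 ≤ ζ) (hγ : 0 < γ) (hB : 0 ≤ B) :
    ∃ C : ℝ, 0 < C ∧
    ∀ δ lc ll : ℝ, 0 < δ → δ < 1 → 0 < lc → lc < ll →
    ∃ Λ₀ : ℝ,
    -- the feature space, the target `f`, the comparison function `fc`, the preference
    -- probabilities and the law `ν` of the random opponent
    ∀ (X : Set (DuelingChoice.Pt d)), X ⊆ DuelingChoice.box d r → IsCompact X → X.Nonempty →
    ∀ (f fc : DuelingChoice.Pt d → ℝ) (pref : DuelingChoice.Pt d → DuelingChoice.Pt d → ℝ)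
      (ν : Measure (DuelingChoice.Pt d)), IsProbabilityMeasure ν → ν Xᶜ = 0 →
      Measurable (Function.uncurry pref) →
      (∀ x ∈ X, ∀ u ∈ X, 0 ≤ pref x u ∧ pref x u ≤ 1) →
    -- smoothness
    DuelingChoice.InRKHSBall κ X B f →
    DuelingChoice.InRKHSBall κ X B (DuelingChoice.borda pref ν) →
    -- bounded bias of the comparison function near the optimum
    (∀ x ∈ X, |(DuelingChoice.supOn X fc - fc x) - (DuelingChoice.supOn X f - f x)| ≤ ζ) →
    -- usefulness of the comparisons
    ∀ L₁ L₂ : ℝ, 0 < L₁ → 0 < L₂ →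
    (∀ x ∈ X,
      1 / L₁ * (DuelingChoice.supOn X fc - fc x) ≤
        DuelingChoice.supOn X (DuelingChoice.borda pref ν) - DuelingChoice.borda pref ν x ∧
      DuelingChoice.supOn X (DuelingChoice.borda pref ν) - DuelingChoice.borda pref ν x ≤
        L₂ * (DuelingChoice.supOn X fc - fc x)) →
    -- a run of the algorithm
    ∀ (Ω : Type*) (mΩ : MeasurableSpace Ω) (P : Measure Ω), IsProbabilityMeasure P →
    ∀ (ℱ : Filtration ℕ mΩ) (x x' : ℕ → Ω → DuelingChoice.Pt d)
      (q : ℕ → Ω → DuelingChoice.Query) (y : ℕ → Ω → ℝ),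
    DuelingChoice.IsFeedback P ℱ η f pref ν x x' q y →
    (∀ ω, DuelingChoice.IsTrajectory κ η X
      (DuelingChoice.beta κ η B δ X)
      (DuelingChoice.beta κ η B δ
        (DuelingChoice.reducedSet X (DuelingChoice.borda pref ν) L₂ ζ γ))
      L₂ ζ γ (fun t => x t ω) (fun t => q t ω) (fun t => y t ω)) →
    -- with probability at least `1 - δ`, the bound holds for all budgets from `Λ₀` on
    P {ω | ¬ ∀ Λ : ℝ, Λ₀ ≤ Λ →
      DuelingChoice.simpleRegret X f lc ll (fun t => x t ω) (fun t => x' t ω)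
        (fun t => q t ω) Λ ≤
      min
        (2 * L₁ * γ + ζ + C * DuelingChoice.rate κ η B δ ⌈Λ / lc⌉₊ X)
        (C * DuelingChoice.rate κ η B δ ⌊Λ / ll⌋₊
          (DuelingChoice.reducedSet X (DuelingChoice.borda pref ν) L₂ ζ γ))} ≤
      ENNReal.ofReal δ := by
  have hη0 : 0 < η := by linarith
  obtain ⟨k, hk1, hk⟩ := DuelingChoice.exists_kernel_bound r hκc
  refine ⟨4 * √(k + η ^ 2) * (2 + 2 / B) + 1, by positivity, ?_⟩
  intro δ lc ll hδ hδ1 hlc hll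
  obtain ⟨t₀, ht₀, hlate⟩ := DuelingChoice.exists_forall_beta_sq_mul_infoGain_le (B := B) (δ := δ)
    hκ hη0 (zero_le_one.trans hk1) hγ (hκa.isLittleO hκ hη0 hr)
  -- This budget pays for `t₀` steps of either type.
  refine ⟨t₀ * ll, ?_⟩
  intro X hXr hX hne f fc pref ν hν hνX hpm hpref hf hfr hbias L₁ L₂ hL₁ hL₂ huse Ω mΩ P hP ℱ
    x x' q y hfb htraj
  have hx : ∀ t ω, x t ω ∈ X := fun t ω => (htraj ω).mem t
  have hlabel := hfb.isNoise_label hη0 (hf.continuousOn hκ hκc) hx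
  have hcomp := hfb.isNoise_comp hνX hpm hpref (hfr.continuousOn hκ hκc) hx
  have he : 2 < Real.exp 1 := by linarith [Real.exp_one_gt_d9]
  have hc : 1 < Real.exp 1 / δ := by
    rw [lt_div_iff₀ hδ]
    linarith
  -- For comparisons the noise interval has length 1, and `1 ≤ 2 η` is where the lower bound on the
  -- noise level enters.
  have h1 := DuelingChoice.measure_likelihoodProcess_ge hκ hη0 hκc hcomp one_pos (by linarith) hc
  have h2 := DuelingChoice.measure_likelihoodProcess_ge hκ hη0 hκc hlabel (by linarith) le_rfl hc
  refine (measure_mono ?_).trans ((measure_union_le _ _).trans ((add_le_add h1 h2).trans ?_))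
  · intro ω hω
    by_contra hcon
    simp only [Set.mem_union, Set.mem_ofPred_eq, not_or, not_exists, not_le] at hcon
    exact hω fun Λ hΛ => DuelingChoice.simpleRegret_le_min hκ hκc hη0 hζ hγ hB hδ hδ1 hlc hll hk ht₀
      hlate hXr hX hne hf hfr hbias hL₁ hL₂ huse (htraj ω) (fun t => (hcon.1 t).le)
      (fun t => (hcon.2 t).le) hΛ
  · rw [← ENNReal.ofReal_add (by positivity) (by positivity)]
    refine ENNReal.ofReal_le_ofReal ?_
    -- The two failure probabilities add up to `2 δ / exp 1`, at most `δ` as `exp 1 > 2`.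
    rw [one_div_div, ← add_div, div_le_iff₀ (by positivity)]
    nlinarith
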